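/- Let $f,g:\mathbb C\to\mathbb C$ be polynomials with $f(z)=z+z^2+az^3+O(z^4)$ as $z\to0$ for some $a\in\mathbb C$, and $g(w)=w-w^2+O(w^3)$ as $w\to0$. Let $$\mathcal B_f=\{z\in\mathbb C:\ f^{\circ n}(z)\to 0 \text{ as } n\to\infty \text{ and } f^{\circ n}(z)\neq 0\text{ for all }n\ge0\}$$ be the parabolic basin of $0$. For $z\in\mathcal B_f$ and $Z\in\mathbb C$ the limits $$\phi_f(z)=\lim_{m\to\infty}\Bigl(-\frac1{f^{\circ m}(z)}-m-(1-a)\log m\Bigr),\qquad \psi_f(Z)=\lim_{m\to\infty} f^{\circ m}\Bigl(-\frac{1}{Z-m+(1-a)\log m}\Bigr)$$ exist; $\phi_f:\mathcal B_f\to\mathbb C$ and $\psi_f:\mathbb C\to\mathbb C$ are the normalized attracting Fatou coordinate and repelling Fatou parameterization of $f$, and $\mathcal L_f:=\psi_f\circ\phi_f:\mathcal B_f\to\mathbb C$ is the Lavaurs map of $f$ with phase $0$. Suppose that $\mathcal L_f$ has an attracting fixed point, i.e. there is $\xi\in\mathcal B_f$ with $\mathcal L_f(\xi)=\xi$ and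 $|\mathcal L_f'(\xi)|<1$. Then the skew product $$P:\mathbb C^2\to\mathbb C^2,\qquad P(z,w)=\Bigl(f(z)+\frac{\pi^2}{4}w,\ g(w)\Bigr)$$ has a wandering Fatou component $\Omega$ such that the forward orbit under $P$ of every point of $\Omega$ is bounded in $\mathbb C^2$. Here the Fatou set of $P$ is the largest open subset of $\mathbb C^2$ on which the sequence of iterates $(P^{\circ n})_{n\ge0}$ is locally equicontinuous with respect to the usual Euclidean metric on the source and the (Fubini--Study) metric of $\mathbb P^2(\mathbb C)\supset\mathbb C^2$ on the target; a Fatou component is a connected component of the Fatou set; and a Fatou component $\Omega$ is wandering if the sets $P^{\circ i}(\Omega)$, $i\ge0$, are pairwise disjoint. -/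

import Mathlib

open Filter Topology Polynomial

noncomputable section

namespace LavaursSkew

/-- The parabolic basin of `0`: the points whose orbit under `f` converges to `0` without ever
being equal to `0`. -/
def parabolicBasin (f : ℂ[X]) : Set ℂ :=
  {z | Tendsto (fun n : ℕ => (fun x => f.eval x)^[n] z) atTop (𝓝 0) ∧
    ∀ n : ℕ, (fun x => f.eval x)^[n] z ≠ 0}

/-- The attracting Fatou coordinate of `f(z) = z + z² + a z³ + O(z⁴)` on its parabolic basin:
`φ_f(z) = lim (-1 / fᵐ(z) - m - (1 - a) log m)`. It satisfies `φ_f(f(z)) = φ_f(z) + 1` and has the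
normalization `φ_f(z) = -1/z - (1 - a) log(-1/z) + o(1)` as `Re(-1/z) → +∞`. (The limit exists at
every point of the parabolic basin; values elsewhere are irrelevant.) -/
def attractingFatouCoordinate (f : ℂ[X]) (z : ℂ) : ℂ :=
  limUnder atTop fun m : ℕ =>
    -1 / (fun x => f.eval x)^[m] z - (m : ℂ) - (1 - f.coeff 3) * (Real.log m : ℂ)

/-- The repelling Fatou parameterization of `f(z) = z + z² + a z³ + O(z⁴)`:
`ψ_f(Z) = lim fᵐ(-1 / (Z - m + (1 - a) log m))`. It satisfies `ψ_f(Z + 1) = f(ψ_f(Z))` and has the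
normalization `-1/ψ_f(Z) = Z + (1 - a) log(-Z) + o(1)` as `Re Z → -∞`. (The limit exists for every
complex `Z`.) -/
def repellingFatouParameterization (f : ℂ[X]) (Z : ℂ) : ℂ :=
  limUnder atTop fun m : ℕ =>
    (fun x => f.eval x)^[m] (-1 / (Z - (m : ℂ) + (1 - f.coeff 3) * (Real.log m : ℂ)))

/-- The Lavaurs map of phase `0`, `𝓛_f = ψ_f ∘ φ_f`, to be considered on the parabolic basin. -/
def lavaursMap (f : ℂ[X]) (z : ℂ) : ℂ :=
  repellingFatouParameterization f (attractingFatouCoordinate f z)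

/-- `ξ` is an attracting (possibly superattracting) fixed point of the Lavaurs map
`𝓛_f : 𝓑_f → ℂ`: it lies in the basin, is fixed, and its multiplier has modulus less than one. -/
def IsAttractingFixedPointOfLavaurs (f : ℂ[X]) (ξ : ℂ) : Prop :=
  ξ ∈ parabolicBasin f ∧ lavaursMap f ξ = ξ ∧
    ∃ μ : ℂ, HasDerivAt (lavaursMap f) μ ξ ∧ ‖μ‖ < 1

/-- The skew product `P(z, w) = (f(z) + (π² / 4) w, g(w))`. -/
def skewProduct (f g : ℂ[X]) (p : ℂ × ℂ) : ℂ × ℂ :=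
  (f.eval p.1 + (Real.pi : ℂ) ^ 2 / 4 * p.2, g.eval p.2)

/-- The chordal distance of the projective plane, on the affine chart `ℂ²`: for the points
`[z : w : 1]` and `[z' : w' : 1]` it is the norm of the exterior product of the two vectors divided
by the product of their norms (the sine of their Fubini–Study distance). -/
def chordalDist (p q : ℂ × ℂ) : ℝ :=
  √(‖p.1 - q.1‖ ^ 2 + ‖p.2 - q.2‖ ^ 2 + ‖p.1 * q.2 - q.1 * p.2‖ ^ 2) /
    (√(‖p.1‖ ^ 2 + ‖p.2‖ ^ 2 + 1) * √(‖q.1‖ ^ 2 + ‖q.2‖ ^ 2 + 1))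

/-- The iterates of `P` are locally equicontinuous on `U`, as maps into the projective plane. -/
def IteratesEquicontinuousOn (P : ℂ × ℂ → ℂ × ℂ) (U : Set (ℂ × ℂ)) : Prop :=
  ∀ x ∈ U, ∀ ε > 0, ∀ᶠ y in 𝓝 x, ∀ n : ℕ, chordalDist (P^[n] x) (P^[n] y) < ε

/-- The Fatou set of `P` in `ℂ²`: the largest open set on which the iterates of `P` are locally
equicontinuous. -/
def fatouSet (P : ℂ × ℂ → ℂ × ℂ) : Set (ℂ × ℂ) :=
  ⋃₀ {U | IsOpen U ∧ IteratesEquicontinuousOn P U}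

/-- A Fatou component of `P`: a connected component of its Fatou set. -/
def IsFatouComponent (P : ℂ × ℂ → ℂ × ℂ) (Ω : Set (ℂ × ℂ)) : Prop :=
  ∃ x ∈ fatouSet P, Ω = connectedComponentIn (fatouSet P) x

/-- A Fatou component is wandering if its forward images are pairwise disjoint; in particular it is
not preperiodic. -/
def IsWanderingFatouComponent (P : ℂ × ℂ → ℂ × ℂ) (Ω : Set (ℂ × ℂ)) : Prop :=
  IsFatouComponent P Ω ∧ ∀ i j : ℕ, i ≠ j → Disjoint (P^[i] '' Ω) (P^[j] '' Ω)

end LavaursSkew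

end

/-! This is parabolic implosion driven by the second coordinate. Orbits of g satisfy 1/w = N + O(log
N), where N grows by one per step, so the first coordinate moves by z ↦ f(z) + ε² + (small error)
with ε = π/(2√N). For frozen ε this map is close to the time-one flow of z² + ε², whose solutions
are z = -ε cot χ with χ growing at speed ε. Since ε is the derivative of π√N, the angle π(√N - n)
runs from 0 to π while N runs from n² to (n+1)². Thus 2n+1 steps carry the orbit once through the
gate, from the attracting to the repelling side of 0, with phase 0. The factor π²/4 is what makes
this synchronization exact.

The core is `exists_lavaurs_convergence`: near a point of the basin, these 2n+1 steps converge
uniformly to the Lavaurs map as n → ∞. The orbit is written as -ε cot χ with χ equal to the expected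
angle plus v time units. The discretization makes v drift by logarithmic amounts, but `gatePhase`,
which adds the compensating terms, is conserved to second order (`exists_gate_step`). The errors sum
to O(1/k + σ) between the times k and 2n+1-k (`exists_gate_passage`). For fixed k and n → ∞, the
phase equals an approximate attracting Fatou coordinate at the entrance and a repelling one at the
exit (`gate_entry`, `gate_exit`). `exists_attracting` and `exists_repelling` relate these to the
true Fatou coordinate and parameterization, with an error that is small for large k.

An attracting fixed point ξ of the Lavaurs map then attracts a product open set along the times n² -
n₀² (`exists_tendsto_iterate`). An orbit returning infinitely often to a bounded region never enters
the escape region, so orbits from this set are uniformly bounded and the set lies in the Fatou set.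
A Vitali argument (`tendsto_of_mem_connectedComponentIn_fatouSet`) spreads the convergence to (ξ, 0)
over the whole Fatou component Ω. On the i-th image of Ω the same times give the limit (fⁱ(ξ), 0).
These limits are distinct because ξ lies in the parabolic basin, so the images are disjoint. -/

namespace LavaursSkew

/-! ### The map f near infinity, in the coordinate Z = -1/z -/

/-- The polynomial `f` in the coordinate `Z = -1 / z`. -/
noncomputable def atInfinity (f : ℂ[X]) (Z : ℂ) : ℂ := -1 / f.eval (-1 / Z)

lemma neg_one_div_neg_one_div (z : ℂ) : -1 / (-1 / z) = z := by
  rcases eq_or_ne z 0 with rfl | h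
  · simp
  · field_simp

lemma atInfinity_iterate (f : ℂ[X]) (n : ℕ) (Z : ℂ) :
    (atInfinity f)^[n] Z = -1 / (fun x => f.eval x)^[n] (-1 / Z) := by
  induction n with
  | zero => simp
  | succ n ih =>
    rw [Function.iterate_succ_apply', ih, Function.iterate_succ_apply', atInfinity,
      neg_one_div_neg_one_div]

lemma exists_norm_eval_le (q : ℂ[X]) (r : ℝ) : ∃ B : ℝ, 0 ≤ B ∧ ∀ z : ℂ, ‖z‖ ≤ r → ‖q.eval z‖ ≤ B := by
  obtain ⟨B, hB⟩ := (isCompact_closedBall (0 : ℂ) r).exists_bound_of_continuousOn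
    (q.continuous.continuousOn)
  exact ⟨max B 0, le_max_right _ _, fun z hz => (hB z (by simpa using hz)).trans (le_max_left _ _)⟩

lemma exists_eval_eq {f : ℂ[X]} (h0 : f.coeff 0 = 0) (h1 : f.coeff 1 = 1) (h2 : f.coeff 2 = 1) :
    ∃ q : ℂ[X], ∀ z, f.eval z = z + z ^ 2 + f.coeff 3 * z ^ 3 + z ^ 4 * q.eval z := by
  refine ⟨f.divX.divX.divX.divX, fun z => ?_⟩
  have key : ∀ p : ℂ[X], p.eval z = p.divX.eval z * z + p.coeff 0 := fun p => by
    conv_lhs => rw [← divX_mul_X_add p]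
    simp
  rw [key f, key f.divX, key f.divX.divX, key f.divX.divX.divX]
  simp only [coeff_divX, h0, h1, h2, Nat.reduceAdd, zero_add]
  ring

/-- Factoring f(z) = z(1 + z p(z)) turns the displacement at Z into H(-1/Z) with H = p/(1 + zp),
which is smooth at 0. The last estimate is the Lipschitz bound for H. Its factor 1/(‖Z‖‖Z'‖) is
summable along orbits and so controls their distortion. -/
lemma exists_atInfinity_bound {f : ℂ[X]} (h0 : f.coeff 0 = 0) (h1 : f.coeff 1 = 1)
    (h2 : f.coeff 2 = 1) :
    ∃ R C : ℝ, 1 ≤ R ∧ 0 ≤ C ∧ ∀ Z : ℂ, R ≤ ‖Z‖ →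
      ‖atInfinity f Z - Z - 1‖ ≤ 1 / 10 ∧
      ‖atInfinity f Z - Z - 1 - (1 - f.coeff 3) / Z‖ ≤ C / ‖Z‖ ^ 2 ∧
      ∀ Z' : ℂ, R ≤ ‖Z'‖ →
        ‖(atInfinity f Z - Z) - (atInfinity f Z' - Z')‖ ≤ C * (‖Z - Z'‖ / (‖Z‖ * ‖Z'‖)) := by
  obtain ⟨q, hq⟩ := exists_eval_eq h0 h1 h2
  set a := f.coeff 3 with ha
  let p : ℂ[X] := 1 + Polynomial.C a * X + X ^ 2 * q
  have hp : ∀ z, p.eval z = 1 + a * z + z ^ 2 * q.eval z := fun z => by simp [p]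
  let H : ℂ → ℂ := fun z => p.eval z / (1 + z * p.eval z)
  have hcd : ContDiffAt ℂ 1 H 0 := by
    have hpc : ContDiff ℂ 1 (fun z : ℂ => p.eval z) := by
      simpa using p.contDiff_aeval (𝕜 := ℂ) 1
    exact (hpc.contDiffAt).div (contDiffAt_const.add (contDiffAt_id.mul hpc.contDiffAt)) (by simp)
  obtain ⟨K, t, ht, hK⟩ := hcd.exists_lipschitzOnWith
  have hc : ContinuousAt H 0 := hcd.continuousAt
  have hH0 : H 0 = 1 := by simp [H, hp]
  have hden : ContinuousAt (fun z : ℂ => 1 + z * p.eval z) 0 := by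
    have := p.continuous
    fun_prop
  have e1 : ∀ᶠ z in 𝓝 (0 : ℂ), ‖H z - 1‖ < 1 / 10 := by
    have := hc.eventually (Metric.ball_mem_nhds (H 0) (show (0 : ℝ) < 1 / 10 by norm_num))
    filter_upwards [this] with z hz
    rwa [hH0, dist_eq_norm] at hz
  have e2 : ∀ᶠ z in 𝓝 (0 : ℂ), ‖(1 + z * p.eval z) - 1‖ < 1 / 2 := by
    have := hden.eventually (Metric.ball_mem_nhds _ (show (0 : ℝ) < 1 / 2 by norm_num))
    filter_upwards [this] with z hz
    simpa [dist_eq_norm] using hz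
  obtain ⟨r, hr, hball⟩ := Metric.eventually_nhds_iff_ball.1 ((e1.and e2).and ht)
  -- This polynomial is what remains of (H - 1 + (1-a)z)(1 + zp) after dividing by z²; the terms of
  -- order 0 and 1 cancel.
  obtain ⟨B, hB, hBq⟩ := exists_norm_eval_le (q - Polynomial.C a - X * q + Polynomial.C (1 - a) * p) 1
  have hZ : ∀ Z : ℂ, max 1 (2 / r) ≤ ‖Z‖ → Z ≠ 0 ∧ -1 / Z ∈ Metric.ball (0 : ℂ) r ∧ ‖-1 / Z‖ ≤ 1 ∧
      atInfinity f Z - Z = H (-1 / Z) := by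
    intro Z hZ
    have h1 : 1 ≤ ‖Z‖ := (le_max_left _ _).trans hZ
    have h2 : 2 / r ≤ ‖Z‖ := (le_max_right _ _).trans hZ
    have hZ0 : Z ≠ 0 := by
      rintro rfl
      simp at h1
      linarith
    have hb : -1 / Z ∈ Metric.ball (0 : ℂ) r := by
      rw [mem_ball_zero_iff, norm_div, norm_neg, norm_one, div_lt_iff₀ (by linarith)]
      rw [div_le_iff₀ hr] at h2
      nlinarith
    refine ⟨hZ0, hb, ?_, ?_⟩
    · rw [norm_div, norm_neg, norm_one, div_le_one (by linarith)]
      exact h1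
    · have hz := ((hball _ hb).1.2)
      set z := -1 / Z with hz'
      have hzz : Z = -1 / z := by rw [hz', neg_one_div_neg_one_div]
      have hz0 : z ≠ 0 := by
        intro h
        rw [h] at hzz
        simp at hzz
        exact hZ0 hzz
      have hd : 1 + z * p.eval z ≠ 0 := by
        intro h
        rw [h] at hz
        norm_num at hz
      have hf : f.eval z = z * (1 + z * p.eval z) := by
        rw [hq, hp]; ring
      show -1 / f.eval (-1 / Z) - Z = p.eval z / (1 + z * p.eval z)
      rw [← hz', hf, hzz]
      field_simp
      ring
  refine ⟨max 1 (2 / r), max (2 * B) K, le_max_left _ _, by positivity, fun Z hZR => ?_⟩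
  obtain ⟨hZ0, hb, hle, hFH⟩ := hZ Z hZR
  refine ⟨?_, ?_, ?_⟩
  · rw [hFH]
    exact (hball _ hb).1.1.le
  · rw [hFH]
    set z := -1 / Z with hz'
    have hzz : (1 - a) / Z = - (1 - a) * z := by rw [hz']; ring
    have hn : 1 / 2 ≤ ‖1 + z * p.eval z‖ := by
      have h1 := (hball _ hb).1.2
      have := norm_sub_norm_le (1 : ℂ) (1 - (1 + z * p.eval z))
      rw [norm_sub_rev 1 (1 + z * p.eval z), norm_one] at this
      simp only [sub_sub_cancel] at this
      linarith
    have hd : 1 + z * p.eval z ≠ 0 := by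
      intro h
      rw [h] at hn
      norm_num at hn
    have : H z - 1 - (1 - a) / Z = z ^ 2 *
        (q - Polynomial.C a - X * q + Polynomial.C (1 - a) * p).eval z / (1 + z * p.eval z) := by
      rw [hzz, eq_div_iff hd]
      simp only [H, sub_mul, div_mul_cancel₀ _ hd]
      simp only [eval_add, eval_sub, eval_mul, eval_C, eval_X, hp]
      ring
    rw [this, norm_div, norm_mul, norm_pow, hz', norm_div, norm_neg, norm_one, div_pow, one_pow, ← hz',
      div_le_iff₀ (by linarith)]
    have h3 := hBq z hle
    have h4 : 0 ≤ 1 / ‖Z‖ ^ 2 := by positivity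
    calc 1 / ‖Z‖ ^ 2 * _ ≤ 1 / ‖Z‖ ^ 2 * B := mul_le_mul_of_nonneg_left h3 h4
      _ = 2 * B / ‖Z‖ ^ 2 * (1 / 2) := by ring
      _ ≤ max (2 * B) K / ‖Z‖ ^ 2 * ‖1 + z * p.eval z‖ := by
        gcongr
        exact le_max_left _ _
  · intro Z' hZR'
    obtain ⟨hZ0', hb', hle', hFH'⟩ := hZ Z' hZR'
    rw [hFH, hFH']
    have := hK.dist_le_mul _ (hball _ hb).2 _ (hball _ hb').2
    rw [dist_eq_norm, dist_eq_norm] at this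
    have h5 : -1 / Z - -1 / Z' = (Z - Z') / (Z * Z') := by
      field_simp
      ring
    rw [h5, norm_div, norm_mul] at this
    refine this.trans ?_
    gcongr
    exact le_max_right _ _

/-! ### Approximate Fatou coordinates -/

/-- The leading terms `Z - (b / 2) log (Z²)` of a Fatou coordinate of `Z ↦ Z + 1 + b / Z + O(Z⁻²)`,
on both sides of the imaginary axis. -/
noncomputable def fatouApprox (b Z : ℂ) : ℂ := Z - b / 2 * Complex.log (Z ^ 2)

lemma norm_log_one_add_sub_le {y : ℂ} (hy : ‖y‖ ≤ 1 / 2) : ‖Complex.log (1 + y) - y‖ ≤ ‖y‖ ^ 2 := by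
  refine (Complex.norm_log_one_add_sub_self_le (by linarith)).trans ?_
  have h1 : (1 - ‖y‖)⁻¹ ≤ 2 := by
    rw [inv_le_comm₀ (by linarith) (by norm_num)]
    linarith
  have h2 : 0 ≤ ‖y‖ ^ 2 := by positivity
  nlinarith

lemma re_one_add_pos {y : ℂ} (hy : ‖y‖ ≤ 1 / 2) : 0 < (1 + y).re := by
  have := (abs_le.1 (Complex.abs_re_le_norm y)).1
  simp only [Complex.add_re, Complex.one_re]
  linarith

lemma log_mul_of_re_pos {x y : ℂ} (hx : 0 < x.re) (hy : 0 < y.re) :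
    Complex.log (x * y) = Complex.log x + Complex.log y := by
  refine Complex.log_mul (by rintro rfl; simp at hx) (by rintro rfl; simp at hy) ?_
  have h1 := abs_lt.1 (Complex.abs_arg_lt_pi_div_two_iff.2 (Or.inl hx))
  have h2 := abs_lt.1 (Complex.abs_arg_lt_pi_div_two_iff.2 (Or.inl hy))
  constructor <;> linarith [h1.1, h1.2, h2.1, h2.2]

lemma norm_log_le (w : ℂ) : ‖Complex.log w‖ ≤ |Real.log ‖w‖| + 4 := by
  have h := Complex.norm_le_abs_re_add_abs_im (Complex.log w)
  rw [Complex.log_re, Complex.log_im] at h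
  have := Complex.abs_arg_le_pi w
  have := Real.pi_lt_four
  linarith

lemma sq_mem_slitPlane {Z : ℂ} (h : Z.re ≠ 0) : Z ^ 2 ∈ Complex.slitPlane := by
  rw [Complex.mem_slitPlane_iff]
  by_cases hi : Z.im = 0
  · left
    simp only [sq, Complex.mul_re, hi]
    have := mul_self_pos.2 h
    linarith
  · right
    simp only [sq, Complex.mul_im]
    intro h'
    have : Z.re * Z.im = 0 := by linarith
    rcases mul_eq_zero.1 this with h1 | h1 <;> contradiction

lemma norm_log_sq_sub_le_of_convex {s : Set ℂ} (hs : Convex ℝ s) {R : ℝ} (hR : 0 < R)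
    (h : ∀ z ∈ s, R ≤ |z.re|) {Z Z' : ℂ} (hZ : Z ∈ s) (hZ' : Z' ∈ s) :
    ‖Complex.log (Z ^ 2) - Complex.log (Z' ^ 2)‖ ≤ 2 / R * ‖Z - Z'‖ := by
  refine hs.norm_image_sub_le_of_norm_hasDerivWithin_le (f := fun z => Complex.log (z ^ 2))
    (f' := fun z => 2 / z) (fun z hz => ?_) (fun z hz => ?_) hZ' hZ
  · have hre : z.re ≠ 0 := by
      intro h0
      have := h z hz
      rw [h0] at this
      simp at this
      linarith
    have hz0 : z ≠ 0 := by
      rintro rfl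
      simp at hre
    have := ((hasDerivAt_pow 2 z).clog (sq_mem_slitPlane hre)).hasDerivWithinAt (s := s)
    convert this using 1
    field_simp
    ring
  · have h1 : R ≤ ‖z‖ := (h z hz).trans (Complex.abs_re_le_norm z)
    rw [norm_div, Complex.norm_ofNat]
    gcongr

lemma norm_log_sq_sub_le_right {R : ℝ} (hR : 0 < R) {Z Z' : ℂ} (hZ : R ≤ Z.re) (hZ' : R ≤ Z'.re) :
    ‖Complex.log (Z ^ 2) - Complex.log (Z' ^ 2)‖ ≤ 2 / R * ‖Z - Z'‖ :=
  norm_log_sq_sub_le_of_convex (convex_halfSpace_re_ge R) hR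
    (fun _ hz => le_trans hz (le_abs_self _)) hZ hZ'

lemma norm_log_sq_sub_le_left {R : ℝ} (hR : 0 < R) {Z Z' : ℂ} (hZ : Z.re ≤ -R) (hZ' : Z'.re ≤ -R) :
    ‖Complex.log (Z ^ 2) - Complex.log (Z' ^ 2)‖ ≤ 2 / R * ‖Z - Z'‖ :=
  norm_log_sq_sub_le_of_convex (convex_halfSpace_re_le (-R)) hR
    (fun z hz => by
      have hz : z.re ≤ -R := hz
      rw [abs_of_neg (by linarith)]
      linarith) hZ hZ'

/-- The step adds b/Z to Z beyond 1, and log(Z²) grows by 2/Z, so the first-order terms cancel. The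
condition Re Z² > 0 splits the logarithm of a product without a branch jump, and it holds in a left
sector as well as in a right one. -/
lemma exists_fatouApprox_step {f : ℂ[X]} (h0 : f.coeff 0 = 0) (h1 : f.coeff 1 = 1)
    (h2 : f.coeff 2 = 1) :
    ∃ R C : ℝ, 1 ≤ R ∧ 0 ≤ C ∧ ∀ Z : ℂ, R ≤ ‖Z‖ → 0 < (Z ^ 2).re →
      ‖fatouApprox (1 - f.coeff 3) (atInfinity f Z) - fatouApprox (1 - f.coeff 3) Z - 1‖
        ≤ C / ‖Z‖ ^ 2 := by
  obtain ⟨R, C, hR, hC, hF⟩ := exists_atInfinity_bound h0 h1 h2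
  set b := 1 - f.coeff 3
  refine ⟨max R 6, C + ‖b‖ / 2 * (9 + (2 * (‖b‖ + C) + 2)), hR.trans (le_max_left _ _), by positivity,
    fun Z hZ hre => ?_⟩
  have hZR := (le_max_left _ _).trans hZ
  have hZ6 : 6 ≤ ‖Z‖ := (le_max_right _ _).trans hZ
  obtain ⟨hF1, hF2, -⟩ := hF Z hZR
  have hZ0 : Z ≠ 0 := by
    rintro rfl
    simp at hZ6
    linarith
  set W := atInfinity f Z
  set s := 1 / ‖Z‖ with hs
  have hs0 : 0 ≤ s := by positivity
  have hs6 : s ≤ 1 / 6 := one_div_le_one_div_of_le (by norm_num) hZ6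
  have hW1 : ‖W - Z - 1‖ ≤ (‖b‖ + C) * s := by
    have : W - Z - 1 = (W - Z - 1 - b / Z) + b / Z := by ring
    rw [this]
    refine (norm_add_le _ _).trans ?_
    rw [norm_div]
    have e : C / ‖Z‖ ^ 2 = C * s * s := by rw [hs]; ring
    have e2 : ‖b‖ / ‖Z‖ = ‖b‖ * s := by rw [hs]; ring
    rw [e] at hF2
    rw [e2]
    nlinarith [mul_nonneg hC hs0]
  set u := (W - Z) / Z with hu
  have hun : ‖u‖ ≤ 11 / 10 * s := by
    have : W - Z = (W - Z - 1) + 1 := by ring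
    have h3 : ‖W - Z‖ ≤ 11 / 10 := by
      rw [this]
      refine (norm_add_le _ _).trans ?_
      rw [norm_one]
      linarith
    rw [hu, norm_div, hs, div_eq_mul_one_div]
    gcongr
  have hWu : W ^ 2 = Z ^ 2 * (1 + (2 * u + u ^ 2)) := by
    rw [hu]; field_simp; ring
  set y := 2 * u + u ^ 2 with hy
  have hyn : ‖y‖ ≤ 3 * s := by
    refine (norm_add_le _ _).trans ?_
    rw [norm_mul, norm_pow, Complex.norm_ofNat]
    nlinarith [norm_nonneg u]
  have hlog : Complex.log (W ^ 2) = Complex.log (Z ^ 2) + Complex.log (1 + y) := by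
    rw [hWu]
    exact log_mul_of_re_pos hre (re_one_add_pos (by linarith))
  have hL := norm_log_one_add_sub_le (y := y) (by linarith)
  have hy2 : ‖y - 2 / Z‖ ≤ (2 * (‖b‖ + C) + 2) * s ^ 2 := by
    have : y - 2 / Z = 2 * ((W - Z - 1) / Z) + u ^ 2 := by
      rw [hy, hu]; field_simp; ring
    rw [this]
    refine (norm_add_le _ _).trans ?_
    rw [norm_mul, norm_pow, Complex.norm_ofNat, norm_div, div_eq_mul_one_div _ ‖Z‖, ← hs]
    have := mul_le_mul_of_nonneg_right hW1 hs0
    nlinarith [norm_nonneg u]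
  have e : fatouApprox b W - fatouApprox b Z - 1 =
      (W - Z - 1 - b / Z) - b / 2 * ((Complex.log (1 + y) - y) + (y - 2 / Z)) := by
    rw [fatouApprox, fatouApprox, hlog]; ring
  rw [e]
  refine (norm_sub_le _ _).trans ?_
  rw [norm_mul, norm_div, Complex.norm_ofNat]
  have h3 := norm_add_le (Complex.log (1 + y) - y) (y - 2 / Z)
  have e3 : C / ‖Z‖ ^ 2 = C * s ^ 2 := by rw [hs]; ring
  have e4 : (C + ‖b‖ / 2 * (9 + (2 * (‖b‖ + C) + 2))) / ‖Z‖ ^ 2 =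
    (C + ‖b‖ / 2 * (9 + (2 * (‖b‖ + C) + 2))) * s ^ 2 := by rw [hs]; ring
  rw [e4]
  rw [e3] at hF2
  have h4 : ‖y‖ ^ 2 ≤ 9 * s ^ 2 := by nlinarith [norm_nonneg y]
  have h5 : ‖Complex.log (1 + y) - y + (y - 2 / Z)‖ ≤ (9 + (2 * (‖b‖ + C) + 2)) * s ^ 2 := by linarith
  calc _ ≤ C * s ^ 2 + ‖b‖ / 2 * ((9 + (2 * (‖b‖ + C) + 2)) * s ^ 2) := by gcongr
    _ = _ := by ring

/-! ### The attracting side: uniform convergence of the Fatou coordinate -/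

lemma exists_add_mul_log_le (K₁ K₂ : ℝ) {ε : ℝ} (hε : 0 < ε) :
    ∃ x₀ : ℝ, 1 ≤ x₀ ∧ ∀ x, x₀ ≤ x → K₁ + K₂ * Real.log x ≤ ε * x := by
  have h1 : (fun x : ℝ => K₁ + K₂ * Real.log x) =o[atTop] (id : ℝ → ℝ) :=
    (Asymptotics.isLittleO_const_id_atTop K₁).add (Real.isLittleO_log_id_atTop.const_mul_left K₂)
  obtain ⟨x₀, hx₀⟩ := eventually_atTop.1 (h1.def hε)
  refine ⟨max x₀ 1, le_max_right _ _, fun x hx => ?_⟩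
  have h2 := hx₀ x ((le_max_left _ _).trans hx)
  have h3 : 0 ≤ x := zero_le_one.trans ((le_max_right _ _).trans hx)
  rw [Real.norm_eq_abs, id, Real.norm_eq_abs, abs_of_nonneg h3] at h2
  exact (le_abs_self _).trans h2

lemma norm_sub_le_of_telescope {d : ℕ → ℂ} {C : ℝ}
    (hd : ∀ j : ℕ, ‖d (j + 1) - d j‖ ≤ C * (1 / ((j : ℝ) + 1) - 1 / ((j : ℝ) + 2))) {m n : ℕ} (h : m ≤ n) :
    ‖d n - d m‖ ≤ C * (1 / ((m : ℝ) + 1) - 1 / ((n : ℝ) + 1)) := by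
  induction n, h using Nat.le_induction with
  | base => simp
  | succ n hmn ih =>
    have : d (n + 1) - d m = (d (n + 1) - d n) + (d n - d m) := by ring
    rw [this]
    refine (norm_add_le _ _).trans ((add_le_add (hd n) ih).trans (le_of_eq ?_))
    push_cast
    ring

lemma exists_limit_of_telescope {d : ℕ → ℂ} {C : ℝ} (hC : 0 ≤ C)
    (hd : ∀ j : ℕ, ‖d (j + 1) - d j‖ ≤ C * (1 / ((j : ℝ) + 1) - 1 / ((j : ℝ) + 2))) :
    ∃ l, Tendsto d atTop (𝓝 l) ∧ ∀ j : ℕ, ‖d j - l‖ ≤ C / ((j : ℝ) + 1) := by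
  have hb : ∀ m n : ℕ, m ≤ n → ‖d n - d m‖ ≤ C / ((m : ℝ) + 1) := fun m n h => by
    refine (norm_sub_le_of_telescope hd h).trans ?_
    rw [show C / ((m : ℝ) + 1) = C * (1 / ((m : ℝ) + 1)) by ring]
    refine mul_le_mul_of_nonneg_left ?_ hC
    have : (0 : ℝ) ≤ 1 / ((n : ℝ) + 1) := by positivity
    linarith
  have hcs : CauchySeq d := by
    refine cauchySeq_of_le_tendsto_0' (fun m : ℕ => C / ((m : ℝ) + 1)) (fun m n h => ?_) ?_
    · rw [dist_comm, dist_eq_norm]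
      exact hb m n h
    · exact tendsto_const_nhds.div_atTop (tendsto_natCast_atTop_atTop.atTop_add tendsto_const_nhds)
  obtain ⟨l, hl⟩ := cauchySeq_tendsto_of_complete hcs
  refine ⟨l, hl, fun j => ?_⟩
  rw [norm_sub_rev]
  exact le_of_tendsto (hl.sub_const (d j)).norm (eventually_atTop.2 ⟨j, fun n hn => hb j n hn⟩)

lemma norm_sub_natCast_le (F : ℂ → ℂ) (Z : ℂ) (n : ℕ) (h : ∀ j < n, ‖F^[j + 1] Z - F^[j] Z - 1‖ ≤ 1 / 10) :
    ‖F^[n] Z - Z - n‖ ≤ n / 10 := by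
  induction n with
  | zero => simp
  | succ n ih =>
    have : F^[n + 1] Z - Z - (n + 1 : ℕ) = (F^[n + 1] Z - F^[n] Z - 1) + (F^[n] Z - Z - n) := by
      push_cast; ring
    rw [this]
    refine (norm_add_le _ _).trans ?_
    have := h n (Nat.lt_succ_self n)
    have := ih fun j hj => h j (hj.trans (Nat.lt_succ_self n))
    push_cast
    linarith

lemma re_sq_pos_of_two_mul_abs_im_le {Z : ℂ} (h : 2 * |Z.im| ≤ |Z.re|) (h0 : Z.re ≠ 0) : 0 < (Z ^ 2).re := by
  have h1 : (Z ^ 2).re = Z.re ^ 2 - Z.im ^ 2 := by simp only [sq, Complex.mul_re]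
  rw [h1, ← sq_abs Z.re, ← sq_abs Z.im]
  have := abs_pos.2 h0
  nlinarith [abs_nonneg Z.im]

lemma re_le_of_norm_sub_one_le {W Z : ℂ} (h : ‖W - Z - 1‖ ≤ 1 / 10) :
    Z.re + 9 / 10 ≤ W.re ∧ W.re ≤ Z.re + 11 / 10 ∧ |W.im| ≤ |Z.im| + 1 / 10 := by
  have h1 := abs_le.1 ((Complex.abs_re_le_norm _).trans h)
  have h2 := (Complex.abs_im_le_norm _).trans h
  simp only [Complex.sub_re, Complex.sub_im, Complex.one_re, Complex.one_im, sub_zero] at h1 h2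
  refine ⟨by linarith, by linarith, ?_⟩
  have := abs_sub_abs_le_abs_sub W.im Z.im
  linarith

/-- Orbits starting in a right sector stay in it and have a uniformly converging Fatou coordinate. -/
lemma exists_attracting_sector {f : ℂ[X]} (h0 : f.coeff 0 = 0) (h1 : f.coeff 1 = 1)
    (h2 : f.coeff 2 = 1) :
    ∃ R : ℝ, 1 ≤ R ∧ (∀ Z : ℂ, R ≤ ‖Z‖ → ‖atInfinity f Z - Z - 1‖ ≤ 1 / 10) ∧
      ∀ B : ℝ, ∃ K : ℝ, 0 ≤ K ∧ ∀ Z : ℂ, R + 2 * |Z.im| ≤ Z.re → ‖Z‖ ≤ B →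
      (∀ j : ℕ, ‖(atInfinity f)^[j] Z - j‖ ≤ K + K * Real.log (j + 1)) ∧
      ∃ l : ℂ, ‖l‖ ≤ K ∧ ∀ j : ℕ,
        ‖fatouApprox (1 - f.coeff 3) ((atInfinity f)^[j] Z) - j - l‖ ≤ K / (j + 1) := by
  obtain ⟨R₁, C₁, hR₁, hC₁, hF⟩ := exists_atInfinity_bound h0 h1 h2
  obtain ⟨R₂, C, hR₂, hC, hΦ⟩ := exists_fatouApprox_step h0 h1 h2
  set b := 1 - f.coeff 3
  have hRm : 1 ≤ max R₁ R₂ := hR₁.trans (le_max_left _ _)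
  refine ⟨max R₁ R₂, hRm, fun Z hZ => (hF Z ((le_max_left _ _).trans hZ)).1, fun B => ?_⟩
  set R := max R₁ R₂
  -- The lower bound 2 keeps log B' nonnegative and gives ‖T j‖ ≤ B'(j+1), since each step has
  -- length at most 11/10.
  set B' := max B 2 with hB'
  have hB2 : 2 ≤ B' := le_max_right _ _
  have hlB : 0 ≤ Real.log B' := Real.log_nonneg (by linarith)
  set K₀ := B' + ‖b‖ / 2 * (2 * Real.log B' + 4) + 8 * C with hK₀
  have hK₀p : 0 ≤ K₀ := by positivity
  set K := K₀ + ‖b‖ / 2 * (2 * Real.log B' + 4) + ‖b‖ with hK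
  have hKp : 0 ≤ K := by positivity
  have hKK : K₀ ≤ K := by
    have : 0 ≤ ‖b‖ / 2 * (2 * Real.log B' + 4) := by positivity
    have := norm_nonneg b
    linarith
  refine ⟨K, hKp, fun Z hZ hZB => ?_⟩
  have hZB' : ‖Z‖ ≤ B' := hZB.trans (le_max_left _ _)
  set T : ℕ → ℂ := fun j => (atInfinity f)^[j] Z with hT
  have hTs : ∀ j, T (j + 1) = atInfinity f (T j) := fun j => Function.iterate_succ_apply' _ _ _
  -- A step raises Re by at least 9/10 and |Im| by at most 1/10, hence Re - 2|Im| by at least 7/10.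
  have hsec : ∀ j : ℕ, R + 7 / 10 * j + 2 * |(T j).im| ≤ (T j).re := by
    intro j
    induction j with
    | zero => simpa [hT] using hZ
    | succ j ih =>
      have hn : R ≤ ‖T j‖ := by
        refine le_trans ?_ ((le_abs_self _).trans (Complex.abs_re_le_norm _))
        have := abs_nonneg (T j).im
        have : (0 : ℝ) ≤ j := j.cast_nonneg
        linarith
      obtain ⟨e1, -, e3⟩ := re_le_of_norm_sub_one_le (hF _ ((le_max_left _ _).trans hn)).1
      rw [hTs]
      push_cast
      linarith
  have hnorm : ∀ j : ℕ, R + 7 / 10 * j ≤ ‖T j‖ := fun j => by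
    refine le_trans ?_ ((le_abs_self _).trans (Complex.abs_re_le_norm _))
    have := abs_nonneg (T j).im
    linarith [hsec j]
  have hRj : ∀ j : ℕ, R ≤ ‖T j‖ := fun j => by
    have : (0 : ℝ) ≤ j := j.cast_nonneg
    linarith [hnorm j]
  have hre : ∀ j : ℕ, 0 < (T j ^ 2).re := fun j => by
    have h3 : (0 : ℝ) ≤ j := j.cast_nonneg
    have h4 := hsec j
    have h5 := abs_nonneg (T j).im
    have h6 : 0 < (T j).re := by linarith
    refine re_sq_pos_of_two_mul_abs_im_le ?_ h6.ne'
    rw [abs_of_pos h6]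
    linarith
  set d : ℕ → ℂ := fun j => fatouApprox b (T j) - j with hd
  have hdd : ∀ j : ℕ, ‖d (j + 1) - d j‖ ≤ (8 * C) * (1 / ((j : ℝ) + 1) - 1 / ((j : ℝ) + 2)) := by
    intro j
    have h3 : (0 : ℝ) ≤ j := j.cast_nonneg
    have h4 := hΦ (T j) ((le_max_right _ _).trans (hRj j)) (hre j)
    rw [← hTs] at h4
    have e : d (j + 1) - d j = fatouApprox b (T (j + 1)) - fatouApprox b (T j) - 1 := by
      simp only [hd]; push_cast; ring
    rw [e]
    refine h4.trans ?_
    have h5 : 7 / 10 * ((j : ℝ) + 1) ≤ ‖T j‖ := by linarith [hnorm j]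
    have h6 : 1 / ((j : ℝ) + 1) - 1 / ((j : ℝ) + 2) = 1 / (((j : ℝ) + 1) * ((j : ℝ) + 2)) := by
      field_simp; ring
    rw [h6, mul_one_div, div_le_div_iff₀ (by nlinarith) (by positivity)]
    have : ((j : ℝ) + 1) * (j + 2) ≤ 8 * ‖T j‖ ^ 2 := by nlinarith
    nlinarith
  obtain ⟨l, -, hl⟩ := exists_limit_of_telescope (by positivity) hdd
  have hlog : ∀ (W : ℂ) (x : ℝ), 1 ≤ ‖W‖ → ‖W‖ ≤ x → ‖Complex.log (W ^ 2)‖ ≤ 2 * Real.log x + 4 := by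
    intro W x h1 hx
    refine (norm_log_le _).trans ?_
    rw [norm_pow, Real.log_pow, abs_of_nonneg (by have := Real.log_nonneg h1; positivity)]
    have := Real.log_le_log (by linarith) hx
    push_cast
    linarith
  have hd0 : ‖d 0‖ ≤ B' + ‖b‖ / 2 * (2 * Real.log B' + 4) := by
    simp only [hd, hT, Function.iterate_zero, id, Nat.cast_zero, sub_zero, fatouApprox]
    refine (norm_sub_le _ _).trans ?_
    rw [norm_mul, norm_div, Complex.norm_ofNat]
    gcongr
    exact hlog _ _ (hRm.trans (hRj 0)) hZB'
  have hdK : ∀ j, ‖d j‖ ≤ K₀ := by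
    intro j
    have h3 := norm_sub_le_of_telescope hdd (Nat.zero_le j)
    have h4 : 8 * C * (1 / (((0 : ℕ) : ℝ) + 1) - 1 / ((j : ℝ) + 1)) ≤ 8 * C := by
      have : (0 : ℝ) ≤ 1 / ((j : ℝ) + 1) := by positivity
      push_cast
      nlinarith
    have h5 : d j = (d j - d 0) + d 0 := by ring
    rw [h5]
    refine (norm_add_le _ _).trans ?_
    linarith
  refine ⟨fun j => ?_, l, ?_, fun j => (hl j).trans ?_⟩
  · have h3 : (0 : ℝ) ≤ j := j.cast_nonneg
    have e : T j - j = d j + b / 2 * Complex.log (T j ^ 2) := by simp only [hd, fatouApprox]; ring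
    have h4 := norm_sub_natCast_le (atInfinity f) Z j (fun i _ => by
      have := (hF (T i) ((le_max_left _ _).trans (hRj i))).1
      rwa [← hTs] at this)
    have h5 : ‖T j‖ ≤ B' * (j + 1) := by
      have : T j = (T j - Z - j) + Z + j := by ring
      rw [this]
      refine (norm_add_le _ _).trans ((add_le_add_left (norm_add_le _ _) _).trans ?_)
      rw [Complex.norm_natCast]
      nlinarith
    have h6 := hlog _ _ (hRm.trans (hRj j)) h5
    rw [Real.log_mul (by positivity) (by positivity)] at h6
    have hlj : 0 ≤ Real.log ((j : ℝ) + 1) := Real.log_nonneg (by linarith)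
    show ‖T j - j‖ ≤ _
    rw [e]
    refine (norm_add_le _ _).trans ?_
    rw [norm_mul, norm_div, Complex.norm_ofNat]
    calc _ ≤ K₀ + ‖b‖ / 2 * (2 * (Real.log B' + Real.log (j + 1)) + 4) := by
          gcongr
          exact hdK j
      _ = (K₀ + ‖b‖ / 2 * (2 * Real.log B' + 4)) + ‖b‖ * Real.log (j + 1) := by ring
      _ ≤ K + K * Real.log (j + 1) := by
        have : ‖b‖ ≤ K := by
          have : 0 ≤ K₀ + ‖b‖ / 2 * (2 * Real.log B' + 4) := by positivity
          linarith
        have := mul_le_mul_of_nonneg_right this hlj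
        linarith [norm_nonneg b]
  · have h3 := hl 0
    have h5 : l = d 0 - (d 0 - l) := by ring
    rw [h5]
    refine (norm_sub_le _ _).trans ?_
    simp only [Nat.cast_zero, zero_add, div_one] at h3
    linarith
  · gcongr
    refine le_trans ?_ hKK
    have : 0 ≤ B' + ‖b‖ / 2 * (2 * Real.log B' + 4) := by positivity
    linarith

/-- An orbit tending to 0 without hitting it has ‖Z‖ → ∞. From then on Re Z - 2|Im Z| gains at least
7/10 per step, so it exceeds any bound. -/
lemma exists_mem_sector_of_mem_parabolicBasin {f : ℂ[X]} {R : ℝ}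
    (hF : ∀ Z : ℂ, R ≤ ‖Z‖ → ‖atInfinity f Z - Z - 1‖ ≤ 1 / 10) {ξ : ℂ} (hξ : ξ ∈ parabolicBasin f)
    (R' : ℝ) :
    ∃ m : ℕ, R' + 2 * |(-1 / (fun x => f.eval x)^[m] ξ).im| < (-1 / (fun x => f.eval x)^[m] ξ).re := by
  obtain ⟨hlim, hne⟩ := hξ
  set T : ℕ → ℂ := fun j => -1 / (fun x => f.eval x)^[j] ξ with hT
  have hTs : ∀ j, T (j + 1) = atInfinity f (T j) := fun j => by
    simp only [hT, atInfinity, neg_one_div_neg_one_div, Function.iterate_succ_apply']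
  have hinf : Tendsto (fun j => ‖T j‖) atTop atTop := by
    have h1 : Tendsto (fun n => (fun x => f.eval x)^[n] ξ) atTop (𝓝[≠] 0) :=
      tendsto_nhdsWithin_iff.2 ⟨hlim, Eventually.of_forall hne⟩
    have h2 := tendsto_norm_inv_nhdsNE_zero_atTop.comp h1
    refine h2.congr fun j => ?_
    simp [hT]
  obtain ⟨j₀, hj₀⟩ := eventually_atTop.1 (hinf.eventually_ge_atTop R)
  have hgrow : ∀ i : ℕ, (T j₀).re - 2 * |(T j₀).im| + 7 / 10 * i ≤ (T (j₀ + i)).re - 2 * |(T (j₀ + i)).im| := by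
    intro i
    induction i with
    | zero => simp
    | succ i ih =>
      obtain ⟨e1, -, e3⟩ := re_le_of_norm_sub_one_le (hF _ (hj₀ (j₀ + i) (Nat.le_add_right _ _)))
      rw [← add_assoc, hTs]
      push_cast
      linarith
  obtain ⟨i, hi⟩ := exists_nat_gt ((R' - ((T j₀).re - 2 * |(T j₀).im|)) / (7 / 10))
  rw [div_lt_iff₀ (by norm_num)] at hi
  refine ⟨j₀ + i, ?_⟩
  have := hgrow i
  show R' + 2 * |(T (j₀ + i)).im| < (T (j₀ + i)).re
  linarith

lemma continuous_iterate_eval (f : ℂ[X]) (n : ℕ) : Continuous (fun x => f.eval x)^[n] :=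
  f.continuous.iterate n

/-- The definition subtracts log of the time, whereas `fatouApprox` subtracts the logarithm of the
orbit itself. The two agree in the limit because the orbit divided by the time tends to 1. -/
lemma attractingFatouCoordinate_eq_of_tendsto {f : ℂ[X]} {z l : ℂ}
    (h1 : ∀ ε > 0, ∀ᶠ k : ℕ in atTop, ‖-1 / (fun x => f.eval x)^[k] z - k‖ ≤ ε * k)
    (h2 : Tendsto (fun k : ℕ => fatouApprox (1 - f.coeff 3) (-1 / (fun x => f.eval x)^[k] z) - k) atTop (𝓝 l)) :
    attractingFatouCoordinate f z = l := by
  refine Tendsto.limUnder_eq ?_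
  set T : ℕ → ℂ := fun j => -1 / (fun x => f.eval x)^[j] z with hT
  have h3 : Tendsto (fun k : ℕ => T k / k) atTop (𝓝 1) := by
    rw [Metric.tendsto_nhds]
    intro ε hε
    filter_upwards [h1 (ε / 2) (by linarith), eventually_gt_atTop 0] with k hk hk0
    have hk0' : (0 : ℝ) < k := by exact_mod_cast hk0
    have hk0'' : (k : ℂ) ≠ 0 := by exact_mod_cast hk0.ne'
    have : T k / k - 1 = (T k - k) / k := by field_simp
    rw [dist_eq_norm, this, norm_div, Complex.norm_natCast, div_lt_iff₀ hk0']
    have := mul_pos hε hk0'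
    linarith
  have h4 : Tendsto (fun k : ℕ => Complex.log ((T k / k) ^ 2)) atTop (𝓝 0) := by
    have h5 : ContinuousAt (fun w : ℂ => Complex.log (w ^ 2)) 1 :=
      (continuousAt_id.pow 2).clog (by simp)
    have := h5.tendsto.comp h3
    simpa [Function.comp_def] using this
  have h6 := h2.add (h4.const_mul ((1 - f.coeff 3) / 2))
  rw [mul_zero, add_zero] at h6
  refine h6.congr' ?_
  filter_upwards [h3.eventually_ne one_ne_zero, eventually_gt_atTop 0] with k hk hk0
  have hk0' : (0 : ℝ) < k := by exact_mod_cast hk0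
  have hk0'' : (k : ℂ) ≠ 0 := by exact_mod_cast hk0.ne'
  have e : T k ^ 2 = ((k : ℝ) ^ 2 : ℝ) * (T k / k) ^ 2 := by
    push_cast
    field_simp
  have e2 : Complex.log (T k ^ 2) = 2 * (Real.log k : ℂ) + Complex.log ((T k / k) ^ 2) := by
    rw [e, Complex.log_ofReal_mul (by positivity) (pow_ne_zero _ hk), Real.log_pow]
    push_cast
    rfl
  rw [fatouApprox]
  change T k - _ * Complex.log (T k ^ 2) - _ + _ = T k - k - _
  rw [e2]
  ring

/-- Near a point of the parabolic basin the attracting Fatou coordinate is a uniform limit. -/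
theorem exists_attracting {f : ℂ[X]} (h0 : f.coeff 0 = 0) (h1 : f.coeff 1 = 1)
    (h2 : f.coeff 2 = 1) {ξ : ℂ} (hξ : ξ ∈ parabolicBasin f) :
    ∃ ρ > 0, ∃ B : ℝ, (∀ z ∈ Metric.closedBall ξ ρ, ‖attractingFatouCoordinate f z‖ ≤ B) ∧
      ∀ η > 0, ∃ k₀ : ℕ, ∀ k : ℕ, k₀ ≤ k → ∀ z ∈ Metric.closedBall ξ ρ,
        ‖fatouApprox (1 - f.coeff 3) (-1 / (fun x => f.eval x)^[k] z) - k
          - attractingFatouCoordinate f z‖ ≤ η ∧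
        ‖-1 / (fun x => f.eval x)^[k] z - k‖ ≤ η * k := by
  obtain ⟨R, hR, hF, hA⟩ := exists_attracting_sector h0 h1 h2
  set b := 1 - f.coeff 3
  obtain ⟨m, hm⟩ := exists_mem_sector_of_mem_parabolicBasin hF hξ R
  set T : ℕ → ℂ → ℂ := fun j z => -1 / (fun x => f.eval x)^[j] z with hT
  have hTc : ContinuousAt (T m) ξ :=
    continuousAt_const.div (continuous_iterate_eval f m).continuousAt (hξ.2 m)
  have hnear : ∀ᶠ z in 𝓝 ξ, R + 2 * |(T m z).im| < (T m z).re := by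
    have h3 : ContinuousAt (fun z => (T m z).re - 2 * |(T m z).im|) ξ :=
      (Complex.continuous_re.continuousAt.comp hTc).sub
        (continuousAt_const.mul (Complex.continuous_im.continuousAt.comp hTc).abs)
    have h4 : R < (T m ξ).re - 2 * |(T m ξ).im| := by
      have : R + 2 * |(T m ξ).im| < (T m ξ).re := hm
      linarith
    filter_upwards [h3.eventually (lt_mem_nhds h4)] with z hz
    linarith
  have hbdd : ∀ᶠ z in 𝓝 ξ, ‖T m z‖ < ‖T m ξ‖ + 1 :=
    hTc.norm.eventually (gt_mem_nhds (by linarith))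
  obtain ⟨ρ, hρ, hball⟩ := Metric.nhds_basis_closedBall.eventually_iff.1 (hnear.and hbdd)
  obtain ⟨K, hK, hKA⟩ := hA (‖T m ξ‖ + 1)
  have hiter : ∀ j z, T (m + j) z = (atInfinity f)^[j] (T m z) := fun j z => by
    simp only [hT, atInfinity_iterate, neg_one_div_neg_one_div]
    rw [add_comm, Function.iterate_add_apply]
  have hlin : ∀ η > 0, ∃ k₀ : ℕ, ∀ k : ℕ, k₀ ≤ k → ∀ z ∈ Metric.closedBall ξ ρ, ‖T k z - k‖ ≤ η * k := by
    intro η hη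
    obtain ⟨x₀, hx₀, hx⟩ := exists_add_mul_log_le (K + m + K * Real.log 2) K hη
    obtain ⟨k₀, hk₀⟩ := exists_nat_ge x₀
    refine ⟨k₀ + m + 1, fun k hk z hz => ?_⟩
    obtain ⟨j, rfl⟩ : ∃ j, k = m + j := ⟨k - m, by omega⟩
    have hz' := hball hz
    obtain ⟨h3, -⟩ := hKA (T m z) hz'.1.le hz'.2.le
    have e : T (m + j) z - (m + j : ℕ) = ((atInfinity f)^[j] (T m z) - j) - m := by
      rw [hiter]; push_cast; ring
    rw [e]
    refine (norm_sub_le _ _).trans ?_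
    rw [Complex.norm_natCast]
    have h4 : k₀ + 1 ≤ j := by omega
    have h4' : (k₀ : ℝ) + 1 ≤ j := by exact_mod_cast h4
    have hm0 : (0 : ℝ) ≤ m := m.cast_nonneg
    have hk00 : (0 : ℝ) ≤ k₀ := k₀.cast_nonneg
    have h5 := hx (m + j) (by linarith)
    have h6 : Real.log (j + 1) ≤ Real.log 2 + Real.log (m + j) := by
      rw [← Real.log_mul (by norm_num) (by linarith)]
      exact Real.log_le_log (by linarith) (by linarith)
    have h7 := mul_le_mul_of_nonneg_left h6 hK
    have := h3 j
    push_cast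
    linarith
  have hφ : ∀ z ∈ Metric.closedBall ξ ρ, ‖attractingFatouCoordinate f z‖ ≤ K + m ∧ ∀ j : ℕ,
      ‖fatouApprox b (T (m + j) z) - (m + j : ℕ) - attractingFatouCoordinate f z‖ ≤ K / (j + 1) := by
    intro z hz
    have hz' := hball hz
    obtain ⟨-, l, hlK, hl⟩ := hKA (T m z) hz'.1.le hz'.2.le
    have hl' : ∀ j : ℕ, ‖fatouApprox b (T (m + j) z) - (m + j : ℕ) - (l - m)‖ ≤ K / (j + 1) := fun j => by
      have := hl j
      rw [← hiter] at this
      convert this using 2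
      push_cast
      ring
    have hφl : attractingFatouCoordinate f z = l - m := by
      refine attractingFatouCoordinate_eq_of_tendsto (fun ε hε => ?_) ?_
      · obtain ⟨k₀, hk₀⟩ := hlin ε hε
        exact eventually_atTop.2 ⟨k₀, fun k hk => hk₀ k hk z hz⟩
      · rw [← tendsto_add_atTop_iff_nat m, tendsto_iff_norm_sub_tendsto_zero]
        refine squeeze_zero (fun _ => norm_nonneg _) (fun j => ?_)
          (tendsto_const_nhds.div_atTop (tendsto_natCast_atTop_atTop.atTop_add tendsto_const_nhds) :
            Tendsto (fun j : ℕ => K / ((j : ℝ) + 1)) atTop (𝓝 0))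
        rw [add_comm j m]
        exact hl' j
    refine ⟨?_, fun j => by rw [hφl]; exact hl' j⟩
    rw [hφl]
    refine (norm_sub_le _ _).trans ?_
    rw [Complex.norm_natCast]
    linarith
  refine ⟨ρ, hρ, K + m, fun z hz => (hφ z hz).1, fun η hη => ?_⟩
  obtain ⟨k₁, hk₁⟩ := hlin η hη
  obtain ⟨k₂, hk₂⟩ := exists_nat_ge (K / η)
  refine ⟨k₁ + k₂ + m, fun k hk z hz => ⟨?_, hk₁ k (by omega) z hz⟩⟩
  obtain ⟨j, rfl⟩ : ∃ j, k = m + j := ⟨k - m, by omega⟩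
  refine ((hφ z hz).2 j).trans ?_
  have h4 : k₂ ≤ j := by omega
  have h4' : (k₂ : ℝ) ≤ j := by exact_mod_cast h4
  rw [div_le_iff₀ hη] at hk₂
  rw [div_le_iff₀ (by positivity)]
  nlinarith

/-! ### The repelling side: the Fatou parameterization -/

lemma norm_bounds_of_norm_add_le {Z : ℂ} {x t : ℝ} (h : ‖Z + x‖ ≤ t * x) :
    (1 - t) * x ≤ ‖Z‖ ∧ ‖Z‖ ≤ (1 + |t|) * |x| ∧ Z.re ≤ -((1 - t) * x) ∧ |Z.im| ≤ t * x := by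
  have h1 := abs_le.1 ((Complex.abs_re_le_norm _).trans h)
  have h2 := (Complex.abs_im_le_norm _).trans h
  simp only [Complex.add_re, Complex.add_im, Complex.ofReal_re, Complex.ofReal_im, add_zero] at h1 h2
  refine ⟨?_, ?_, by linarith, h2⟩
  · have := Complex.abs_re_le_norm Z
    have := neg_le_abs Z.re
    linarith
  · have e : Z = (Z + x) - x := by ring
    rw [e]
    refine (norm_sub_le _ _).trans ?_
    rw [Complex.norm_real, Real.norm_eq_abs]
    have := le_abs_self (t * x)
    rw [abs_mul] at this
    linarith

/-- A bootstrap: if Z is comparable to -x, then log(Z²) is O(log x). A bounded approximate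
coordinate then forces Z + x = O(log x), far below εx. -/
lemma exists_confine (b : ℂ) (ρ : ℝ) {ε : ℝ} (hε : 0 < ε) : ∃ x₀ : ℝ, 1 ≤ x₀ ∧ ∀ x : ℝ, x₀ ≤ x → ∀ Z : ℂ,
    ‖Z + x‖ ≤ 1 / 2 * x → ‖fatouApprox b Z + x‖ ≤ ρ → ‖Z + x‖ ≤ ε * x := by
  obtain ⟨x₀, h1, hx⟩ := exists_add_mul_log_le (ρ + ‖b‖ / 2 * (2 * Real.log 2 + 4)) ‖b‖ hε
  refine ⟨max x₀ 2, h1.trans (le_max_left _ _), fun x hx0 Z hZ hΦ => ?_⟩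
  have h2 : 2 ≤ x := (le_max_right _ _).trans hx0
  have h3 := hx x ((le_max_left _ _).trans hx0)
  obtain ⟨e1, e2, -, -⟩ := norm_bounds_of_norm_add_le hZ
  rw [abs_of_nonneg (by norm_num), abs_of_nonneg (by linarith)] at e2
  have h4 : ‖Complex.log (Z ^ 2)‖ ≤ 2 * (Real.log 2 + Real.log x) + 4 := by
    refine (norm_log_le _).trans ?_
    have h5 : 1 ≤ ‖Z‖ := by linarith
    rw [norm_pow, Real.log_pow, abs_of_nonneg (by have := Real.log_nonneg h5; positivity),
      ← Real.log_mul (by norm_num) (by linarith)]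
    have := Real.log_le_log (by linarith) (show ‖Z‖ ≤ 2 * x by linarith)
    push_cast
    linarith
  have e : Z + x = (fatouApprox b Z + x) + b / 2 * Complex.log (Z ^ 2) := by rw [fatouApprox]; ring
  rw [e]
  refine (norm_add_le _ _).trans ?_
  rw [norm_mul, norm_div, Complex.norm_ofNat]
  calc _ ≤ ρ + ‖b‖ / 2 * (2 * (Real.log 2 + Real.log x) + 4) := by gcongr
    _ = ρ + ‖b‖ / 2 * (2 * Real.log 2 + 4) + ‖b‖ * Real.log x := by ring
    _ ≤ _ := h3

lemma div_add_div_sq_le {C x : ℝ} (hC : 0 ≤ C) (hx : 1 < x) : C / x + C / x ^ 2 ≤ C / (x - 1) := by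
  rw [div_add_div _ _ (by positivity) (by positivity), div_le_div_iff₀ (by positivity) (by linarith)]
  nlinarith [mul_nonneg hC (by linarith : 0 ≤ x)]

/-- Orbits in the left half plane, at a controlled approximate Fatou coordinate. -/
lemma exists_repelling_orbit {f : ℂ[X]} (h0 : f.coeff 0 = 0) (h1 : f.coeff 1 = 1)
    (h2 : f.coeff 2 = 1) :
    ∃ C : ℝ, 0 ≤ C ∧ ∀ ρ : ℝ, ∃ j₀ : ℕ, 1 ≤ j₀ ∧ ∀ j k : ℕ, j₀ ≤ j → j ≤ k → ∀ X : ℂ, ‖X‖ ≤ ρ → ∀ Y : ℂ,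
      ‖Y + k‖ ≤ 1 / 2 * k → ‖fatouApprox (1 - f.coeff 3) Y - (X - k)‖ ≤ 1 →
      (‖(atInfinity f)^[k - j] Y + j‖ ≤ 1 / 4 * j ∧
      ‖fatouApprox (1 - f.coeff 3) ((atInfinity f)^[k - j] Y) - (X - j)‖ ≤
        ‖fatouApprox (1 - f.coeff 3) Y - (X - k)‖ + C / j) ∧
      ∀ X' : ℂ, ‖X'‖ ≤ ρ → ∀ Y' : ℂ, ‖Y' + k‖ ≤ 1 / 2 * k →
        ‖fatouApprox (1 - f.coeff 3) Y' - (X' - k)‖ ≤ 1 →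
        ‖(atInfinity f)^[k - j] Y - (atInfinity f)^[k - j] Y'‖ ≤ ‖Y - Y'‖ * Real.exp (C / j) := by
  obtain ⟨R₁, C₁, hR₁, hC₁, hF⟩ := exists_atInfinity_bound h0 h1 h2
  obtain ⟨R₂, C₂, hR₂, hC₂, hΦ⟩ := exists_fatouApprox_step h0 h1 h2
  set b := 1 - f.coeff 3
  set C := 2 * (C₁ + C₂) with hCd
  have hC : 0 ≤ C := by positivity
  refine ⟨C, hC, fun ρ => ?_⟩
  obtain ⟨x₀, -, hconf⟩ := exists_confine b (ρ + 1 + C) (show (0 : ℝ) < 1 / 4 by norm_num)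
  obtain ⟨j₀, hj₀⟩ := exists_nat_ge (max x₀ (2 * (R₁ + R₂)))
  refine ⟨j₀ + 1, by omega, ?_⟩
  -- Induction along the orbit, with the time label j decreasing from k. The allowance C/j absorbs
  -- each step's error, since C/(j+1) + C/(j+1)² ≤ C/j. One step degrades the localization from 1/4
  -- to at most 1/2, and `exists_confine` restores 1/4.
  have main : ∀ k : ℕ, ∀ X : ℂ, ‖X‖ ≤ ρ → ∀ Y : ℂ, ‖Y + k‖ ≤ 1 / 2 * k → ‖fatouApprox b Y - (X - k)‖ ≤ 1 →
      ∀ i j : ℕ, j₀ + 1 ≤ j → j + i = k → (‖(atInfinity f)^[i] Y + j‖ ≤ 1 / 4 * j ∧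
      ‖fatouApprox b ((atInfinity f)^[i] Y) - (X - j)‖ ≤ ‖fatouApprox b Y - (X - k)‖ + C / j) := by
    intro k X hX Y hY hYΦ i
    have fin : ∀ (Z : ℂ) (j : ℕ), j₀ + 1 ≤ j → ‖Z + j‖ ≤ 1 / 2 * j →
        ‖fatouApprox b Z - (X - j)‖ ≤ ‖fatouApprox b Y - (X - k)‖ + C / j → ‖Z + j‖ ≤ 1 / 4 * j := by
      intro Z j hj hZ hZΦ
      have hj' : (j₀ : ℝ) + 1 ≤ j := by exact_mod_cast hj
      have hj0 : (0 : ℝ) ≤ j₀ := j₀.cast_nonneg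
      have := hconf j (by linarith [le_max_left x₀ (2 * (R₁ + R₂))]) Z (by exact_mod_cast hZ) ?_
      · exact_mod_cast this
      · have e : fatouApprox b Z + (j : ℝ) = (fatouApprox b Z - (X - j)) + X := by push_cast; ring
        rw [e]
        refine (norm_add_le _ _).trans ?_
        have : C / j ≤ C := div_le_self hC (by linarith)
        linarith
    induction i with
    | zero =>
      intro j hj hjk
      obtain rfl : j = k := by omega
      have : ‖fatouApprox b Y - (X - j)‖ ≤ ‖fatouApprox b Y - (X - j)‖ + C / j := by
        have : 0 ≤ C / j := by positivity
        linarith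
      exact ⟨fin Y j hj hY this, this⟩
    | succ i ih =>
      intro j hj hjk
      obtain ⟨i1, i2⟩ := ih (j + 1) (by omega) (by omega)
      set Z := (atInfinity f)^[i] Y
      rw [Function.iterate_succ_apply']
      have hj' : (j₀ : ℝ) + 1 ≤ j := by exact_mod_cast hj
      have hm1 := le_max_left x₀ (2 * (R₁ + R₂))
      have hm2 := le_max_right x₀ (2 * (R₁ + R₂))
      obtain ⟨e1, -, e3, e4⟩ := norm_bounds_of_norm_add_le (Z := Z) (x := (j + 1 : ℕ)) (t := 1 / 4) (by exact_mod_cast i1)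
      push_cast at e1 e3 e4 i1 i2
      have s1 := (hF Z (by linarith)).1
      have s2 := hΦ Z (by linarith) (re_sq_pos_of_two_mul_abs_im_le (by
        rw [abs_of_neg (show Z.re < 0 by linarith)]; linarith) (by linarith))
      have s3 : C₂ / ‖Z‖ ^ 2 ≤ C / ((j : ℝ) + 1) ^ 2 := by
        rw [div_le_div_iff₀ (by nlinarith) (by positivity)]
        have : ((j : ℝ) + 1) ^ 2 ≤ 2 * ‖Z‖ ^ 2 := by nlinarith
        have := mul_le_mul_of_nonneg_left this hC₂
        nlinarith [mul_nonneg hC₁ (sq_nonneg ‖Z‖)]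
      have s4 := div_add_div_sq_le hC (show 1 < (j : ℝ) + 1 by linarith)
      rw [add_sub_cancel_right] at s4
      have A : ‖fatouApprox b (atInfinity f Z) - (X - j)‖ ≤ ‖fatouApprox b Y - (X - k)‖ + C / j := by
        have e : fatouApprox b (atInfinity f Z) - (X - j) = (fatouApprox b (atInfinity f Z) - fatouApprox b Z - 1)
          + (fatouApprox b Z - (X - (j + 1))) := by ring
        rw [e]
        refine (norm_add_le _ _).trans ?_
        linarith
      refine ⟨fin _ j hj ?_ A, A⟩
      have e : atInfinity f Z + j = (atInfinity f Z - Z - 1) + (Z + (j + 1)) := by ring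
      rw [e]
      refine (norm_add_le _ _).trans ?_
      linarith
  refine fun j k hj hjk X hX Y hY hYΦ => ⟨main k X hX Y hY hYΦ (k - j) j hj (by omega),
    fun X' hX' Y' hY' hYΦ' => ?_⟩
  -- Each step expands distances by at most 1 + C/(j+1)² ≤ exp(C/(j+1)²), and the exponents
  -- telescope into C/j.
  have lip : ∀ i j : ℕ, j₀ + 1 ≤ j → j + i = k →
      ‖(atInfinity f)^[i] Y - (atInfinity f)^[i] Y'‖ ≤ ‖Y - Y'‖ * Real.exp (C / j) := by
    intro i
    induction i with
    | zero =>
      intro j _ _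
      refine le_mul_of_one_le_right (norm_nonneg _) (Real.one_le_exp (by positivity))
    | succ i ih =>
      intro j hj hjk
      have i3 := ih (j + 1) (by omega) (by omega)
      obtain ⟨i1, -⟩ := main k X hX Y hY hYΦ i (j + 1) (by omega) (by omega)
      obtain ⟨i2, -⟩ := main k X' hX' Y' hY' hYΦ' i (j + 1) (by omega) (by omega)
      set Z := (atInfinity f)^[i] Y
      set Z' := (atInfinity f)^[i] Y'
      rw [Function.iterate_succ_apply', Function.iterate_succ_apply']
      have hj' : (j₀ : ℝ) + 1 ≤ j := by exact_mod_cast hj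
      have hm1 := le_max_left x₀ (2 * (R₁ + R₂))
      have hm2 := le_max_right x₀ (2 * (R₁ + R₂))
      obtain ⟨e1, -⟩ := norm_bounds_of_norm_add_le (Z := Z) (x := (j + 1 : ℕ)) (t := 1 / 4) (by exact_mod_cast i1)
      obtain ⟨e2, -⟩ := norm_bounds_of_norm_add_le (Z := Z') (x := (j + 1 : ℕ)) (t := 1 / 4) (by exact_mod_cast i2)
      push_cast at e1 e2 i3
      have s1 := (hF Z (by linarith)).2.2 Z' (by linarith)
      have s2 : C₁ * (‖Z - Z'‖ / (‖Z‖ * ‖Z'‖)) ≤ ‖Z - Z'‖ * (C / ((j : ℝ) + 1) ^ 2) := by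
        have hp : 0 < ‖Z‖ * ‖Z'‖ := mul_pos (by linarith) (by linarith)
        have : ((j : ℝ) + 1) ^ 2 ≤ 2 * (‖Z‖ * ‖Z'‖) := by
          have := mul_le_mul e1 e2 (by linarith) (by linarith)
          nlinarith
        have t1 : C₁ / (‖Z‖ * ‖Z'‖) ≤ C / ((j : ℝ) + 1) ^ 2 := by
          rw [div_le_div_iff₀ hp (by positivity)]
          have := mul_le_mul_of_nonneg_left this hC₁
          nlinarith [mul_nonneg hC₂ hp.le]
        calc C₁ * (‖Z - Z'‖ / (‖Z‖ * ‖Z'‖)) = ‖Z - Z'‖ * (C₁ / (‖Z‖ * ‖Z'‖)) := by ring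
          _ ≤ _ := by gcongr
      have s4 := div_add_div_sq_le hC (show 1 < (j : ℝ) + 1 by linarith)
      rw [add_sub_cancel_right] at s4
      have e : atInfinity f Z - atInfinity f Z' = (atInfinity f Z - Z - (atInfinity f Z' - Z')) + (Z - Z') := by
        ring
      rw [e]
      refine (norm_add_le _ _).trans ?_
      have s5 := Real.add_one_le_exp (C / ((j : ℝ) + 1) ^ 2)
      calc _ ≤ ‖Z - Z'‖ * (C / ((j : ℝ) + 1) ^ 2 + 1) := by linarith
        _ ≤ (‖Y - Y'‖ * Real.exp (C / ((j : ℝ) + 1))) * Real.exp (C / ((j : ℝ) + 1) ^ 2) := by gcongr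
        _ = ‖Y - Y'‖ * Real.exp (C / ((j : ℝ) + 1) + C / ((j : ℝ) + 1) ^ 2) := by
          rw [Real.exp_add]; ring
        _ ≤ _ := by gcongr
  exact lip (k - j) j hj (by omega)

lemma norm_sub_le_two_mul_fatouApprox_left {b : ℂ} {R : ℝ} (hR : 0 < R) (hb : 2 * ‖b‖ ≤ R) {Y Y' : ℂ}
    (hY : Y.re ≤ -R) (hY' : Y'.re ≤ -R) : ‖Y - Y'‖ ≤ 2 * ‖fatouApprox b Y - fatouApprox b Y'‖ := by
  have h1 := norm_log_sq_sub_le_left hR hY hY'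
  have e : Y - Y' = (fatouApprox b Y - fatouApprox b Y') +
      b / 2 * (Complex.log (Y ^ 2) - Complex.log (Y' ^ 2)) := by rw [fatouApprox, fatouApprox]; ring
  have h2 : ‖Y - Y'‖ ≤ ‖fatouApprox b Y - fatouApprox b Y'‖ + ‖b‖ / 2 * (2 / R * ‖Y - Y'‖) := by
    conv_lhs => rw [e]
    refine (norm_add_le _ _).trans ?_
    rw [norm_mul, norm_div, Complex.norm_ofNat]
    gcongr
  have h3 : ‖b‖ / 2 * (2 / R * ‖Y - Y'‖) ≤ 1 / 2 * ‖Y - Y'‖ := by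
    have : ‖b‖ / R ≤ 1 / 2 := by
      rw [div_le_iff₀ hR]; linarith
    calc ‖b‖ / 2 * (2 / R * ‖Y - Y'‖) = ‖b‖ / R * ‖Y - Y'‖ := by ring
      _ ≤ _ := by gcongr
  linarith

/-- The k iterates split at a fixed j. The first k - j have distortion at most exp(C/j), uniformly
in k, and bring the points into a disc about -j. There the last j iterates are one fixed uniformly
continuous map. -/
lemma exists_repelling_equicontinuous {f : ℂ[X]} (h0 : f.coeff 0 = 0) (h1 : f.coeff 1 = 1)
    (h2 : f.coeff 2 = 1) (ρ : ℝ) {η : ℝ} (hη : 0 < η) :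
    ∃ s > 0, ∃ k₀ : ℕ, ∀ k : ℕ, k₀ ≤ k → ∀ X : ℂ, ‖X‖ ≤ ρ → ∀ Y Y' : ℂ,
      ‖Y + k‖ ≤ 1 / 2 * k → ‖fatouApprox (1 - f.coeff 3) Y - (X - k)‖ ≤ s →
      ‖Y' + k‖ ≤ 1 / 2 * k → ‖fatouApprox (1 - f.coeff 3) Y' - (X - k)‖ ≤ s →
      ‖(fun x => f.eval x)^[k] (-1 / Y) - (fun x => f.eval x)^[k] (-1 / Y')‖ ≤ η := by
  obtain ⟨C, hC, hA⟩ := exists_repelling_orbit h0 h1 h2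
  obtain ⟨j, hj1, hj⟩ := hA ρ
  set b := 1 - f.coeff 3
  have hj1' : (1 : ℝ) ≤ j := by exact_mod_cast hj1
  let s : Set ℂ := Metric.closedBall (-(j : ℂ)) (1 / 4 * j)
  have huc : UniformContinuousOn (fun Z : ℂ => (fun x => f.eval x)^[j] (-1 / Z)) s := by
    refine (isCompact_closedBall _ _).uniformContinuousOn_of_continuous ?_
    refine (continuous_iterate_eval f j).comp_continuousOn (continuousOn_const.div continuousOn_id ?_)
    rintro Z hZ rfl
    simp only [Metric.mem_closedBall, dist_zero_left, norm_neg, Complex.norm_natCast] at hZ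
    linarith
  obtain ⟨δ, hδ, hdelta⟩ := Metric.uniformContinuousOn_iff.1 huc η hη
  have hE : 0 < Real.exp (C / j) := Real.exp_pos _
  obtain ⟨k₀, hk₀⟩ := exists_nat_ge (4 * ‖b‖ + 2)
  -- Two points whose coordinates are s-close to X - k are 4s-close themselves; after expansion by
  -- exp(C/j) they are still within δ/2.
  refine ⟨min 1 (δ / (8 * Real.exp (C / j))), by positivity, k₀ + j,
    fun k hk X hX Y Y' hY hYΦ hY' hYΦ' => ?_⟩
  have hk' : (k₀ : ℝ) + j ≤ k := by exact_mod_cast hk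
  obtain ⟨⟨a1, -⟩, a2⟩ := hj j k le_rfl (by omega) X hX Y hY (hYΦ.trans (min_le_left _ _))
  obtain ⟨⟨a3, -⟩, -⟩ := hj j k le_rfl (by omega) X hX Y' hY' (hYΦ'.trans (min_le_left _ _))
  have a4 := a2 X hX Y' hY' (hYΦ'.trans (min_le_left _ _))
  have hit : ∀ Y : ℂ, (fun x => f.eval x)^[k] (-1 / Y) =
      (fun x => f.eval x)^[j] (-1 / (atInfinity f)^[k - j] Y) := fun Y => by
    rw [atInfinity_iterate, neg_one_div_neg_one_div, ← Function.iterate_add_apply]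
    congr 2
    omega
  rw [hit Y, hit Y', ← dist_eq_norm]
  refine (hdelta _ ?_ _ ?_ ?_).le
  · simpa [s, dist_eq_norm] using a1
  · simpa [s, dist_eq_norm] using a3
  · rw [dist_eq_norm]
    refine a4.trans_lt ?_
    obtain ⟨-, -, e1, -⟩ := norm_bounds_of_norm_add_le (Z := Y) (x := k) (t := 1 / 2) (by exact_mod_cast hY)
    obtain ⟨-, -, e2, -⟩ := norm_bounds_of_norm_add_le (Z := Y') (x := k) (t := 1 / 2) (by exact_mod_cast hY')
    have a5 := norm_sub_le_two_mul_fatouApprox_left (b := b) (R := k / 2) (by nlinarith [norm_nonneg b])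
      (by linarith) (by linarith : Y.re ≤ _) (by linarith : Y'.re ≤ _)
    have a6 : ‖fatouApprox b Y - fatouApprox b Y'‖ ≤ 2 * (δ / (8 * Real.exp (C / j))) := by
      have e : fatouApprox b Y - fatouApprox b Y' = (fatouApprox b Y - (X - k)) - (fatouApprox b Y' - (X - k)) := by
        ring
      rw [e]
      refine (norm_sub_le _ _).trans ?_
      linarith [min_le_right 1 (δ / (8 * Real.exp (C / j)))]
    calc ‖Y - Y'‖ * Real.exp (C / j) ≤ (2 * (2 * (δ / (8 * Real.exp (C / j))))) * Real.exp (C / j) := by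
          gcongr
          linarith
      _ = δ / 2 := by field_simp; ring
      _ < δ := by linarith

/-- The starting points used in the definition of the parameterization have approximate coordinate X
- k + o(1), because log of their square is 2 log k + o(1). This makes them admissible in the
equicontinuity lemma. -/
lemma exists_repelling_base (b : ℂ) (ρ : ℝ) {s : ℝ} (hs : 0 < s) :
    ∃ k₀ : ℕ, ∀ k : ℕ, k₀ ≤ k → ∀ X : ℂ, ‖X‖ ≤ ρ →
      ‖(X - k + b * (Real.log k : ℂ)) + k‖ ≤ 1 / 2 * k ∧
      ‖fatouApprox b (X - k + b * (Real.log k : ℂ)) - (X - k)‖ ≤ s := by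
  set t := min (1 / 10) (s / (3 * ‖b‖ + 1)) with ht
  have ht0 : 0 < t := by positivity
  have ht1 : t ≤ 1 / 10 := min_le_left _ _
  have ht2 : 3 * ‖b‖ * t ≤ s := by
    have h1 : t ≤ s / (3 * ‖b‖ + 1) := min_le_right _ _
    rw [le_div_iff₀ (by positivity)] at h1
    linarith
  obtain ⟨x₀, hx₀, hx⟩ := exists_add_mul_log_le ρ ‖b‖ ht0
  obtain ⟨k₀, hk₀⟩ := exists_nat_ge x₀
  refine ⟨k₀, fun k hk X hX => ?_⟩
  have hk' : (k₀ : ℝ) ≤ k := by exact_mod_cast hk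
  have hk1 : (1 : ℝ) ≤ k := by linarith
  have h1 := hx k (by linarith)
  have hkc : (k : ℂ) ≠ 0 := by
    have : (k : ℝ) ≠ 0 := by linarith
    exact_mod_cast this
  have h2 : ‖X + b * (Real.log k : ℂ)‖ ≤ t * k := by
    refine (norm_add_le _ _).trans ?_
    rw [norm_mul, Complex.norm_real, Real.norm_eq_abs, abs_of_nonneg (Real.log_nonneg hk1)]
    linarith
  constructor
  · have e : X - k + b * (Real.log k : ℂ) + k = X + b * (Real.log k : ℂ) := by ring
    rw [e]
    nlinarith
  · set u := (X + b * (Real.log k : ℂ)) / k with hu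
    have hun : ‖u‖ ≤ t := by
      rw [hu, norm_div, Complex.norm_natCast, div_le_iff₀ (by linarith)]
      exact h2
    have e : (X - k + b * (Real.log k : ℂ)) ^ 2 = ((k : ℝ) ^ 2 : ℝ) * (1 + (-2 * u + u ^ 2)) := by
      rw [hu]; push_cast; field_simp; ring
    have hy : ‖-2 * u + u ^ 2‖ ≤ 3 * t := by
      refine (norm_add_le _ _).trans ?_
      rw [norm_mul, norm_pow, norm_neg, Complex.norm_ofNat]
      nlinarith [norm_nonneg u]
    have hl := norm_log_one_add_sub_le (y := -2 * u + u ^ 2) (by linarith)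
    have hne : 1 + (-2 * u + u ^ 2) ≠ 0 := by
      intro h
      have := re_one_add_pos (y := -2 * u + u ^ 2) (by linarith)
      rw [h] at this
      simp at this
    have hl2 : ‖Complex.log (1 + (-2 * u + u ^ 2))‖ ≤ 6 * t := by
      have e : Complex.log (1 + (-2 * u + u ^ 2)) = (Complex.log (1 + (-2 * u + u ^ 2)) - (-2 * u + u ^ 2))
        + (-2 * u + u ^ 2) := by ring
      rw [e]
      refine (norm_add_le _ _).trans ?_
      nlinarith [norm_nonneg (-2 * u + u ^ 2)]
    have e2 : fatouApprox b (X - k + b * (Real.log k : ℂ)) - (X - k) =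
        -(b / 2) * Complex.log (1 + (-2 * u + u ^ 2)) := by
      rw [fatouApprox, e, Complex.log_ofReal_mul (by positivity) hne, Real.log_pow]
      push_cast
      ring
    rw [e2, norm_mul, norm_neg, norm_div, Complex.norm_ofNat]
    calc _ ≤ ‖b‖ / 2 * (6 * t) := by gcongr
      _ = 3 * ‖b‖ * t := by ring
      _ ≤ s := ht2

/-- The repelling Fatou parameterization is determined by approximate Fatou coordinates. -/
theorem exists_repelling {f : ℂ[X]} (h0 : f.coeff 0 = 0) (h1 : f.coeff 1 = 1)
    (h2 : f.coeff 2 = 1) (ρ : ℝ) {η : ℝ} (hη : 0 < η) :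
    ∃ s > 0, ∃ k₀ : ℕ, ∀ k : ℕ, k₀ ≤ k → ∀ X : ℂ, ‖X‖ ≤ ρ → ∀ Y : ℂ,
      ‖Y + k‖ ≤ 1 / 2 * k → ‖fatouApprox (1 - f.coeff 3) Y - (X - k)‖ ≤ s →
      ‖(fun x => f.eval x)^[k] (-1 / Y) - repellingFatouParameterization f X‖ ≤ η := by
  set b := 1 - f.coeff 3 with hb
  let E : ℂ → ℕ → ℂ := fun X m =>
    (fun x => f.eval x)^[m] (-1 / (X - (m : ℂ) + b * (Real.log m : ℂ)))
  -- The starting point for k' is carried to label k, where its coordinate differs from X - k by at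
  -- most s/2 + C/k ≤ s. Equicontinuity then compares it with Y. Taking Y itself to be a starting
  -- point gives the Cauchy property; letting k' → ∞ gives the theorem.
  have key : ∀ η > 0, ∃ s > 0, ∃ k₀ : ℕ, ∀ k : ℕ, k₀ ≤ k → ∀ X : ℂ, ‖X‖ ≤ ρ → ∀ Y : ℂ,
      ‖Y + k‖ ≤ 1 / 2 * k → ‖fatouApprox b Y - (X - k)‖ ≤ s →
      ∀ k', k ≤ k' → ‖(fun x => f.eval x)^[k] (-1 / Y) - E X k'‖ ≤ η := by
    intro η hη
    obtain ⟨s, hs, k₁, hk₁⟩ := exists_repelling_equicontinuous h0 h1 h2 ρ hη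
    obtain ⟨C, hC, hA⟩ := exists_repelling_orbit h0 h1 h2
    obtain ⟨j, hj1, hj⟩ := hA ρ
    obtain ⟨k₂, hk₂⟩ := exists_repelling_base b ρ (show 0 < min 1 (s / 2) by positivity)
    obtain ⟨k₃, hk₃⟩ := exists_nat_ge (2 * C / s)
    refine ⟨s, hs, k₁ + k₂ + k₃ + j, fun k hk X hX Y hY hYΦ k' hkk' => ?_⟩
    obtain ⟨b1, b2⟩ := hk₂ k' (by omega) X hX
    obtain ⟨⟨c1, c2⟩, -⟩ := hj k k' (by omega) hkk' X hX _ b1 (b2.trans (min_le_left _ _))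
    set Y' := (atInfinity f)^[k' - k] (X - k' + b * (Real.log k' : ℂ)) with hY'
    have hkR : (k₃ : ℝ) + j ≤ k := by exact_mod_cast (by omega : k₃ + j ≤ k)
    have hj1' : (1 : ℝ) ≤ j := by exact_mod_cast hj1
    have hk3 : (0 : ℝ) ≤ k₃ := k₃.cast_nonneg
    have e : E X k' = (fun x => f.eval x)^[k] (-1 / Y') := by
      rw [hY', atInfinity_iterate, neg_one_div_neg_one_div, ← Function.iterate_add_apply]
      simp only [E]
      congr 2
      omega
    rw [e]
    refine hk₁ k (by omega) X hX Y Y' hY hYΦ (by linarith) (c2.trans ?_)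
    have h3 : C / k ≤ s / 2 := by
      rw [div_le_iff₀ hs] at hk₃
      rw [div_le_iff₀ (by linarith)]
      nlinarith
    linarith [min_le_right 1 (s / 2)]
  have hlim : ∀ X : ℂ, ‖X‖ ≤ ρ → Tendsto (E X) atTop (𝓝 (repellingFatouParameterization f X)) := by
    intro X hX
    have hcs : CauchySeq (E X) := by
      rw [Metric.cauchySeq_iff']
      intro ε hε
      obtain ⟨s, hs, k₁, hk₁⟩ := key (ε / 2) (by linarith)
      obtain ⟨k₂, hk₂⟩ := exists_repelling_base b ρ hs
      refine ⟨k₁ + k₂, fun n hn => ?_⟩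
      obtain ⟨c1, c2⟩ := hk₂ (k₁ + k₂) (by omega) X hX
      rw [dist_comm, dist_eq_norm]
      have := hk₁ (k₁ + k₂) (by omega) X hX _ c1 c2 n hn
      change ‖E X (k₁ + k₂) - E X n‖ ≤ _ at this
      linarith
    obtain ⟨l, hl⟩ := cauchySeq_tendsto_of_complete hcs
    have : repellingFatouParameterization f X = l := hl.limUnder_eq
    rwa [this]
  obtain ⟨s, hs, k₀, hk₀⟩ := key η hη
  refine ⟨s, hs, k₀, fun k hk X hX Y hY hYΦ => ?_⟩
  exact le_of_tendsto ((hlim X hX).const_sub _).norm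
    (eventually_atTop.2 ⟨k, fun k' hk' => hk₀ k hk X hX Y hY hYΦ k' hk'⟩)

/-! ### One step in the gate -/

set_option maxHeartbeats 1000000 in
/-- One step of `z ↦ f z + d` with `d` close to `ε²`, measured against the flow of `z² + ε²`. -/
lemma exists_one_step {f : ℂ[X]} (h0 : f.coeff 0 = 0) (h1 : f.coeff 1 = 1)
    (h2 : f.coeff 2 = 1) (c₀ : ℝ) :
    ∃ r C : ℝ, 0 < r ∧ r ≤ 1 / 16 ∧ 0 ≤ C ∧ ∀ (ε κ e : ℝ) (z d : ℂ), 0 < ε → |κ - c₀ * ε ^ 2| ≤ ε ^ 4 →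
      ‖d - (ε : ℂ) ^ 2‖ ≤ e → ‖z‖ ^ 2 + ε ^ 2 ≤ 4 * ‖z ^ 2 + (ε : ℂ) ^ 2‖ →
      (‖z‖ ^ 2 + ε ^ 2) + e / (‖z‖ ^ 2 + ε ^ 2) ≤ r →
      ε * (ε * (1 - κ)) + z * (f.eval z + d) ≠ 0 ∧
      ‖(ε * (f.eval z + d) - (ε * (1 - κ)) * z) / (ε * (ε * (1 - κ)) + z * (f.eval z + d)) / ε
        - (1 - (1 - f.coeff 3) * z + (c₀ - f.coeff 3) * (ε ^ 2 / (z ^ 2 + (ε : ℂ) ^ 2)) * z)‖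
        ≤ C * ((‖z‖ ^ 2 + ε ^ 2) + e / (‖z‖ ^ 2 + ε ^ 2)) ∧
      ‖((f.eval z + d) ^ 2 + (ε * (1 - κ)) ^ 2) / (z ^ 2 + (ε : ℂ) ^ 2) - 1 - 2 * z‖
        ≤ C * ((‖z‖ ^ 2 + ε ^ 2) + e / (‖z‖ ^ 2 + ε ^ 2)) ∧ |κ| ≤ C * ε ^ 2 := by
  obtain ⟨q, hq⟩ := exists_eval_eq h0 h1 h2
  set a := f.coeff 3
  obtain ⟨Q, hQ, hQb⟩ := exists_norm_eval_le q 1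
  set k₀ := |c₀| + 1 with hk₀
  have hk₀p : 1 ≤ k₀ := by have := abs_nonneg c₀; linarith
  set A := ‖a‖ with hA
  have hAp : 0 ≤ A := norm_nonneg _
  set c₁ := 4 * (Q + 1) with hc₁
  have hc₁p : 0 ≤ c₁ := by positivity
  set c₂ := 4 * A + c₁ + 4 * k₀ with hc₂
  have hc₂p : 0 ≤ c₂ := by positivity
  set c₃ := 2 + 4 * A + 4 * k₀ with hc₃
  have hc₃p : 0 ≤ c₃ := by positivity
  refine ⟨min (1 / 16) (1 / (4 * (c₂ + 1))),
    2 * (c₁ + 4 + 1 + c₃ + c₂ * c₃) + (2 * (4 * A + c₁) + (1 + 4 * A + c₁) ^ 2 + 4 * k₀ * (2 + k₀)) + k₀,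
    by positivity, min_le_left _ _, by positivity, fun ε κ e z d hε hκ hd hM hT => ?_⟩
  set m := √(‖z‖ ^ 2 + ε ^ 2) with hm
  have hm2 : ‖z‖ ^ 2 + ε ^ 2 = m ^ 2 := (Real.sq_sqrt (by positivity)).symm
  have hmp : 0 < m := Real.sqrt_pos.2 (by positivity)
  rw [hm2] at hM hT ⊢
  have hzm : ‖z‖ ≤ m := by
    refine abs_le_of_sq_le_sq' (by nlinarith) hmp.le |>.2
  have hεm : ε ≤ m := by
    refine abs_le_of_sq_le_sq' (by nlinarith [norm_nonneg z]) hmp.le |>.2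
  have he : 0 ≤ e := (norm_nonneg _).trans hd
  set T := m ^ 2 + e / m ^ 2 with hTd
  have hT1 : T ≤ 1 / 16 := hT.trans (min_le_left _ _)
  have hT2 : c₂ * T ≤ 1 / 4 := by
    have h3 := hT.trans (min_le_right _ _)
    rw [le_div_iff₀ (by positivity)] at h3
    have : 0 ≤ T := by positivity
    nlinarith
  have hT0 : 0 ≤ T := by positivity
  have hmT : m ^ 2 ≤ T := by
    have : 0 ≤ e / m ^ 2 := by positivity
    linarith
  have heT : e ≤ m ^ 2 * T := by
    have : e / m ^ 2 ≤ T := by nlinarith [sq_nonneg m]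
    rw [div_le_iff₀ (by positivity)] at this
    linarith
  have hm4 : m ≤ 1 / 4 := by nlinarith
  set D : ℂ := z ^ 2 + (ε : ℂ) ^ 2 with hD
  have hDp : 0 < ‖D‖ := by nlinarith
  have hD0 : D ≠ 0 := norm_pos_iff.1 hDp
  have hDm : ‖D‖ ≤ m ^ 2 := by
    rw [← hm2]
    refine (norm_add_le _ _).trans ?_
    simp
  have hεn : ‖(ε : ℂ)‖ = ε := by rw [Complex.norm_real, Real.norm_eq_abs, abs_of_pos hε]
  have hε0 : (ε : ℂ) ≠ 0 := by exact_mod_cast hε.ne'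
  -- The hypothesis m² ≤ 4‖D‖ keeps z away from the points ±iε; only through it can errors be
  -- divided by D.
  have hdivD : ∀ (x : ℂ) (y : ℝ), ‖x‖ ≤ m ^ 2 * y → ‖x / D‖ ≤ 4 * y := by
    intro x y hx
    rw [norm_div, div_le_iff₀ hDp]
    have hy : 0 ≤ y := by
      have := (norm_nonneg _).trans hx
      have h3 : 0 < m ^ 2 := by positivity
      exact nonneg_of_mul_nonneg_right this h3
    nlinarith
  set E₁ : ℂ := z ^ 4 * q.eval z + (d - (ε : ℂ) ^ 2) with hE₁
  have hE : ‖E₁ / D‖ ≤ c₁ * T := by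
    have : ‖E₁‖ ≤ m ^ 2 * ((Q + 1) * T) := by
      refine (norm_add_le _ _).trans ?_
      rw [norm_mul, norm_pow]
      have h3 : ‖z‖ ^ 4 * ‖q.eval z‖ ≤ m ^ 4 * Q := by
        gcongr
        exact hQb z (by linarith)
      have h4 : m ^ 4 * Q ≤ m ^ 2 * (Q * T) := by
        have : m ^ 4 * Q = m ^ 2 * (Q * m ^ 2) := by ring
        rw [this]
        gcongr
      have h5 : m ^ 2 * ((Q + 1) * T) = m ^ 2 * (Q * T) + m ^ 2 * T := by ring
      linarith
    have := hdivD _ _ this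
    rw [hc₁]
    linarith
  set x : ℂ := a * z ^ 3 + E₁ with hx
  have hz' : f.eval z + d = z + D + x := by rw [hq, hx, hE₁, hD]; ring
  have hw : ‖z ^ 3 / D‖ ≤ 4 * m := by
    refine hdivD _ _ ?_
    rw [norm_pow]
    calc ‖z‖ ^ 3 ≤ m ^ 3 := by gcongr
      _ = m ^ 2 * m := by ring
  have hX : ‖x / D‖ ≤ 4 * A * m + c₁ * T := by
    have : x / D = a * (z ^ 3 / D) + E₁ / D := by rw [hx]; ring
    rw [this]
    refine (norm_add_le _ _).trans ?_
    rw [norm_mul]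
    have := mul_le_mul_of_nonneg_left hw hAp
    linarith
  have hzX : ‖z * (x / D)‖ ≤ (4 * A + c₁) * T := by
    rw [norm_mul]
    calc ‖z‖ * ‖x / D‖ ≤ m * (4 * A * m + c₁ * T) := by gcongr
      _ = 4 * A * m ^ 2 + m * (c₁ * T) := by ring
      _ ≤ 4 * A * T + 1 * (c₁ * T) := by
        gcongr
        linarith
      _ = _ := by ring
  have hε2 : ε ^ 2 ≤ m ^ 2 := by gcongr
  have hκ1 : |κ| ≤ k₀ * ε ^ 2 := by
    have h3 : |κ| ≤ |κ - c₀ * ε ^ 2| + |c₀ * ε ^ 2| := by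
      have := abs_add_le (κ - c₀ * ε ^ 2) (c₀ * ε ^ 2)
      simpa using this
    rw [abs_mul, abs_of_pos (by positivity : 0 < ε ^ 2)] at h3
    have h4 : ε ^ 4 ≤ ε ^ 2 := by
      have : ε ^ 2 ≤ 1 := by nlinarith
      nlinarith [sq_nonneg ε]
    rw [hk₀]
    linarith
  have hκ2 : |κ| ≤ k₀ * T := by
    refine hκ1.trans ?_
    gcongr
    linarith
  have hκn : ‖(κ : ℂ)‖ = |κ| := by rw [Complex.norm_real, Real.norm_eq_abs]
  have hκD : ‖(κ : ℂ) * (ε : ℂ) ^ 2 / D‖ ≤ 4 * k₀ * T := by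
    have := hdivD ((κ : ℂ) * (ε : ℂ) ^ 2) (k₀ * T) (by
      rw [norm_mul, norm_pow, hκn, hεn, mul_comm]
      gcongr)
    linarith only [this]
  -- The second-order relative error in the denominator, which equals D(1 + z + y₁).
  set y₁ : ℂ := z * (x / D) - (κ : ℂ) * (ε : ℂ) ^ 2 / D with hy₁
  have hy₁n : ‖y₁‖ ≤ c₂ * T := by
    refine (norm_sub_le _ _).trans ?_
    rw [hc₂]
    linarith
  have hB : ε * (ε * (1 - κ)) + z * (f.eval z + d) = D * (1 + z + y₁) := by
    rw [hz', hy₁]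
    field_simp
    rw [hD]
    ring
  have hP : 1 / 2 ≤ ‖1 + z + y₁‖ := by
    have e1 : (1 : ℂ) = (1 + z + y₁) - (z + y₁) := by ring
    have h3 : (1 : ℝ) ≤ ‖1 + z + y₁‖ + ‖z + y₁‖ := by
      calc (1 : ℝ) = ‖(1 : ℂ)‖ := norm_one.symm
        _ = ‖(1 + z + y₁) - (z + y₁)‖ := by rw [← e1]
        _ ≤ _ := norm_sub_le _ _
    have := norm_add_le z y₁
    linarith only [this, h3, hzm, hm4, hy₁n, hT2]
  have hP0 : 1 + z + y₁ ≠ 0 := by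
    intro h
    rw [h] at hP
    norm_num at hP
  set α : ℂ := a * (z ^ 3 / D) + c₀ * (ε ^ 2 * z / D) with hα
  have hεz : ‖(ε : ℂ) ^ 2 * z / D‖ ≤ 4 * m := by
    refine hdivD _ _ ?_
    rw [norm_mul, norm_pow, hεn]
    gcongr
  have hαn : ‖α‖ ≤ (4 * A + 4 * k₀) * m := by
    refine (norm_add_le _ _).trans ?_
    rw [norm_mul, norm_mul, Complex.norm_real, Real.norm_eq_abs]
    have h3 := mul_le_mul_of_nonneg_left hw hAp
    have h4 := mul_le_mul_of_nonneg_left hεz (abs_nonneg c₀)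
    rw [hk₀]
    have h5 : (|c₀| + 1) * m = |c₀| * m + m := by ring
    linarith only [h3, h4, h5, hmp]
  set y₂ : ℂ := E₁ / D + (κ - c₀ * ε ^ 2) * z / D with hy₂
  have hy₂n : ‖y₂‖ ≤ (c₁ + 4) * T := by
    have : ‖((κ : ℂ) - c₀ * ε ^ 2) * z / D‖ ≤ 4 * T := by
      refine hdivD _ _ ?_
      have e1 : ((κ : ℂ) - c₀ * ε ^ 2) = ((κ - c₀ * ε ^ 2 : ℝ) : ℂ) := by push_cast; ring
      rw [norm_mul, e1, Complex.norm_real, Real.norm_eq_abs]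
      calc |κ - c₀ * ε ^ 2| * ‖z‖ ≤ m ^ 4 * 1 := by
            gcongr
            · exact hκ.trans (by gcongr)
            · linarith
        _ = m ^ 2 * m ^ 2 := by ring
        _ ≤ m ^ 2 * T := by gcongr
    refine (norm_add_le _ _).trans ?_
    linarith
  have hαc : 1 - (1 - a) * z + (c₀ - a) * (ε ^ 2 / D) * z = 1 - z + α := by
    rw [hα]
    field_simp
    rw [hD]
    ring
  have hαn' : ‖1 - z + α‖ ≤ c₃ := by
    refine (norm_add_le _ _).trans ((add_le_add_left (norm_sub_le _ _) _).trans ?_)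
    rw [norm_one, hc₃]
    have h3 : (4 * A + 4 * k₀) * m ≤ 4 * A + 4 * k₀ :=
      mul_le_of_le_one_right (by positivity) (by linarith only [hm4])
    linarith only [hαn, hzm, hm4, h3]
  refine ⟨?_, ?_, ?_, ?_⟩
  · rw [hB]
    exact mul_ne_zero hD0 hP0
  · rw [hB, hαc]
    -- The quotient is (1 + α + y₂)/(1 + z + y₁). Subtracting 1 - z + α cancels the first-order
    -- terms and leaves only products of small quantities and the errors y₁, y₂.
    have e1 : (ε * (f.eval z + d) - ε * (1 - κ) * z) / (D * (1 + z + y₁)) / ε - (1 - z + α) =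
        (y₂ + z * z - z * α - y₁ * (1 - z + α)) / (1 + z + y₁) := by
      have e2 : (ε * (f.eval z + d) - ε * (1 - κ) * z) / (D * (1 + z + y₁)) / ε =
          (1 + α + y₂) / (1 + z + y₁) := by
        rw [hz', hα, hy₂, hx]
        field_simp
        ring
      rw [e2]
      field_simp
      ring
    rw [e1, norm_div, div_le_iff₀ (by linarith)]
    have h3 : ‖z * z‖ ≤ T := by
      rw [norm_mul, ← sq]
      exact le_trans (pow_le_pow_left₀ (norm_nonneg z) hzm 2) hmT
    have h4 : ‖z * α‖ ≤ c₃ * T := by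
      rw [norm_mul]
      calc ‖z‖ * ‖α‖ ≤ m * ((4 * A + 4 * k₀) * m) := by gcongr
        _ = (4 * A + 4 * k₀) * m ^ 2 := by ring
        _ ≤ c₃ * T := by
          gcongr
          rw [hc₃]
          linarith only
    have h5 : ‖y₁ * (1 - z + α)‖ ≤ c₂ * c₃ * T := by
      rw [norm_mul]
      calc ‖y₁‖ * ‖1 - z + α‖ ≤ (c₂ * T) * c₃ := by gcongr
        _ = _ := by ring
    have h6 : ‖y₂ + z * z - z * α - y₁ * (1 - z + α)‖ ≤ (c₁ + 4 + 1 + c₃ + c₂ * c₃) * T := by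
      refine (norm_sub_le _ _).trans ((add_le_add_left ((norm_sub_le _ _).trans
        (add_le_add_left (norm_add_le _ _) _)) _).trans ?_)
      linarith only [h3, h4, h5, hy₂n]
    refine h6.trans ?_
    calc (c₁ + 4 + 1 + c₃ + c₂ * c₃) * T = (2 * (c₁ + 4 + 1 + c₃ + c₂ * c₃)) * T * (1 / 2) := by ring
      _ ≤ _ := by
        gcongr
        exact (le_add_of_nonneg_right (by positivity : (0 : ℝ) ≤ 2 * (4 * A + c₁) + (1 + 4 * A + c₁) ^ 2
          + 4 * k₀ * (2 + k₀))).trans (le_add_of_nonneg_right (by linarith only [hk₀p]))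
  · have e1 : ((f.eval z + d) ^ 2 + (ε * (1 - κ)) ^ 2) / D - 1 - 2 * z =
        2 * (z * (x / D)) + D * (1 + x / D) ^ 2 + (κ * ε ^ 2 / D) * (κ - 2) := by
      rw [hz']
      field_simp
      rw [hD]
      ring
    rw [e1]
    have h3 : ‖D * (1 + x / D) ^ 2‖ ≤ (1 + 4 * A + c₁) ^ 2 * T := by
      rw [norm_mul, norm_pow]
      have h4 : ‖1 + x / D‖ ≤ 1 + 4 * A + c₁ := by
        refine (norm_add_le _ _).trans ?_
        rw [norm_one, add_assoc]
        refine add_le_add_right (hX.trans (add_le_add ?_ ?_)) _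
        · exact mul_le_of_le_one_right (by positivity) (by linarith only [hm4])
        · exact mul_le_of_le_one_right (by positivity) (by linarith only [hT1])
      calc ‖D‖ * ‖1 + x / D‖ ^ 2 ≤ T * (1 + 4 * A + c₁) ^ 2 := by
            gcongr
            exact hDm.trans hmT
        _ = _ := by ring
    have h4 : ‖(κ * (ε : ℂ) ^ 2 / D) * (κ - 2)‖ ≤ 4 * k₀ * (2 + k₀) * T := by
      rw [norm_mul]
      have : ‖(κ : ℂ) - 2‖ ≤ 2 + k₀ := by
        refine (norm_sub_le _ _).trans ?_
        rw [hκn, Complex.norm_ofNat]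
        have : k₀ * T ≤ k₀ := mul_le_of_le_one_right (by linarith only [hk₀p]) (by linarith only [hT1])
        linarith only [this, hκ2]
      calc _ ≤ (4 * k₀ * T) * (2 + k₀) := by gcongr
        _ = _ := by ring
    have h5 : ‖2 * (z * (x / D))‖ ≤ 2 * (4 * A + c₁) * T := by
      rw [norm_mul, Complex.norm_ofNat]
      linarith only [hzX]
    refine (norm_add_le _ _).trans ((add_le_add_left (norm_add_le _ _) _).trans ?_)
    have h6 : 0 ≤ 2 * (c₁ + 4 + 1 + c₃ + c₂ * c₃) * T := by positivity
    have h7 : 0 ≤ k₀ * T := by positivity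
    linarith only [h3, h4, h5, h6, h7]
  · refine hκ1.trans (mul_le_mul_of_nonneg_right ?_ (sq_nonneg ε))
    refine le_add_of_nonneg_left ?_
    positivity

/-- Half the size of the perturbation gate: `ε² = π² / (4 N)`. -/
noncomputable def gateSize (N : ℝ) : ℝ := Real.pi / (2 * √N)

lemma gateSize_pos {N : ℝ} (hN : 0 < N) : 0 < gateSize N := by
  have := Real.pi_pos
  have := Real.sqrt_pos.2 hN
  rw [gateSize]
  positivity

lemma gateSize_sq {N : ℝ} (hN : 0 < N) : gateSize N ^ 2 = Real.pi ^ 2 / (4 * N) := by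
  rw [gateSize, div_pow, mul_pow, Real.sq_sqrt hN.le]
  norm_num

/-- Here 1 - κ = √(N/(N+1)), so κ is about 1/(2N) = (2/π²)ε². This is the origin of the constant
2/π² in the conserved phase. The last bound compares the increment of the reference angle with ε. -/
lemma exists_gateSize_succ {N : ℝ} (hN : 0 < N) : ∃ κ : ℝ, gateSize (N + 1) = gateSize N * (1 - κ) ∧
    |κ - 2 / Real.pi ^ 2 * gateSize N ^ 2| ≤ gateSize N ^ 4 ∧
    |Real.pi * (√(N + 1) - √N) - gateSize N| ≤ gateSize N ^ 3 := by
  have hpi := Real.pi_gt_three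
  set s := √N with hs
  set t := √(N + 1) with ht
  have hs0 : 0 < s := Real.sqrt_pos.2 hN
  have hst : s < t := Real.sqrt_lt_sqrt hN.le (by linarith)
  have ht0 : 0 < t := hs0.trans hst
  have hs2 : s ^ 2 = N := Real.sq_sqrt hN.le
  have ht2 : t ^ 2 = s ^ 2 + 1 := by rw [hs2]; exact Real.sq_sqrt (by linarith)
  have hd : t - s = 1 / (t + s) := by
    rw [eq_div_iff (by linarith)]
    nlinarith
  refine ⟨1 - s / t, ?_, ?_, ?_⟩
  · simp only [gateSize, ← hs, ← ht]
    field_simp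
    ring
  · have e1 : 2 / Real.pi ^ 2 * gateSize N ^ 2 = 1 / (2 * s ^ 2) := by
      rw [gateSize, ← hs]
      field_simp
    have e2 : 1 - s / t = 1 / (t * (t + s)) := by
      have : 1 - s / t = (t - s) / t := by field_simp
      rw [this, hd, div_div, mul_comm]
    have e3 : gateSize N ^ 4 = Real.pi ^ 4 / (16 * s ^ 4) := by
      rw [gateSize, ← hs]
      field_simp
      ring
    have hp4 : 81 ≤ Real.pi ^ 4 := by
      have : (3 : ℝ) ^ 4 ≤ Real.pi ^ 4 := by gcongr
      norm_num at this
      exact this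
    rw [e1, e2, e3, abs_sub_comm, abs_of_nonneg]
    · have h3 : 1 / (2 * s ^ 2) - 1 / (t * (t + s)) ≤ 1 / (2 * s ^ 4) := by
        have : 1 / (2 * s ^ 2) - 1 / (t * (t + s)) = (t - s) * (t + 2 * s) / (2 * s ^ 2 * (t * (t + s))) := by
          field_simp
          ring
        rw [this, hd, div_le_div_iff₀ (by positivity) (by positivity)]
        have h5 : 1 / (t + s) * (t + 2 * s) ≤ 2 := by
          rw [div_mul_eq_mul_div, div_le_iff₀ (by linarith)]
          linarith
        have h6 : 2 * s ^ 4 ≤ s ^ 2 * (t * (t + s)) := by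
          have : 2 * s ^ 2 ≤ t * (t + s) := by nlinarith
          nlinarith [sq_nonneg s]
        calc 1 / (t + s) * (t + 2 * s) * (2 * s ^ 4) ≤ 2 * (2 * s ^ 4) := by gcongr
          _ ≤ 1 * (2 * s ^ 2 * (t * (t + s))) := by linarith
      refine h3.trans ?_
      rw [div_le_div_iff₀ (by positivity) (by positivity)]
      have : 0 < s ^ 4 := by positivity
      nlinarith
    · rw [sub_nonneg]
      apply one_div_le_one_div_of_le (by positivity)
      nlinarith
  · have e0 : Real.pi * (t - s) = Real.pi / (t + s) := by rw [hd, mul_one_div]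
    have e1 : gateSize N - Real.pi / (t + s) = Real.pi * (t - s) / (2 * s * (t + s)) := by
      rw [gateSize, ← hs]
      field_simp
      ring
    have e3 : gateSize N ^ 3 = Real.pi ^ 3 / (8 * s ^ 3) := by
      rw [gateSize, ← hs]
      field_simp
      ring
    have hts : 0 < t - s := by linarith
    rw [abs_sub_comm, e0, e1, e3, abs_of_nonneg (by positivity), hd, mul_one_div, div_div,
      div_le_div_iff₀ (by positivity) (by positivity)]
    have h4 : 4 * s ^ 2 ≤ (t + s) ^ 2 := by nlinarith
    have h5 : Real.pi ≤ Real.pi ^ 3 := le_self_pow₀ (by linarith) (by norm_num)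
    calc Real.pi * (8 * s ^ 3) = Real.pi * (2 * s * (4 * s ^ 2)) := by ring
      _ ≤ Real.pi ^ 3 * (2 * s * (t + s) ^ 2) := by gcongr
      _ = _ := by ring

/-- Throughout one passage ε stays close to π/(2n), so the delay v can be measured in this single
time unit. -/
lemma gateSize_comparison {n N : ℝ} (hn : 1 ≤ n) (h1 : n ^ 2 ≤ N) (h2 : N ≤ (n + 1) ^ 2) :
    gateSize N ≤ Real.pi / (2 * n) ∧ Real.pi / (2 * n) ≤ 2 * gateSize N ∧
    |gateSize N / (Real.pi / (2 * n)) - 1| ≤ 2 * gateSize N ∧ 1 / n ≤ 2 * gateSize N := by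
  have hpi := Real.pi_gt_three
  have hN : 0 < N := by nlinarith
  set s := √N with hs
  have hs2 : s ^ 2 = N := Real.sq_sqrt hN.le
  have hs0 : 0 < s := Real.sqrt_pos.2 hN
  have a1 : n ≤ s := Real.le_sqrt_of_sq_le h1
  have a2 : s ≤ n + 1 := by
    rw [hs, Real.sqrt_le_left (by linarith)]
    exact h2
  refine ⟨?_, ?_, ?_, ?_⟩
  · rw [gateSize, ← hs]
    gcongr
  · rw [gateSize, ← hs, ← mul_div_assoc, div_le_div_iff₀ (by positivity) (by positivity)]
    nlinarith
  · have : gateSize N / (Real.pi / (2 * n)) = n / s := by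
      rw [gateSize, ← hs]
      field_simp
    rw [this, abs_sub_comm, abs_of_nonneg (by rw [sub_nonneg, div_le_one hs0]; exact a1), gateSize, ← hs,
      ← mul_div_assoc, le_div_iff₀ (by positivity)]
    have : (1 - n / s) * (2 * s) = 2 * (s - n) := by field_simp
    rw [this]
    linarith
  · rw [gateSize, ← hs, ← mul_div_assoc, div_le_div_iff₀ (by positivity) (by positivity)]
    nlinarith

/-- The solution is arctan r. The cubic error is essential: after division by ε it is still of
second order. -/
lemma exists_sin_eq_mul_cos {r : ℂ} (hr : ‖r‖ ≤ 1 / 2) :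
    ∃ w : ℂ, Complex.sin w = r * Complex.cos w ∧ ‖w - r‖ ≤ 2 * ‖r‖ ^ 3 := by
  refine ⟨Complex.arctan r, ?_, ?_⟩
  · have hI : ∀ s : ℂ, ‖s‖ = 1 → r ≠ s := by
      rintro s hs rfl
      rw [hs] at hr
      norm_num at hr
    have ht := Complex.tan_arctan (hI _ Complex.norm_I) (hI (-Complex.I) (by simp))
    have hc : Complex.cos (Complex.arctan r) ≠ 0 := by
      intro h
      rw [Complex.tan, h, div_zero] at ht
      subst ht
      have : Complex.arctan 0 = 0 := by simp [Complex.arctan]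
      rw [this, Complex.cos_zero] at h
      exact one_ne_zero h
    rw [Complex.tan, div_eq_iff hc] at ht
    exact ht
  · have hs := Complex.hasSum_arctan (z := r) (by linarith)
    rw [← hasSum_nat_add_iff' 1] at hs
    simp only [Finset.range_one, Finset.sum_singleton, pow_zero, mul_zero, zero_add, pow_one, one_mul,
      Nat.cast_one, div_one] at hs
    rw [← hs.tsum_eq]
    have hg : HasSum (fun n : ℕ => ‖r‖ ^ 3 * (1 / 2 : ℝ) ^ n) (‖r‖ ^ 3 * 2) := hasSum_geometric_two.mul_left _
    refine (tsum_of_norm_bounded hg fun i => ?_).trans (le_of_eq (mul_comm _ _))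
    rw [norm_div, norm_mul, norm_pow, norm_pow, norm_neg, norm_one, one_pow, one_mul, Complex.norm_natCast]
    have h1 : (1 : ℝ) ≤ ((2 * (i + 1) + 1 : ℕ) : ℝ) := by exact_mod_cast Nat.le_add_left _ _
    refine (div_le_self (by positivity) h1).trans ?_
    have h2 : ‖r‖ ^ (2 * (i + 1) + 1) = ‖r‖ ^ 3 * (‖r‖ ^ 2) ^ i := by ring
    rw [h2]
    gcongr
    nlinarith [norm_nonneg r]

/-- The tangent subtraction formula: for z = -ε cot χ and z' = -ε' cot χ', the ratio r is tan(χ' -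
χ). With denominators cleared, zeros of the sine need no separate treatment. -/
lemma tangent_step {z z' χ w r ε ε' : ℂ} (hε : ε ≠ 0) (hB : ε * ε' + z * z' ≠ 0)
    (h : z * Complex.sin χ = -ε * Complex.cos χ) (hw : Complex.sin w = r * Complex.cos w)
    (hr : r = (ε * z' - ε' * z) / (ε * ε' + z * z')) :
    z' * Complex.sin (χ + w) = -ε' * Complex.cos (χ + w) := by
  rw [Complex.sin_add, Complex.cos_add, hw]
  rw [eq_div_iff hB] at hr
  have h1 : z' * (Complex.sin χ + r * Complex.cos χ) + ε' * (Complex.cos χ - r * Complex.sin χ) = 0 := by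
    have h2 : ε * (z' * (Complex.sin χ + r * Complex.cos χ) + ε' * (Complex.cos χ - r * Complex.sin χ)) = 0 := by
      linear_combination (-Complex.sin χ) * hr + (z' * r + ε') * h
    exact (mul_eq_zero.1 h2).resolve_left hε
  linear_combination Complex.cos w * h1

/-- The quantity that is nearly conserved while passing through the gate. -/
noncomputable def gatePhase (b c v z : ℂ) (ε : ℝ) : ℂ :=
  v + b / 2 * Complex.log (z ^ 2 + (ε : ℂ) ^ 2) + c / 2 * ((ε : ℂ) ^ 2 / (z ^ 2 + (ε : ℂ) ^ 2))

set_option maxHeartbeats 1000000 in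
-- To first order v changes by -bz + cwz, where D = z² + ε² and w = ε²/D, while log D changes by 2z
-- and w by -2zw. The coefficients b/2 and c/2 in `gatePhase` are exactly those for which these
-- changes cancel.
lemma exists_gate_step {f : ℂ[X]} (h0 : f.coeff 0 = 0) (h1 : f.coeff 1 = 1)
    (h2 : f.coeff 2 = 1) :
    ∃ r C : ℝ, 0 < r ∧ 0 ≤ C ∧ ∀ (n N e : ℝ) (z d v : ℂ), 1 ≤ n → n ^ 2 ≤ N → N + 1 ≤ (n + 1) ^ 2 →
      ‖d - (gateSize N : ℂ) ^ 2‖ ≤ e → ‖z‖ ^ 2 + gateSize N ^ 2 ≤ 4 * (z ^ 2 + (gateSize N : ℂ) ^ 2).re →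
      (‖z‖ ^ 2 + gateSize N ^ 2) + e / (‖z‖ ^ 2 + gateSize N ^ 2) ≤ r →
      z * Complex.sin ((Real.pi * (√N - n) : ℝ) + (Real.pi / (2 * n) : ℝ) * v) =
        -gateSize N * Complex.cos ((Real.pi * (√N - n) : ℝ) + (Real.pi / (2 * n) : ℝ) * v) →
      ∃ v' : ℂ, (f.eval z + d) * Complex.sin ((Real.pi * (√(N + 1) - n) : ℝ) + (Real.pi / (2 * n) : ℝ) * v') =
        -gateSize (N + 1) * Complex.cos ((Real.pi * (√(N + 1) - n) : ℝ) + (Real.pi / (2 * n) : ℝ) * v') ∧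
        ‖v' - v‖ ≤ 1 ∧
        ‖gatePhase (1 - f.coeff 3) ((2 / Real.pi ^ 2 : ℝ) - f.coeff 3) v' (f.eval z + d) (gateSize (N + 1))
          - gatePhase (1 - f.coeff 3) ((2 / Real.pi ^ 2 : ℝ) - f.coeff 3) v z (gateSize N)‖ ≤
          C * ((‖z‖ ^ 2 + gateSize N ^ 2) + e / (‖z‖ ^ 2 + gateSize N ^ 2)) := by
  obtain ⟨r, C, hr, hr16, hC, hstep⟩ := exists_one_step h0 h1 h2 (2 / Real.pi ^ 2)
  set b := 1 - f.coeff 3 with hb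
  set c : ℂ := ((2 / Real.pi ^ 2 : ℝ) : ℂ) - f.coeff 3 with hc
  set l := ‖b‖ + 4 * ‖c‖ with hl
  have hl0 : 0 ≤ l := by positivity
  set C₁ := 17 + C + 2 * l with hC₁
  set C₂ := ‖b‖ / 2 * (C + (8 + 2 * C ^ 2)) with hC₂
  set C₃ := ‖c‖ / 2 * (4 * (2 * (5 * C + 4))) with hC₃
  -- The second bound makes the first-order change of v at most 1/16 and keeps C·T at most 1/256;
  -- this gives ‖v' - v‖ ≤ 1 and room for the logarithm expansions.
  refine ⟨min r (1 / (256 * (l + C + 1) ^ 2)), C₁ + C₂ + C₃, by positivity, by positivity,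
    fun n N e z d v hn hN1 hN2 hd hM hT hχ => ?_⟩
  have hN : 0 < N := by nlinarith
  set ε := gateSize N with hε
  have hε0 : 0 < ε := gateSize_pos hN
  obtain ⟨κ, hκ, hκ1, hγ⟩ := exists_gateSize_succ hN
  obtain ⟨g1, g2, g3, -⟩ := gateSize_comparison hn hN1 (by linarith : N ≤ (n + 1) ^ 2)
  rw [← hε] at hκ hκ1 hγ g1 g2 g3
  set εs := Real.pi / (2 * n) with hεs
  have hεs0 : 0 < εs := by have := Real.pi_pos; positivity
  set D : ℂ := z ^ 2 + (ε : ℂ) ^ 2 with hD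
  set M := ‖z‖ ^ 2 + ε ^ 2 with hMd
  have hMp : 0 < M := by positivity
  have hDre : 0 < D.re := by linarith
  have hDM : M ≤ 4 * ‖D‖ := by linarith [(le_abs_self _).trans (Complex.abs_re_le_norm D)]
  have hDp : 0 < ‖D‖ := by linarith
  have hD0 : D ≠ 0 := norm_pos_iff.1 hDp
  obtain ⟨s1, s2, s3, s4⟩ := hstep ε κ e z d hε0 hκ1 hd hDM (hT.trans (min_le_left _ _))
  set T := M + e / M with hTd
  have he0 : 0 ≤ e := (norm_nonneg _).trans hd
  have hMT : M ≤ T := by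
    have : 0 ≤ e / M := by positivity
    linarith
  have hT0 : 0 ≤ T := by linarith
  have hT16 : T ≤ 1 / 16 := (hT.trans (min_le_left _ _)).trans hr16
  have hTl : (l + C + 1) ^ 2 * T ≤ 1 / 256 := by
    have h3 := hT.trans (min_le_right _ _)
    rw [le_div_iff₀ (by positivity)] at h3
    linarith
  have hCT : C * T ≤ 1 / 256 := by
    refine le_trans ?_ hTl
    gcongr
    nlinarith only [hl0, hC]
  set z' := f.eval z + d with hz'
  have hε0c : (ε : ℂ) ≠ 0 := by exact_mod_cast hε0.ne'
  have hεsc : (εs : ℂ) ≠ 0 := by exact_mod_cast hεs0.ne'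
  have hεn : ‖(ε : ℂ)‖ = ε := by rw [Complex.norm_real, Real.norm_eq_abs, abs_of_pos hε0]
  have hεsn : ‖(εs : ℂ)‖ = εs := by rw [Complex.norm_real, Real.norm_eq_abs, abs_of_pos hεs0]
  obtain ⟨m, hm0, hm⟩ : ∃ m : ℝ, 0 ≤ m ∧ m ^ 2 = M := ⟨√M, Real.sqrt_nonneg _, Real.sq_sqrt hMp.le⟩
  have hzm : ‖z‖ ≤ m := abs_le_of_sq_le_sq' (by rw [hm]; linarith only [hMd, sq_nonneg ε]) hm0 |>.2
  have hεm : ε ≤ m := abs_le_of_sq_le_sq' (by rw [hm]; linarith only [hMd, sq_nonneg ‖z‖]) hm0 |>.2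
  have hm4 : m ≤ 1 / 4 := abs_le_of_sq_le_sq' (by rw [hm]; linarith only [hMT, hT16]) (by norm_num) |>.2
  have hlm : l * m ≤ 1 / 16 := by
    refine abs_le_of_sq_le_sq' ?_ (by norm_num) |>.2
    rw [mul_pow, hm]
    have : l ^ 2 * M ≤ (l + C + 1) ^ 2 * T := by
      gcongr
      linarith only [hC]
    linarith only [this, hTl]
  set w : ℂ := (ε : ℂ) ^ 2 / D with hw
  have hwn : ‖w‖ ≤ 4 := by
    rw [hw, norm_div, norm_pow, hεn, div_le_iff₀ hDp]
    linarith only [hDM, hMd, sq_nonneg ‖z‖]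
  set L : ℂ := -b * z + c * w * z with hL
  have hLn : ‖L‖ ≤ l * m := by
    refine (norm_add_le _ _).trans ?_
    rw [norm_mul, norm_mul, norm_mul, norm_neg]
    calc ‖b‖ * ‖z‖ + ‖c‖ * ‖w‖ * ‖z‖ ≤ ‖b‖ * m + ‖c‖ * 4 * m := by gcongr
      _ = l * m := by rw [hl]; ring
  set B : ℂ := ε * (ε * (1 - κ)) + z * z' with hB
  set rr : ℂ := (ε * z' - (ε * (1 - κ)) * z) / B with hrr
  set y₀ : ℂ := rr / ε - 1 - L with hy₀
  have hy₀n : ‖y₀‖ ≤ C * T := by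
    have : y₀ = rr / ε - (1 - b * z + (((2 / Real.pi ^ 2 : ℝ) : ℂ) - f.coeff 3) * w * z) := by
      rw [hy₀, hL, hc]; ring
    rw [this]
    exact s2
  have hrrn : ‖rr‖ ≤ 2 * ε := by
    have e1 : rr = ε * (1 + L + y₀) := by rw [hy₀]; field_simp; ring
    rw [e1, norm_mul, hεn, mul_comm]
    gcongr
    refine (norm_add_le _ _).trans ((add_le_add_left (norm_add_le _ _) _).trans ?_)
    rw [norm_one]
    linarith only [hLn, hlm, hy₀n, hCT]
  obtain ⟨ω, hω1, hω2⟩ := exists_sin_eq_mul_cos (r := rr) (by linarith only [hrrn, hεm, hm4])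
  set γ := Real.pi * (√(N + 1) - √N) with hγd
  -- The true angle advances by ω and the reference angle by γ; their difference, in time units εs,
  -- is the change of delay.
  refine ⟨v + (ω - γ) / εs, ?_, ?_⟩
  · have := tangent_step (z' := z') (ε' := ε * (1 - κ)) hε0c s1 hχ hω1 hrr
    have e1 : ((Real.pi * (√(N + 1) - n) : ℝ) : ℂ) + (εs : ℂ) * (v + (ω - γ) / εs) =
        ((Real.pi * (√N - n) : ℝ) : ℂ) + (εs : ℂ) * v + ω := by
      rw [hγd]
      field_simp
      push_cast
      ring
    have e2 : ((ε * (1 - κ) : ℝ) : ℂ) = ε * (1 - κ) := by push_cast; ring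
    rw [e1, hκ, e2]
    exact this
  · have hε2T : ε ^ 2 ≤ T := by linarith only [hMT, hMd, sq_nonneg ‖z‖]
    have hv : ‖(v + (ω - γ) / εs) - v - L‖ ≤ C₁ * T := by
      -- Four sources of error: the arctangent remainder, the reference increment γ against ε, the
      -- one-step error y₀, and the unit εs used in place of ε.
      have e1 : (v + (ω - γ) / εs) - v - L = (ω - rr) / εs + ((ε - γ : ℝ) : ℂ) / εs +
          ((ε / εs : ℝ) : ℂ) * y₀ + ((ε / εs - 1 : ℝ) : ℂ) * L := by
        rw [hy₀]
        push_cast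
        field_simp
        ring
      have t1 : ‖(ω - rr) / εs‖ ≤ 16 * T := by
        rw [norm_div, hεsn, div_le_iff₀ hεs0]
        calc ‖ω - rr‖ ≤ 2 * (2 * ε) ^ 3 := hω2.trans (by gcongr)
          _ = 16 * ε ^ 2 * ε := by ring
          _ ≤ 16 * T * εs := by gcongr
      have t2 : ‖((ε - γ : ℝ) : ℂ) / εs‖ ≤ T := by
        rw [norm_div, hεsn, div_le_iff₀ hεs0, Complex.norm_real, Real.norm_eq_abs, abs_sub_comm]
        calc |γ - ε| ≤ ε ^ 2 * ε := by rw [← pow_succ]; exact hγ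
          _ ≤ T * εs := by gcongr
      have t3 : ‖((ε / εs : ℝ) : ℂ) * y₀‖ ≤ C * T := by
        rw [norm_mul, Complex.norm_real, Real.norm_eq_abs, abs_of_nonneg (by positivity)]
        have : ε / εs ≤ 1 := by rw [div_le_one hεs0]; exact g1
        calc ε / εs * ‖y₀‖ ≤ 1 * (C * T) := by gcongr
          _ = _ := one_mul _
      have t4 : ‖((ε / εs - 1 : ℝ) : ℂ) * L‖ ≤ 2 * l * T := by
        rw [norm_mul, Complex.norm_real, Real.norm_eq_abs]
        calc |ε / εs - 1| * ‖L‖ ≤ (2 * m) * (l * m) := by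
              gcongr
              exact g3.trans (by linarith only [hεm])
          _ = 2 * l * M := by rw [← hm]; ring
          _ ≤ _ := by gcongr
      rw [e1]
      refine (norm_add_le _ _).trans ((add_le_add_left ((norm_add_le _ _).trans
        (add_le_add_left (norm_add_le _ _) _)) _).trans ?_)
      rw [hC₁]
      linarith only [t1, t2, t3, t4]
    set v' := v + (ω - γ) / εs
    constructor
    · have e1 : v' - v = (v' - v - L) + L := by ring
      rw [e1]
      refine (norm_add_le _ _).trans ?_
      have t1 : (17 + C + 2 * l) * T ≤ 20 * ((l + C + 1) ^ 2 * T) := by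
        rw [← mul_assoc]
        gcongr
        nlinarith only [hl0, hC]
      rw [hC₁] at hv
      linarith only [hv, hLn, hlm, t1, hTl]
    · set ε' := gateSize (N + 1) with hε'
      have hε'c : (ε' : ℂ) = ε * (1 - κ) := by rw [hκ]; push_cast; ring
      set Y : ℂ := (z' ^ 2 + (ε' : ℂ) ^ 2) / D - 1 with hY
      set y : ℂ := Y - 2 * z with hy
      have hyn : ‖y‖ ≤ C * T := by rw [hy, hY, hε'c]; exact s3
      have hYn : ‖Y‖ ≤ 2 * m + C * T := by
        have : Y = 2 * z + y := by rw [hy]; ring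
        rw [this]
        refine (norm_add_le _ _).trans ?_
        rw [norm_mul, Complex.norm_ofNat]
        linarith only [hyn, hzm]
      have hm16 : m ≤ 1 / 8 := by
        refine abs_le_of_sq_le_sq' ?_ (by norm_num) |>.2
        have : 1 * T ≤ (l + C + 1) ^ 2 * T := by
          gcongr
          nlinarith only [hl0, hC]
        rw [hm]
        linarith only [this, hTl, hMT]
      have hY2 : ‖Y‖ ≤ 1 / 2 := by linarith only [hYn, hm16, hCT]
      have hD' : z' ^ 2 + (ε' : ℂ) ^ 2 = D * (1 + Y) := by rw [hY]; field_simp; ring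
      have h1Y : 1 + Y ≠ 0 := by
        intro h
        have := re_one_add_pos hY2
        rw [h] at this
        simp at this
      have h1Yn : 1 / 2 ≤ ‖1 + Y‖ := by
        have := norm_sub_norm_le (1 : ℂ) (-Y)
        rw [norm_one, norm_neg, sub_neg_eq_add] at this
        linarith only [this, hY2]
      have hlog : Complex.log (z' ^ 2 + (ε' : ℂ) ^ 2) = Complex.log D + Complex.log (1 + Y) := by
        rw [hD']
        exact log_mul_of_re_pos hDre (re_one_add_pos hY2)
      have hl1 : ‖Complex.log (1 + Y) - 2 * z‖ ≤ (C + (8 + 2 * C ^ 2)) * T := by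
        have e1 : Complex.log (1 + Y) - 2 * z = y + (Complex.log (1 + Y) - Y) := by rw [hy]; ring
        rw [e1]
        refine (norm_add_le _ _).trans ?_
        have t1 := norm_log_one_add_sub_le hY2
        have t2 : ‖Y‖ ^ 2 ≤ (8 + 2 * C ^ 2) * T := by
          calc ‖Y‖ ^ 2 ≤ (2 * m + C * T) ^ 2 := by gcongr
            _ ≤ 8 * m ^ 2 + 2 * C ^ 2 * (T * T) := by nlinarith only [sq_nonneg (2 * m - C * T)]
            _ ≤ 8 * T + 2 * C ^ 2 * (T * 1) := by
              gcongr
              · rw [hm]; exact hMT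
              · linarith only [hT16]
            _ = _ := by ring
        linarith only [hyn, t1, t2]
      have hκn : ‖(κ : ℂ)‖ ≤ C * T := by
        rw [Complex.norm_real, Real.norm_eq_abs]
        exact s4.trans (by gcongr)
      have hl2 : ‖(1 - (κ : ℂ)) ^ 2 / (1 + Y) - 1 + 2 * z‖ ≤ 2 * (5 * C + 4) * T := by
        have e1 : (1 - (κ : ℂ)) ^ 2 / (1 + Y) - 1 + 2 * z =
            (κ * (κ - 2) - y + 4 * z ^ 2 + 2 * z * y) / (1 + Y) := by
          rw [eq_div_iff h1Y, add_mul, sub_mul, div_mul_cancel₀ _ h1Y, hy]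
          ring
        rw [e1, norm_div, div_le_iff₀ (by linarith only [h1Yn])]
        have t1 : ‖(κ : ℂ) * (κ - 2)‖ ≤ 3 * (C * T) := by
          rw [norm_mul]
          have : ‖(κ : ℂ) - 2‖ ≤ 3 := by
            refine (norm_sub_le _ _).trans ?_
            rw [Complex.norm_ofNat]
            linarith only [hκn, hCT]
          calc ‖(κ : ℂ)‖ * ‖(κ : ℂ) - 2‖ ≤ (C * T) * 3 := by gcongr
            _ = _ := mul_comm _ _
        have t2 : ‖4 * z ^ 2‖ ≤ 4 * T := by
          rw [norm_mul, norm_pow, Complex.norm_ofNat]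
          have : ‖z‖ ^ 2 ≤ m ^ 2 := by gcongr
          linarith only [this, hm, hMT]
        have t3 : ‖2 * z * y‖ ≤ C * T := by
          rw [norm_mul, norm_mul, Complex.norm_ofNat]
          calc 2 * ‖z‖ * ‖y‖ ≤ 2 * (1 / 8) * (C * T) := by
                gcongr
                exact hzm.trans hm16
            _ ≤ C * T := by linarith only [(norm_nonneg y).trans hyn]
        have t4 : ‖(κ : ℂ) * (κ - 2) - y + 4 * z ^ 2 + 2 * z * y‖ ≤ (5 * C + 4) * T := by
          refine (norm_add_le _ _).trans ((add_le_add_left ((norm_add_le _ _).trans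
            (add_le_add_left (norm_sub_le _ _) _)) _).trans ?_)
          linarith only [t1, t2, t3, hyn]
        have t5 : 0 ≤ (5 * C + 4) * T := by positivity
        nlinarith only [t4, t5, h1Yn]
      have e3 : (ε' : ℂ) ^ 2 / (z' ^ 2 + (ε' : ℂ) ^ 2) = w * ((1 - (κ : ℂ)) ^ 2 / (1 + Y)) := by
        rw [hD', hε'c, hw]
        field_simp
      -- The cancellation: the two terms of L are absorbed into the increments of log D and of w, so
      -- each bracket is of second order.
      have e4 : gatePhase b c v' z' ε' - gatePhase b c v z ε = (v' - v - L) +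
          b / 2 * (Complex.log (1 + Y) - 2 * z) + c / 2 * (w * ((1 - (κ : ℂ)) ^ 2 / (1 + Y) - 1 + 2 * z)) := by
        rw [gatePhase, gatePhase, hlog, e3, ← hD, ← hw, hL]
        ring
      rw [e4]
      refine (norm_add_le _ _).trans ((add_le_add_left (norm_add_le _ _) _).trans ?_)
      rw [norm_mul, norm_mul, norm_mul, norm_div, norm_div, Complex.norm_ofNat]
      have u1 : ‖b‖ / 2 * ‖Complex.log (1 + Y) - 2 * z‖ ≤ C₂ * T := by
        calc _ ≤ ‖b‖ / 2 * ((C + (8 + 2 * C ^ 2)) * T) := by gcongr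
          _ = C₂ * T := by rw [hC₂]; ring
      have u2 : ‖c‖ / 2 * (‖w‖ * ‖(1 - (κ : ℂ)) ^ 2 / (1 + Y) - 1 + 2 * z‖) ≤ C₃ * T := by
        calc _ ≤ ‖c‖ / 2 * (4 * (2 * (5 * C + 4) * T)) := by gcongr
          _ = C₃ * T := by rw [hC₃]; ring
      linarith only [hv, u1, u2]

/-! ### Size of the orbit inside the gate -/

lemma norm_cos_sub_one_le {w : ℂ} (hw : ‖w‖ ≤ 1) : ‖Complex.cos w - 1‖ ≤ 6 / 10 * ‖w‖ ^ 2 := by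
  have h := Complex.cos_bound hw
  have e : Complex.cos w - 1 = (Complex.cos w - (1 - w ^ 2 / 2)) - w ^ 2 / 2 := by ring
  rw [e]
  refine (norm_sub_le _ _).trans ?_
  rw [norm_div, norm_pow, Complex.norm_ofNat]
  have : ‖w‖ ^ 4 ≤ ‖w‖ ^ 2 := pow_le_pow_of_le_one (norm_nonneg _) hw (by norm_num)
  have : 0 ≤ ‖w‖ ^ 2 := by positivity
  linarith

lemma norm_sin_sub_self_le {w : ℂ} (hw : ‖w‖ ≤ 1) : ‖Complex.sin w - w‖ ≤ ‖w‖ ^ 3 / 5 := by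
  have h := Complex.sin_bound hw
  have e : Complex.sin w - w = (Complex.sin w - (w - w ^ 3 / 6)) - w ^ 3 / 6 := by ring
  rw [e]
  refine (norm_sub_le _ _).trans ?_
  rw [norm_div, norm_pow, Complex.norm_ofNat]
  have : ‖w‖ ^ 5 ≤ ‖w‖ ^ 3 := pow_le_pow_of_le_one (norm_nonneg _) hw (by norm_num)
  have : 0 ≤ ‖w‖ ^ 3 := by positivity
  linarith

/-- For A = x + w, the sum is cos A cos Ā + sin A sin Ā = cos(A - Ā). The real part x drops out and
‖A - Ā‖ ≤ 2‖w‖. -/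
lemma normSq_cos_add_normSq_sin_le {x : ℝ} {w : ℂ} (hw : ‖w‖ ≤ 16 / 100) :
    ‖Complex.cos (x + w)‖ ^ 2 + ‖Complex.sin (x + w)‖ ^ 2 ≤ 107 / 100 := by
  set u := (starRingEnd ℂ) w with hu
  have h1 : Complex.cos ((x + w) - (x + u)) = ((‖Complex.cos (x + w)‖ ^ 2 + ‖Complex.sin (x + w)‖ ^ 2 : ℝ) : ℂ) := by
    have e : (x : ℂ) + u = (starRingEnd ℂ) (x + w) := by simp [hu]
    rw [e, Complex.cos_sub, Complex.cos_conj, Complex.sin_conj, Complex.mul_conj, Complex.mul_conj,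
      Complex.normSq_eq_norm_sq, Complex.normSq_eq_norm_sq]
    push_cast
    ring
  have hun : ‖u‖ = ‖w‖ := by rw [hu, RCLike.norm_conj]
  have h2 : ‖(x + w) - (x + u)‖ ≤ 32 / 100 := by
    have : (x + w) - (x + u) = w - u := by ring
    rw [this]
    refine (norm_sub_le _ _).trans ?_
    linarith
  have h3 := norm_cos_sub_one_le (w := (x + w) - (x + u)) (by linarith)
  have h4 : ‖Complex.cos ((x + w) - (x + u))‖ ≤ 107 / 100 := by
    have e : Complex.cos ((x + w) - (x + u)) = (Complex.cos ((x + w) - (x + u)) - 1) + 1 := by ring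
    rw [e]
    refine (norm_add_le _ _).trans ?_
    rw [norm_one]
    nlinarith [norm_nonneg ((x + w) - (x + u) : ℂ)]
  rw [h1, Complex.norm_real, Real.norm_eq_abs] at h4
  exact (le_abs_self _).trans h4

/-- Jordan's inequality on the half of (0, π) containing x, with 158/100 as an upper bound for π/2.
-/
lemma sin_bounds_of_min {x y : ℝ} (hy : 0 < y) (hx : y = min x (Real.pi - x)) :
    100 / 158 * y ≤ Real.sin x ∧ Real.sin x ≤ y ∧ y ≤ 158 / 100 := by
  have hpi := Real.pi_lt_d2
  have hpi0 := Real.pi_pos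
  have key : ∀ t : ℝ, 0 < t → t ≤ Real.pi / 2 → 100 / 158 * t ≤ Real.sin t ∧ Real.sin t ≤ t := by
    intro t ht ht2
    refine ⟨le_trans ?_ (Real.mul_le_sin ht.le ht2), Real.sin_le ht.le⟩
    refine mul_le_mul_of_nonneg_right ?_ ht.le
    rw [div_le_div_iff₀ (by norm_num) hpi0]
    linarith
  rcases le_total x (Real.pi - x) with h | h
  · rw [min_eq_left h] at hx
    subst hx
    obtain ⟨a, b⟩ := key y hy (by linarith)
    exact ⟨a, b, by linarith⟩
  · rw [min_eq_right h] at hx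
    have hh := key y hy (by linarith)
    rw [hx, Real.sin_pi_sub] at hh
    rw [hx]
    exact ⟨hh.1, hh.2, by linarith⟩

/-- Size estimates at a point `z = -ε cot χ` with `χ` close to the real segment `(0, π)`. -/
lemma cot_bounds {x y ε : ℝ} {w z : ℂ} (hy : 0 < y) (hx : y = min x (Real.pi - x)) (hε : 0 < ε)
    (hw : ‖w‖ ≤ y / 10) (hz : z * Complex.sin (x + w) = -ε * Complex.cos (x + w)) :
    ‖z‖ ^ 2 + ε ^ 2 ≤ 4 * (z ^ 2 + (ε : ℂ) ^ 2).re ∧ ‖z‖ ^ 2 + ε ^ 2 ≤ 6 * (ε / y) ^ 2 ∧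
    (ε / y) ^ 2 ≤ 3 / 2 * ‖z ^ 2 + (ε : ℂ) ^ 2‖ := by
  obtain ⟨s1, s2, hy2⟩ := sin_bounds_of_min hy hx
  have hw16 : ‖w‖ ≤ 16 / 100 := by linarith
  have hK := normSq_cos_add_normSq_sin_le (x := x) hw16
  set s := Real.sin x with hs
  have hs0 : 0 < s := by linarith
  set S := Complex.sin (x + w) with hS
  -- As w is at most a tenth of the distance from x to {0, π}, sin(x + w) stays in a narrow sector
  -- about the positive axis. Hence the real part of its square is bounded below.
  have hSs : ‖S - s‖ ≤ s / 5 := by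
    have e : S - s = s * (Complex.cos w - 1) + Real.cos x * Complex.sin w := by
      rw [hS, Complex.sin_add, hs, Complex.ofReal_sin, Complex.ofReal_cos]
      ring
    rw [e]
    refine (norm_add_le _ _).trans ?_
    rw [norm_mul, norm_mul, Complex.norm_real, Complex.norm_real, Real.norm_eq_abs, Real.norm_eq_abs,
      abs_of_pos hs0]
    have h1 := norm_cos_sub_one_le (w := w) (by linarith)
    have h2 : ‖Complex.sin w‖ ≤ 101 / 100 * ‖w‖ := by
      have h3 := norm_sin_sub_self_le (w := w) (by linarith)
      have e : Complex.sin w = (Complex.sin w - w) + w := by ring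
      rw [e]
      refine (norm_add_le _ _).trans ?_
      have : ‖w‖ ^ 3 / 5 ≤ 1 / 100 * ‖w‖ := by nlinarith [norm_nonneg w, sq_nonneg ‖w‖]
      linarith
    have h3 := Real.abs_cos_le_one x
    have h4 : s * ‖Complex.cos w - 1‖ ≤ s * (2 / 100) := by
      gcongr
      nlinarith [norm_nonneg w]
    have h5 : |Real.cos x| * ‖Complex.sin w‖ ≤ 1 * (101 / 100 * (y / 10)) := by
      gcongr
      exact h2.trans (by gcongr)
    nlinarith
  have hre := abs_le.1 ((Complex.abs_re_le_norm _).trans hSs)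
  have him := abs_le.1 ((Complex.abs_im_le_norm _).trans hSs)
  simp only [Complex.sub_re, Complex.sub_im, Complex.ofReal_re, Complex.ofReal_im, sub_zero] at hre him
  have hSn : ‖S‖ ^ 2 = S.re ^ 2 + S.im ^ 2 := by
    rw [← Complex.normSq_eq_norm_sq, Complex.normSq_apply]; ring
  have hS0 : S ≠ 0 := by
    intro h
    rw [h] at hre
    simp at hre
    linarith
  have hSp : 0 < ‖S‖ := norm_pos_iff.2 hS0
  have hSup : ‖S‖ ≤ 6 / 5 * s := by
    have e : S = (S - s) + s := by ring
    rw [e]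
    refine (norm_add_le _ _).trans ?_
    rw [Complex.norm_real, Real.norm_eq_abs, abs_of_pos hs0]
    linarith
  have hSlow : 4 / 5 * s ≤ ‖S‖ := by
    have := (le_abs_self _).trans (Complex.abs_re_le_norm S)
    linarith
  -- The identity 1 + cot² = 1/sin² without division; it reduces bounds on D to bounds on the sine.
  have hD : (z ^ 2 + (ε : ℂ) ^ 2) * S ^ 2 = (ε : ℂ) ^ 2 := by
    have := Complex.sin_sq_add_cos_sq (x + w)
    rw [← hS] at this
    linear_combination (z * S - ε * Complex.cos (x + w)) * hz + (ε : ℂ) ^ 2 * this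
  have hM : (‖z‖ ^ 2 + ε ^ 2) * ‖S‖ ^ 2 ≤ 107 / 100 * ε ^ 2 := by
    have h1 : ‖z‖ * ‖S‖ = ε * ‖Complex.cos (x + w)‖ := by
      rw [← norm_mul, hz, norm_mul, norm_neg, Complex.norm_real, Real.norm_eq_abs, abs_of_pos hε]
    have h2 : (‖z‖ ^ 2 + ε ^ 2) * ‖S‖ ^ 2 = (‖z‖ * ‖S‖) ^ 2 + ε ^ 2 * ‖S‖ ^ 2 := by ring
    rw [h2, h1]
    have := mul_le_mul_of_nonneg_left hK (sq_nonneg ε)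
    linarith
  have hDn : ‖z ^ 2 + (ε : ℂ) ^ 2‖ * ‖S‖ ^ 2 = ε ^ 2 := by
    rw [← norm_pow, ← norm_mul, hD, norm_pow, Complex.norm_real, Real.norm_eq_abs, abs_of_pos hε]
  have hDre : (z ^ 2 + (ε : ℂ) ^ 2).re * (‖S‖ ^ 2) ^ 2 = ε ^ 2 * (S.re ^ 2 - S.im ^ 2) := by
    have h1 : (z ^ 2 + (ε : ℂ) ^ 2) * ((‖S‖ ^ 2) ^ 2 : ℝ) = ((ε ^ 2 : ℝ) : ℂ) * ((starRingEnd ℂ) S) ^ 2 := by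
      have h2 : S * (starRingEnd ℂ) S = ((‖S‖ ^ 2 : ℝ) : ℂ) := by
        rw [Complex.mul_conj, Complex.normSq_eq_norm_sq]
      push_cast at h2 ⊢
      rw [← h2]
      linear_combination ((starRingEnd ℂ) S) ^ 2 * hD
    have h3 := congrArg Complex.re h1
    rw [Complex.re_mul_ofReal, Complex.re_ofReal_mul] at h3
    rw [h3]
    simp only [sq, Complex.mul_re, Complex.conj_re, Complex.conj_im]
    ring
  refine ⟨?_, ?_, ?_⟩
  · have hS2 : 0 < (‖S‖ ^ 2) ^ 2 := by positivity
    refine le_of_mul_le_mul_right ?_ hS2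
    rw [mul_assoc, hDre]
    have h1 : ‖S‖ ^ 2 ≤ 36 / 25 * s ^ 2 := by nlinarith
    have h2 : 6 / 10 * s ^ 2 ≤ S.re ^ 2 - S.im ^ 2 := by
      have : S.im ^ 2 ≤ (s / 5) ^ 2 := sq_le_sq' (by linarith) him.2
      have : (4 / 5 * s) ^ 2 ≤ S.re ^ 2 := by
        have : 0 ≤ 4 / 5 * s := by positivity
        gcongr
        linarith
      nlinarith
    calc (‖z‖ ^ 2 + ε ^ 2) * (‖S‖ ^ 2) ^ 2 = ((‖z‖ ^ 2 + ε ^ 2) * ‖S‖ ^ 2) * ‖S‖ ^ 2 := by ring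
      _ ≤ (107 / 100 * ε ^ 2) * (36 / 25 * s ^ 2) := by gcongr
      _ ≤ 4 * (ε ^ 2 * (6 / 10 * s ^ 2)) := by
        have : 0 ≤ ε ^ 2 * s ^ 2 := by positivity
        nlinarith
      _ ≤ _ := by gcongr
  · rw [div_pow, mul_div_assoc', le_div_iff₀ (by positivity)]
    have h1 : 1 / 4 * y ^ 2 ≤ ‖S‖ ^ 2 := by
      have : 1 / 2 * y ≤ ‖S‖ := by linarith
      calc 1 / 4 * y ^ 2 = (1 / 2 * y) ^ 2 := by ring
        _ ≤ _ := by gcongr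
    have h2 : (‖z‖ ^ 2 + ε ^ 2) * (1 / 4 * y ^ 2) ≤ 107 / 100 * ε ^ 2 :=
      le_trans (mul_le_mul_of_nonneg_left h1 (by positivity)) hM
    have e : (‖z‖ ^ 2 + ε ^ 2) * (1 / 4 * y ^ 2) = 1 / 4 * ((‖z‖ ^ 2 + ε ^ 2) * y ^ 2) := by ring
    have := sq_nonneg ε
    linarith only [h2, e, this]
  · rw [div_pow, div_le_iff₀ (by positivity), ← hDn]
    have : ‖S‖ ^ 2 ≤ 3 / 2 * y ^ 2 := by
      have : ‖S‖ ≤ 6 / 5 * y := by linarith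
      nlinarith
    have := mul_le_mul_of_nonneg_left this (norm_nonneg (z ^ 2 + (ε : ℂ) ^ 2))
    linarith

/-- Rationalizing gives √(n²+m) - n = m/(√(n²+m) + n), and its complement to 1 is
(2n+1-m)/(n+1+√(n²+m)). Both denominators lie between 2n and 2n+2. -/
lemma gate_angle_bounds {n m : ℝ} (hn : 5 ≤ n) (hm : 1 ≤ m) (hm2 : m ≤ 2 * n) :
    Real.pi * min m (2 * n + 1 - m) / (2 * (n + 1)) ≤
      min (Real.pi * (√(n ^ 2 + m) - n)) (Real.pi - Real.pi * (√(n ^ 2 + m) - n)) ∧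
    min (Real.pi * (√(n ^ 2 + m) - n)) (Real.pi - Real.pi * (√(n ^ 2 + m) - n)) ≤
      Real.pi * min m (2 * n + 1 - m) / (2 * n) ∧
    Real.pi / (2 * (n + 1)) ≤ gateSize (n ^ 2 + m) ∧ gateSize (n ^ 2 + m) ≤ Real.pi / (2 * n) := by
  have hpi := Real.pi_pos
  set s := √(n ^ 2 + m) with hs
  have hs2 : s ^ 2 = n ^ 2 + m := Real.sq_sqrt (by positivity)
  have a1 : n ≤ s := Real.le_sqrt_of_sq_le (by linarith)
  have a2 : s ≤ n + 1 := by
    rw [hs, Real.sqrt_le_left (by linarith)]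
    nlinarith
  have b1 : s - n = m / (s + n) := by
    rw [eq_div_iff (by linarith)]; nlinarith
  have b2 : 1 - (s - n) = (2 * n + 1 - m) / (n + 1 + s) := by
    rw [eq_div_iff (by linarith)]; nlinarith
  have e2 : Real.pi - Real.pi * (s - n) = Real.pi * (1 - (s - n)) := by ring
  have hmin0 : 0 ≤ min m (2 * n + 1 - m) := le_min (by linarith) (by linarith)
  refine ⟨le_min ?_ ?_, ?_, ?_, ?_⟩
  · rw [b1, mul_div_assoc]
    gcongr
    · exact min_le_left _ _
    · linarith
  · rw [e2, b2, mul_div_assoc]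
    gcongr
    · linarith
    · exact min_le_right _ _
    · linarith
  · rcases le_total m (2 * n + 1 - m) with h | h
    · rw [min_eq_left h]
      refine (min_le_left _ _).trans ?_
      rw [b1, mul_div_assoc]
      gcongr
      linarith
    · rw [min_eq_right h]
      refine (min_le_right _ _).trans ?_
      rw [e2, b2, mul_div_assoc]
      gcongr
      · linarith
      · linarith
  · rw [gateSize, ← hs]
    gcongr
  · rw [gateSize, ← hs]
    gcongr

/-- With μ the time distance to the nearer end of the passage, the angle is about εμ away from {0,
π}. Hence D = z² + ε² has size about μ⁻², and the squared step errors become summable. -/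
lemma gate_bounds {n m : ℝ} (hn : 5 ≤ n) (hm : 1 ≤ m) (hm2 : m ≤ 2 * n) {z v : ℂ}
    (hv : ‖v‖ ≤ min m (2 * n + 1 - m) / 12)
    (hz : z * Complex.sin ((Real.pi * (√(n ^ 2 + m) - n) : ℝ) + (Real.pi / (2 * n) : ℝ) * v) =
        -gateSize (n ^ 2 + m) * Complex.cos ((Real.pi * (√(n ^ 2 + m) - n) : ℝ) + (Real.pi / (2 * n) : ℝ) * v)) :
    ‖z‖ ^ 2 + gateSize (n ^ 2 + m) ^ 2 ≤ 4 * (z ^ 2 + (gateSize (n ^ 2 + m) : ℂ) ^ 2).re ∧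
    ‖z‖ ^ 2 + gateSize (n ^ 2 + m) ^ 2 ≤ 10 / min m (2 * n + 1 - m) ^ 2 ∧
    1 / (4 * min m (2 * n + 1 - m) ^ 2) ≤ ‖z ^ 2 + (gateSize (n ^ 2 + m) : ℂ) ^ 2‖ ∧
    1 / n ^ 2 ≤ gateSize (n ^ 2 + m) ^ 2 := by
  have hpi := Real.pi_gt_three
  obtain ⟨a1, a2, a3, a4⟩ := gate_angle_bounds hn hm hm2
  set ε := gateSize (n ^ 2 + m)
  set μ := min m (2 * n + 1 - m) with hμ
  have hμ1 : 1 ≤ μ := le_min hm (by linarith)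
  set x := Real.pi * (√(n ^ 2 + m) - n)
  set y := min x (Real.pi - x) with hy
  have hy0 : 0 < y := lt_of_lt_of_le (by positivity) a1
  have hε0 : 0 < ε := lt_of_lt_of_le (by positivity) a3
  obtain ⟨c1, c2, c3⟩ := cot_bounds hy0 hy hε0 (w := (Real.pi / (2 * n) : ℝ) * v) (by
    rw [norm_mul, Complex.norm_real, Real.norm_eq_abs, abs_of_pos (by positivity)]
    calc Real.pi / (2 * n) * ‖v‖ ≤ Real.pi / (2 * n) * (μ / 12) := by gcongr
      _ ≤ (Real.pi * μ / (2 * (n + 1))) / 10 := by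
        rw [div_mul_div_comm, div_div, div_le_div_iff₀ (by positivity) (by positivity)]
        have : 0 < Real.pi * μ := by positivity
        nlinarith
      _ ≤ y / 10 := by gcongr) hz
  have r1 : ε / y ≤ 12 / 10 / μ := by
    rw [div_le_div_iff₀ hy0 (by positivity)]
    calc ε * μ ≤ Real.pi / (2 * n) * μ := by gcongr
      _ ≤ 12 / 10 * (Real.pi * μ / (2 * (n + 1))) := by
        rw [div_mul_eq_mul_div, mul_div_assoc', div_le_div_iff₀ (by positivity) (by positivity)]
        have : 0 < Real.pi * μ := by positivity
        nlinarith
      _ ≤ _ := by gcongr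
  have r2 : 8 / 10 / μ ≤ ε / y := by
    rw [div_le_div_iff₀ (by positivity) hy0]
    calc 8 / 10 * y ≤ 8 / 10 * (Real.pi * μ / (2 * n)) := by gcongr
      _ ≤ Real.pi / (2 * (n + 1)) * μ := by
        have e1 : 8 / 10 * (Real.pi * μ / (2 * n)) = Real.pi * μ * (4 / (10 * n)) := by ring
        have e2 : Real.pi / (2 * (n + 1)) * μ = Real.pi * μ * (1 / (2 * (n + 1))) := by ring
        rw [e1, e2]
        refine mul_le_mul_of_nonneg_left ?_ (by positivity)
        rw [div_le_div_iff₀ (by positivity) (by positivity)]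
        linarith
      _ ≤ ε * μ := by gcongr
  refine ⟨c1, c2.trans ?_, ?_, ?_⟩
  · calc 6 * (ε / y) ^ 2 ≤ 6 * (12 / 10 / μ) ^ 2 := by gcongr
      _ = 864 / 100 / μ ^ 2 := by ring
      _ ≤ 10 / μ ^ 2 := by gcongr; norm_num
  · have : (8 / 10 / μ) ^ 2 ≤ (ε / y) ^ 2 := by gcongr
    have e1 : (8 / 10 / μ) ^ 2 = 64 / 100 / μ ^ 2 := by ring
    have e2 : 1 / (4 * μ ^ 2) = 25 / 100 / μ ^ 2 := by ring
    have e3 : (64 / 100 / μ ^ 2 : ℝ) = 3 / 2 * (25 / 100 / μ ^ 2) + (265 / 1000) / μ ^ 2 := by ring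
    have : 0 < (265 / 1000) / μ ^ 2 := by positivity
    rw [e2]
    linarith
  · have : 1 / n ≤ ε := by
      refine le_trans ?_ a3
      rw [div_le_div_iff₀ (by positivity) (by positivity)]
      nlinarith
    calc 1 / n ^ 2 = (1 / n) ^ 2 := by ring
      _ ≤ _ := by gcongr

/-! ### The whole passage through the gate -/

/-- `z = -ε cot χ` where `χ` is the expected angle at time `m`, shifted by `v` time units. -/
def GateRel (n m : ℝ) (v z : ℂ) : Prop :=
  z * Complex.sin ((Real.pi * (√(n ^ 2 + m) - n) : ℝ) + (Real.pi / (2 * n) : ℝ) * v) =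
    -gateSize (n ^ 2 + m) * Complex.cos ((Real.pi * (√(n ^ 2 + m) - n) : ℝ) + (Real.pi / (2 * n) : ℝ) * v)

/-- A bootstrap: `gate_bounds` gives log D = O(log μ), and ε²/D is bounded. A bounded phase
therefore makes v = O(log μ), which improves μ/12 to μ/20 once μ is large. -/
lemma norm_le_of_gatePhase (b c : ℂ) (ρ : ℝ) : ∃ x₀ : ℝ, 1 ≤ x₀ ∧ ∀ (n m : ℝ) (v z : ℂ), 5 ≤ n →
    x₀ ≤ min m (2 * n + 1 - m) → GateRel n m v z → ‖v‖ ≤ min m (2 * n + 1 - m) / 12 →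
    ‖gatePhase b c v z (gateSize (n ^ 2 + m))‖ ≤ ρ → ‖v‖ ≤ min m (2 * n + 1 - m) / 20 := by
  obtain ⟨x₀, hx₀, hx⟩ := exists_add_mul_log_le (ρ + ‖b‖ / 2 * 14 + 2 * ‖c‖) ‖b‖
    (show (0 : ℝ) < 1 / 20 by norm_num)
  refine ⟨x₀, hx₀, fun n m v z hn hμ hrel hv hq => ?_⟩
  have hm1 : 1 ≤ m := hx₀.trans (hμ.trans (min_le_left _ _))
  have hm2 : m ≤ 2 * n := by linarith [hx₀.trans (hμ.trans (min_le_right _ _))]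
  obtain ⟨g1, g2, g3, g4⟩ := gate_bounds hn hm1 hm2 hv hrel
  set ε := gateSize (n ^ 2 + m)
  set μ := min m (2 * n + 1 - m)
  set D : ℂ := z ^ 2 + (ε : ℂ) ^ 2 with hD
  have hμ1 : 1 ≤ μ := hx₀.trans hμ
  have hDp : 0 < ‖D‖ := lt_of_lt_of_le (by positivity) g3
  have hDre : ‖z‖ ^ 2 + ε ^ 2 ≤ 4 * ‖D‖ := by linarith [(le_abs_self _).trans (Complex.abs_re_le_norm D)]
  have hDup : ‖D‖ ≤ 10 / μ ^ 2 := by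
    refine le_trans ?_ g2
    refine (norm_add_le _ _).trans ?_
    simp
  have hlogμ : 0 ≤ Real.log μ := Real.log_nonneg hμ1
  have hlog10 : Real.log 10 ≤ 10 := by
    have := Real.log_le_sub_one_of_pos (show (0 : ℝ) < 10 by norm_num)
    linarith
  have hlog : ‖Complex.log D‖ ≤ 2 * Real.log μ + 14 := by
    refine (norm_log_le _).trans ?_
    have h1 : Real.log ‖D‖ ≤ Real.log 10 - 2 * Real.log μ := by
      have := Real.log_le_log hDp hDup
      rw [Real.log_div (by norm_num) (by positivity), Real.log_pow] at this
      exact_mod_cast this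
    have h2 : -(Real.log 4 + 2 * Real.log μ) ≤ Real.log ‖D‖ := by
      have := Real.log_le_log (by positivity) g3
      rw [one_div, Real.log_inv, Real.log_mul (by norm_num) (by positivity), Real.log_pow] at this
      exact_mod_cast this
    have h3 : Real.log 4 ≤ Real.log 10 := Real.log_le_log (by norm_num) (by norm_num)
    have : |Real.log ‖D‖| ≤ 2 * Real.log μ + 10 := abs_le.2 ⟨by linarith, by linarith⟩
    linarith
  have hw : ‖(ε : ℂ) ^ 2 / D‖ ≤ 4 := by
    rw [norm_div, norm_pow, Complex.norm_real, Real.norm_eq_abs, sq_abs, div_le_iff₀ hDp]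
    linarith [sq_nonneg ‖z‖]
  have e : v = gatePhase b c v z ε - b / 2 * Complex.log D - c / 2 * ((ε : ℂ) ^ 2 / D) := by
    rw [gatePhase, ← hD]; ring
  have h5 : ‖v‖ ≤ ρ + ‖b‖ / 2 * (2 * Real.log μ + 14) + ‖c‖ / 2 * 4 := by
    rw [e]
    refine (norm_sub_le _ _).trans (add_le_add ((norm_sub_le _ _).trans (add_le_add hq ?_)) ?_)
    · rw [norm_mul, norm_div, Complex.norm_ofNat]
      gcongr
    · rw [norm_mul, norm_div, Complex.norm_ofNat]
      gcongr
  have h6 := hx μ hμ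
  linarith

lemma one_div_sq_le {x : ℝ} (hx : 1 < x) : 1 / x ^ 2 ≤ 1 / (x - 1) - 1 / x := by
  have := div_add_div_sq_le zero_le_one hx
  linarith

set_option maxHeartbeats 1000000 in
/-- Passing through the gate: the phase is conserved up to a small error. -/
lemma exists_gate_passage {f : ℂ[X]} (h0 : f.coeff 0 = 0) (h1 : f.coeff 1 = 1)
    (h2 : f.coeff 2 = 1) :
    ∃ C σ₁ : ℝ, 0 ≤ C ∧ 0 < σ₁ ∧ ∀ ρ : ℝ, ∃ k₁ : ℕ, ∀ k n : ℕ, k₁ ≤ k → k + 5 ≤ n → ∀ σ : ℝ, 0 ≤ σ → σ ≤ σ₁ →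
      ∀ (z d : ℕ → ℂ) (v₀ : ℂ),
      (∀ m, k ≤ m → m < 2 * n + 1 - k → ‖d m - (gateSize ((n : ℝ) ^ 2 + m) : ℂ) ^ 2‖ ≤ σ / n ^ 3) →
      (∀ m, k ≤ m → m < 2 * n + 1 - k → z (m + 1) = f.eval (z m) + d m) →
      GateRel n k v₀ (z k) → ‖v₀‖ ≤ k / 20 →
      ‖gatePhase (1 - f.coeff 3) ((2 / Real.pi ^ 2 : ℝ) - f.coeff 3) v₀ (z k)
        (gateSize ((n : ℝ) ^ 2 + k))‖ ≤ ρ →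
      ∃ v : ℂ, GateRel n (2 * n + 1 - k) v (z (2 * n + 1 - k)) ∧ ‖v‖ ≤ k / 20 ∧
        ‖gatePhase (1 - f.coeff 3) ((2 / Real.pi ^ 2 : ℝ) - f.coeff 3) v (z (2 * n + 1 - k))
          (gateSize ((n : ℝ) ^ 2 + (2 * n + 1 - k)))
        - gatePhase (1 - f.coeff 3) ((2 / Real.pi ^ 2 : ℝ) - f.coeff 3) v₀ (z k)
          (gateSize ((n : ℝ) ^ 2 + k))‖ ≤ C * (1 / k + σ) := by
  obtain ⟨r, C, hr, hC, hstep⟩ := exists_gate_step h0 h1 h2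
  set b := 1 - f.coeff 3
  set c : ℂ := ((2 / Real.pi ^ 2 : ℝ) : ℂ) - f.coeff 3
  refine ⟨30 * C, min 1 (r / 2), by positivity, by positivity, fun ρ => ?_⟩
  obtain ⟨x₀, hx₀, hx⟩ := norm_le_of_gatePhase b c (ρ + 30 * C * 2)
  -- The 40 ensures 1 + (μ'+1)/20 ≤ μ'/12, so the delay remains admissible after one step; 20/r
  -- ensures 10/μ² ≤ r/2.
  obtain ⟨k₁, hk₁⟩ := exists_nat_ge (x₀ + 40 + 20 / r)
  refine ⟨k₁, fun k n hk hkn σ hσ0 hσ z d v₀ hd hz hrel hv₀ hq => ?_⟩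
  have hr20 : 0 < 20 / r := by positivity
  have hkR : (k₁ : ℝ) ≤ k := by exact_mod_cast hk
  have hnR : (k : ℝ) + 5 ≤ n := by exact_mod_cast hkn
  have hk40 : (40 : ℝ) ≤ k := by linarith
  have hkx : x₀ ≤ k := by linarith
  have hkr : 20 / r ≤ k := by linarith
  have hσ1 : σ ≤ 1 := hσ.trans (min_le_left _ _)
  have hσr : σ ≤ r / 2 := hσ.trans (min_le_right _ _)
  set q₀ := gatePhase b c v₀ (z k) (gateSize ((n : ℝ) ^ 2 + k)) with hq₀
  -- The accumulated error. Its increments dominate 10/m² + 10/(2n+1-m)² + σ/n: the squares come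
  -- from the size of z near the two ends, and σ/n from dividing the forcing error σ/n³ by ‖z‖² + ε²
  -- ≥ 1/n².
  let β : ℝ → ℝ := fun m => 10 * (1 / ((k : ℝ) - 1) - 1 / (m - 1) + 1 / (2 * n + 1 - m)) + σ * m / n
  have hβ : ∀ m : ℝ, k ≤ m → m ≤ 2 * n + 1 - k → β m ≤ 30 * (1 / k + σ) := by
    intro m hm1 hm2
    have e1 : 1 / ((k : ℝ) - 1) ≤ 2 * (1 / k) := by
      rw [mul_one_div, div_le_div_iff₀ (by linarith) (by linarith)]
      linarith
    have e2 : 0 ≤ 1 / (m - 1) := by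
      have : 0 ≤ m - 1 := by linarith
      positivity
    have e3 : 1 / (2 * n + 1 - m) ≤ 1 / k := one_div_le_one_div_of_le (by linarith) (by linarith)
    have e4 : σ * m / n ≤ 3 * σ := by
      rw [div_le_iff₀ (by linarith)]
      nlinarith
    simp only [β]
    linarith
  have main : ∀ i : ℕ, k + i ≤ 2 * n + 1 - k → ∃ v : ℂ, GateRel n (k + i : ℕ) v (z (k + i)) ∧
      ‖v‖ ≤ min ((k + i : ℕ) : ℝ) (2 * n + 1 - (k + i : ℕ)) / 20 ∧
      ‖gatePhase b c v (z (k + i)) (gateSize ((n : ℝ) ^ 2 + (k + i : ℕ))) - q₀‖ ≤ C * β (k + i : ℕ) := by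
    intro i
    induction i with
    | zero =>
      intro _
      refine ⟨v₀, hrel, ?_, ?_⟩
      · simp only [add_zero]
        rwa [min_eq_left (by linarith)]
      · simp only [add_zero, hq₀, sub_self, norm_zero]
        have e3 : 0 ≤ 1 / (2 * (n : ℝ) + 1 - k) := by
          have : 0 ≤ 2 * (n : ℝ) + 1 - k := by linarith
          positivity
        have : 0 ≤ σ * k / n := by positivity
        simp only [β, sub_self, zero_add]
        positivity
    | succ i ih =>
      intro hi
      obtain ⟨v, hv1, hv2, hv3⟩ := ih (by omega)
      set m := k + i with hm
      have hmR : (k : ℝ) ≤ m := by exact_mod_cast (Nat.le_add_right k i)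
      have hmR2 : (m : ℝ) + 1 ≤ 2 * n + 1 - k := by
        have : m + 1 + k ≤ 2 * n + 1 := by omega
        have : (m : ℝ) + 1 + k ≤ 2 * n + 1 := by exact_mod_cast this
        linarith
      set μ := min (m : ℝ) (2 * n + 1 - m) with hμ
      have hμk : (k : ℝ) ≤ μ := le_min hmR (by linarith)
      have hμ0 : 0 < μ := by linarith
      obtain ⟨g1, g2, g3, g4⟩ := gate_bounds (n := n) (m := m) (by linarith) (by linarith) (by linarith)
        (hv2.trans (by gcongr; norm_num)) hv1
      set N : ℝ := (n : ℝ) ^ 2 + m with hN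
      set M := ‖z m‖ ^ 2 + gateSize N ^ 2 with hM
      have hn0 : (0 : ℝ) < n := by linarith
      have hMn : 1 / (n : ℝ) ^ 2 ≤ M := by linarith [sq_nonneg ‖z m‖]
      have hM0 : 0 < M := lt_of_lt_of_le (by positivity) hMn
      have heM : σ / (n : ℝ) ^ 3 / M ≤ σ / n := by
        rw [div_le_iff₀ hM0]
        calc σ / (n : ℝ) ^ 3 = σ / n * (1 / (n : ℝ) ^ 2) := by field_simp
          _ ≤ _ := by gcongr
      have hT : M + σ / (n : ℝ) ^ 3 / M ≤ 10 / μ ^ 2 + σ / n := add_le_add g2 heM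
      have hTr : M + σ / (n : ℝ) ^ 3 / M ≤ r := by
        refine hT.trans ?_
        have t1 : 10 / μ ^ 2 ≤ r / 2 := by
          rw [div_le_div_iff₀ (by positivity) (by norm_num)]
          rw [div_le_iff₀ hr] at hkr
          have : (1 : ℝ) ≤ μ := by linarith
          nlinarith
        have t2 : σ / n ≤ σ := div_le_self hσ0 (by linarith)
        linarith
      obtain ⟨v', w1, w2, w3⟩ := hstep n N (σ / (n : ℝ) ^ 3) (z m) (d m) v (by linarith) (by linarith)
        (by nlinarith) (hd m (by omega) (by omega)) g1 hTr hv1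
      rw [← hz m (by omega) (by omega)] at w1 w3
      have hN1 : N + 1 = (n : ℝ) ^ 2 + (m + 1 : ℕ) := by rw [hN]; push_cast; ring
      rw [hN1] at w1 w3
      have hrel' : GateRel n (m + 1 : ℕ) v' (z (m + 1)) := w1
      set μ' := min ((m + 1 : ℕ) : ℝ) (2 * n + 1 - (m + 1 : ℕ)) with hμ'
      have hμμ' : μ ≤ μ' + 1 := by
        have e1 : μ ≤ m := min_le_left _ _
        have e2 : μ ≤ 2 * n + 1 - m := min_le_right _ _
        rw [← sub_le_iff_le_add]
        refine le_min ?_ ?_ <;> push_cast <;> linarith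
      have hμ'k : (k : ℝ) ≤ μ' := le_min (by push_cast; linarith) (by push_cast; linarith)
      have hβs : C * (M + σ / (n : ℝ) ^ 3 / M) + C * β m ≤ C * β (m + 1 : ℕ) := by
        rw [← mul_add]
        refine mul_le_mul_of_nonneg_left ?_ hC
        have t0 : 1 / μ ^ 2 ≤ 1 / (m : ℝ) ^ 2 + 1 / (2 * n + 1 - m : ℝ) ^ 2 := by
          have p1 : 0 ≤ 1 / (m : ℝ) ^ 2 := by positivity
          have p2 : 0 ≤ 1 / (2 * n + 1 - m : ℝ) ^ 2 := by positivity
          rcases min_choice (m : ℝ) (2 * n + 1 - m) with h | h <;> rw [hμ, h] <;> linarith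
        have t1 := one_div_sq_le (show 1 < (m : ℝ) by linarith)
        have t2 := one_div_sq_le (show 1 < (2 * n + 1 - m : ℝ) by linarith)
        have t3 : σ * (m + 1 : ℕ) / n = σ * m / n + σ / n := by push_cast; ring
        have t4 : 10 / μ ^ 2 = 10 * (1 / μ ^ 2) := by ring
        have t5 : ((m + 1 : ℕ) : ℝ) - 1 = m := by push_cast; ring
        have t6 : (2 * n + 1 - (m + 1 : ℕ) : ℝ) = 2 * n + 1 - m - 1 := by push_cast; ring
        simp only [β]
        rw [t3, t5, t6]
        linarith
      have hq' : ‖gatePhase b c v' (z (m + 1)) (gateSize ((n : ℝ) ^ 2 + (m + 1 : ℕ))) - q₀‖ ≤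
          C * β (m + 1 : ℕ) := by
        have e := norm_add_le (gatePhase b c v' (z (m + 1)) (gateSize ((n : ℝ) ^ 2 + (m + 1 : ℕ)))
          - gatePhase b c v (z m) (gateSize N)) (gatePhase b c v (z m) (gateSize N) - q₀)
        rw [sub_add_sub_cancel] at e
        linarith
      refine ⟨v', hrel', ?_, hq'⟩
      refine hx n (m + 1 : ℕ) v' (z (m + 1)) (by linarith) (hkx.trans hμ'k) hrel' ?_ ?_
      · have e : v' = (v' - v) + v := by ring
        rw [e]
        refine (norm_add_le _ _).trans ?_
        change _ ≤ μ' / 12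
        linarith
      · have e : gatePhase b c v' (z (m + 1)) (gateSize ((n : ℝ) ^ 2 + (m + 1 : ℕ))) =
          (gatePhase b c v' (z (m + 1)) (gateSize ((n : ℝ) ^ 2 + (m + 1 : ℕ))) - q₀) + q₀ := by ring
        rw [e]
        refine (norm_add_le _ _).trans ?_
        have e2 := hβ (m + 1 : ℕ) (by push_cast; linarith) (by push_cast; linarith)
        have e3 : 1 / (k : ℝ) ≤ 1 := by
          rw [div_le_one (by linarith)]
          linarith
        have e4 : C * β (m + 1 : ℕ) ≤ C * (30 * (1 + 1)) := by
          refine mul_le_mul_of_nonneg_left (e2.trans ?_) hC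
          linarith
        linarith
  obtain ⟨v, hv1, hv2, hv3⟩ := main (2 * n + 1 - k - k) (by omega)
  have hke : k + (2 * n + 1 - k - k) = 2 * n + 1 - k := by omega
  have hcast : ((2 * n + 1 - k : ℕ) : ℝ) = 2 * n + 1 - k := by
    rw [Nat.cast_sub (by omega)]
    push_cast
    ring
  rw [hke, hcast] at hv1 hv2 hv3
  refine ⟨v, hv1, hv2.trans ?_, hv3.trans ?_⟩
  · rw [min_eq_right (by linarith)]
    linarith
  · have := mul_le_mul_of_nonneg_left (hβ (2 * n + 1 - k) (by linarith) le_rfl) hC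
    linarith

/-! ### Matching with the Fatou coordinates at both ends of the gate -/

/-- At z = -1/Z one has z² + ε² = Z⁻²(1 + (εZ)²). When εZ is small, the logarithm becomes -log(Z²)
and the c-term disappears, which leaves the correction appearing in `fatouApprox`. -/
lemma norm_gatePhase_sub_le (b c v : ℂ) {Z : ℂ} {ε : ℝ} (hre : 0 < (Z ^ 2).re) (hs : ‖(ε : ℂ) * Z‖ ≤ 1 / 2) :
    ‖gatePhase b c v (-1 / Z) ε - (v - b / 2 * Complex.log (Z ^ 2))‖ ≤ (‖b‖ + ‖c‖) * ‖(ε : ℂ) * Z‖ ^ 2 := by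
  have hZ0 : Z ≠ 0 := by
    rintro rfl
    simp at hre
  set s : ℂ := (ε : ℂ) * Z with hsd
  have hs2 : ‖s ^ 2‖ ≤ 1 / 2 := by
    rw [norm_pow]
    nlinarith [norm_nonneg s]
  have hD : (-1 / Z) ^ 2 + (ε : ℂ) ^ 2 = (Z ^ 2)⁻¹ * (1 + s ^ 2) := by
    rw [hsd]
    field_simp
  have hinv : 0 < ((Z ^ 2)⁻¹).re := by
    rw [Complex.inv_re]
    have : 0 < Complex.normSq (Z ^ 2) := Complex.normSq_pos.2 (pow_ne_zero _ hZ0)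
    positivity
  have harg : (Z ^ 2).arg ≠ Real.pi := by
    have := (abs_lt.1 (Complex.abs_arg_lt_pi_div_two_iff.2 (Or.inl hre))).2
    have := Real.pi_pos
    intro h
    linarith
  have hlog : Complex.log ((-1 / Z) ^ 2 + (ε : ℂ) ^ 2) = -Complex.log (Z ^ 2) + Complex.log (1 + s ^ 2) := by
    rw [hD, log_mul_of_re_pos hinv (re_one_add_pos hs2), Complex.log_inv _ harg]
  have h1 : 1 + s ^ 2 ≠ 0 := by
    intro h
    have := re_one_add_pos hs2
    rw [h] at this
    simp at this
  have hq : (ε : ℂ) ^ 2 / ((-1 / Z) ^ 2 + (ε : ℂ) ^ 2) = s ^ 2 / (1 + s ^ 2) := by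
    rw [hD, hsd]
    field_simp
  have e : gatePhase b c v (-1 / Z) ε - (v - b / 2 * Complex.log (Z ^ 2)) =
      b / 2 * Complex.log (1 + s ^ 2) + c / 2 * (s ^ 2 / (1 + s ^ 2)) := by
    rw [gatePhase, hlog, hq]
    ring
  rw [e]
  refine (norm_add_le _ _).trans ?_
  rw [norm_mul, norm_mul, norm_div, norm_div, Complex.norm_ofNat]
  have h2 : ‖Complex.log (1 + s ^ 2)‖ ≤ 2 * ‖s‖ ^ 2 := by
    have h3 := norm_log_one_add_sub_le hs2
    have e2 : Complex.log (1 + s ^ 2) = (Complex.log (1 + s ^ 2) - s ^ 2) + s ^ 2 := by ring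
    rw [e2]
    refine (norm_add_le _ _).trans ?_
    rw [norm_pow] at hs2 h3 ⊢
    nlinarith [sq_nonneg ‖s‖]
  have h4 : ‖s ^ 2 / (1 + s ^ 2)‖ ≤ 2 * ‖s‖ ^ 2 := by
    have h5 : 1 / 2 ≤ ‖1 + s ^ 2‖ := by
      have := norm_sub_norm_le (1 : ℂ) (-s ^ 2)
      rw [norm_one, norm_neg, sub_neg_eq_add] at this
      linarith
    rw [norm_div, div_le_iff₀ (by linarith), norm_pow]
    nlinarith [sq_nonneg ‖s‖]
  calc _ ≤ ‖b‖ / 2 * (2 * ‖s‖ ^ 2) + ‖c‖ / 2 * (2 * ‖s‖ ^ 2) := by gcongr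
    _ = _ := by ring

lemma exists_small_step (K : ℝ) {η : ℝ} (hη : 0 < η) :
    ∃ n₁ : ℝ, 1 ≤ n₁ ∧ ∀ n : ℝ, n₁ ≤ n → K * (Real.pi / (2 * n)) ≤ η := by
  have hpi := Real.pi_pos
  refine ⟨max 1 (|K| * Real.pi / (2 * η)), le_max_left _ _, fun n hn => ?_⟩
  have h1 : 1 ≤ n := (le_max_left _ _).trans hn
  have h2 := (le_max_right _ _).trans hn
  rw [div_le_iff₀ (by positivity)] at h2
  rw [mul_div_assoc', div_le_iff₀ (by positivity)]
  have := mul_le_mul_of_nonneg_right (le_abs_self K) hpi.le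
  linarith

set_option maxHeartbeats 1000000 in
-- The angle w of -1/Z satisfies tan w = εZ, so w is about εZ, while the reference angle at time k
-- is about kε. The delay is therefore close to Z - k when k is fixed and n is large.
lemma gate_entry (b c : ℂ) {k η : ℝ} (hk : 1 ≤ k) (hη : 0 < η) :
    ∃ n₁ : ℝ, 1 ≤ n₁ ∧ ∀ n : ℝ, n₁ ≤ n → ∀ Z : ℂ, ‖Z - k‖ ≤ k / 4 →
      ∃ v : ℂ, GateRel n k v (-1 / Z) ∧ ‖v - (Z - k)‖ ≤ η ∧
        ‖gatePhase b c v (-1 / Z) (gateSize (n ^ 2 + k)) - (fatouApprox b Z - k)‖ ≤ η := by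
  set K := 16 * k ^ 3 + 4 * k + k ^ 2 with hK
  set K' := K + (‖b‖ + ‖c‖) * (2 * k) ^ 2 with hK'
  have hK'0 : 0 ≤ (‖b‖ + ‖c‖) * (2 * k) ^ 2 := by positivity
  obtain ⟨n₂, hn₂, h2⟩ := exists_small_step K' hη
  obtain ⟨n₃, hn₃, h3⟩ := exists_small_step (4 * k) (show (0 : ℝ) < 1 by norm_num)
  refine ⟨max n₂ (max n₃ k), hn₂.trans (le_max_left _ _), fun n hn Z hZ => ?_⟩
  have hn2 := h2 n ((le_max_left _ _).trans hn)
  have hn3 := h3 n ((le_max_left _ _).trans ((le_max_right _ _).trans hn))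
  have hnk : k ≤ n := (le_max_right _ _).trans ((le_max_right _ _).trans hn)
  have hn1 : 1 ≤ n := hk.trans hnk
  have hpi := Real.pi_gt_three
  have hN : 0 < n ^ 2 + k := by positivity
  obtain ⟨g1, g2, g3, g4⟩ := gateSize_comparison hn1 (by linarith : n ^ 2 ≤ n ^ 2 + k) (by nlinarith)
  have hε0 := gateSize_pos hN
  set ε := gateSize (n ^ 2 + k) with hε
  set εs := Real.pi / (2 * n) with hεs
  have hεs0 : 0 < εs := by positivity
  have hεs1 : εs ≤ 1 / 4 := by nlinarith
  obtain ⟨z1, z2, z3⟩ : Z ≠ 0 ∧ ‖Z‖ ≤ 2 * k ∧ 0 < (Z ^ 2).re := by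
    have e1 := abs_le.1 ((Complex.abs_re_le_norm _).trans hZ)
    have e2 := (Complex.abs_im_le_norm _).trans hZ
    simp only [Complex.sub_re, Complex.sub_im, Complex.ofReal_re, Complex.ofReal_im, sub_zero] at e1 e2
    refine ⟨?_, ?_, re_sq_pos_of_two_mul_abs_im_le ?_ ?_⟩
    · rintro rfl
      simp at e1
      linarith
    · have e : Z = (Z - k) + k := by ring
      rw [e]
      refine (norm_add_le _ _).trans ?_
      rw [Complex.norm_real, Real.norm_eq_abs, abs_of_pos (by linarith)]
      linarith
    · have := le_abs_self Z.re
      linarith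
    · have : 0 < Z.re := by linarith
      exact this.ne'
  set s : ℂ := (ε : ℂ) * Z with hs
  have hsn : ‖s‖ ≤ 2 * k * εs := by
    rw [hs, norm_mul, Complex.norm_real, Real.norm_eq_abs, abs_of_pos hε0]
    calc ε * ‖Z‖ ≤ εs * (2 * k) := by gcongr
      _ = _ := by ring
  obtain ⟨w, hw1, hw2⟩ := exists_sin_eq_mul_cos (r := s) (by linarith)
  set x := Real.pi * (√(n ^ 2 + k) - n) with hx
  have hεsc : (εs : ℂ) ≠ 0 := by exact_mod_cast hεs0.ne'
  have hεsn : ‖(εs : ℂ)‖ = εs := by rw [Complex.norm_real, Real.norm_eq_abs, abs_of_pos hεs0]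
  have hχ : (x : ℂ) + (εs : ℂ) * ((w - x) / εs) = w := by field_simp; ring
  have hxk : |k - x / εs| ≤ k ^ 2 * εs := by
    set t := √(n ^ 2 + k) with ht
    have ht2 : t ^ 2 = n ^ 2 + k := Real.sq_sqrt hN.le
    have htn : n ≤ t := Real.le_sqrt_of_sq_le (by linarith)
    -- Exact, because x/εs = 2n(t - n) and k = t² - n².
    have e1 : k - x / εs = (t - n) ^ 2 := by
      rw [hx, hεs]
      field_simp
      linear_combination -ht2
    have e2 : t - n = k / (t + n) := by
      rw [eq_div_iff (by linarith)]; linear_combination ht2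
    have e3 : t - n ≤ k * εs := by
      rw [e2, hεs, div_le_iff₀ (by linarith), mul_assoc]
      have : 1 ≤ Real.pi / (2 * n) * (t + n) := by
        rw [div_mul_eq_mul_div, le_div_iff₀ (by positivity)]
        nlinarith only [hpi, htn, hn1]
      nlinarith only [this, hk]
    rw [e1, abs_of_nonneg (sq_nonneg _)]
    calc (t - n) ^ 2 ≤ (k * εs) ^ 2 := by
          have : 0 ≤ t - n := by linarith
          gcongr
      _ = k ^ 2 * εs * εs := by ring
      _ ≤ k ^ 2 * εs * 1 := by gcongr; linarith
      _ = _ := by ring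
  have hv : ‖(w - x) / εs - (Z - k)‖ ≤ K * εs := by
    have e : (w - x) / εs - (Z - k) = (w - s) / εs + ((ε / εs - 1 : ℝ) : ℂ) * Z + ((k - x / εs : ℝ) : ℂ) := by
      rw [hs]
      push_cast
      field_simp
      ring
    have t1 : ‖(w - s) / εs‖ ≤ 16 * k ^ 3 * εs := by
      rw [norm_div, hεsn, div_le_iff₀ hεs0]
      calc ‖w - s‖ ≤ 2 * (2 * k * εs) ^ 3 := hw2.trans (by gcongr)
        _ = 16 * k ^ 3 * εs * εs * εs := by ring
        _ ≤ 16 * k ^ 3 * εs * 1 * εs := by gcongr; linarith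
        _ = _ := by ring
    have t2 : ‖((ε / εs - 1 : ℝ) : ℂ) * Z‖ ≤ 4 * k * εs := by
      rw [norm_mul, Complex.norm_real, Real.norm_eq_abs]
      calc |ε / εs - 1| * ‖Z‖ ≤ (2 * εs) * (2 * k) := by
            gcongr
            linarith
        _ = _ := by ring
    rw [e]
    refine (norm_add_le _ _).trans ((add_le_add_left (norm_add_le _ _) _).trans ?_)
    rw [Complex.norm_real, Real.norm_eq_abs, hK]
    linarith
  refine ⟨(w - x) / εs, ?_, ?_, ?_⟩
  · rw [GateRel, ← hx, ← hεs, ← hε, hχ, hw1, hs]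
    field_simp
  · have : 0 ≤ (‖b‖ + ‖c‖) * (2 * k) ^ 2 * εs := by positivity
    rw [hK'] at hn2
    linarith
  · have hg := norm_gatePhase_sub_le b c ((w - x) / εs) (ε := ε) z3 (by linarith)
    have e : gatePhase b c ((w - x) / εs) (-1 / Z) ε - (fatouApprox b Z - k) =
        (gatePhase b c ((w - x) / εs) (-1 / Z) ε - ((w - x) / εs - b / 2 * Complex.log (Z ^ 2))) +
        ((w - x) / εs - (Z - k)) := by
      rw [fatouApprox]; ring
    rw [e]
    refine (norm_add_le _ _).trans ?_
    have t1 : (‖b‖ + ‖c‖) * ‖s‖ ^ 2 ≤ (‖b‖ + ‖c‖) * (2 * k) ^ 2 * εs := by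
      have : ‖s‖ ^ 2 ≤ (2 * k) ^ 2 * εs := by
        calc ‖s‖ ^ 2 ≤ (2 * k * εs) ^ 2 := by gcongr
          _ = (2 * k) ^ 2 * εs * εs := by ring
          _ ≤ (2 * k) ^ 2 * εs * 1 := by gcongr; linarith
          _ = _ := by ring
      calc _ ≤ (‖b‖ + ‖c‖) * ((2 * k) ^ 2 * εs) := by gcongr
        _ = _ := by ring
    rw [hK'] at hn2
    linarith

set_option maxHeartbeats 1000000 in
-- The mirror image of the entrance: the angle is now close to π. Subtracting π gives u = εs·v - y
-- with tan u = εZ, so Z is close to v - k and the phase is close to `fatouApprox` of Z plus k.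
lemma gate_exit (b c : ℂ) {k η : ℝ} (hk : 1 ≤ k) (hη : 0 < η) :
    ∃ n₁ : ℝ, 1 ≤ n₁ ∧ ∀ n : ℝ, n₁ ≤ n → ∀ z v : ℂ, ‖v‖ ≤ k / 20 → GateRel n (2 * n + 1 - k) v z →
      ‖-1 / z + k‖ ≤ k / 4 ∧
        ‖gatePhase b c v z (gateSize (n ^ 2 + (2 * n + 1 - k))) - (fatouApprox b (-1 / z) + k)‖ ≤ η := by
  set K := 32 * k ^ 3 + 4 * k + k ^ 2 with hK
  set K' := K + (‖b‖ + ‖c‖) * (2 * k) ^ 2 with hK'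
  have hK'0 : 0 ≤ (‖b‖ + ‖c‖) * (2 * k) ^ 2 := by positivity
  have hK0 : 0 ≤ K := by positivity
  obtain ⟨n₂, hn₂, h2⟩ := exists_small_step K' (lt_min hη (show (0 : ℝ) < 1 / 10 by norm_num))
  obtain ⟨n₃, hn₃, h3⟩ := exists_small_step (8 * k) (show (0 : ℝ) < 1 by norm_num)
  refine ⟨max n₂ (max n₃ k), hn₂.trans (le_max_left _ _), fun n hn z v hv hrel => ?_⟩
  have hn2 := h2 n ((le_max_left _ _).trans hn)
  have hn3 := h3 n ((le_max_left _ _).trans ((le_max_right _ _).trans hn))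
  have hnk : k ≤ n := (le_max_right _ _).trans ((le_max_right _ _).trans hn)
  have hn1 : 1 ≤ n := hk.trans hnk
  have hpi := Real.pi_gt_three
  have hNe : n ^ 2 + (2 * n + 1 - k) = (n + 1) ^ 2 - k := by ring
  have hN : 0 < n ^ 2 + (2 * n + 1 - k) := by nlinarith
  obtain ⟨g1, g2, g3, g4⟩ := gateSize_comparison hn1 (by linarith : n ^ 2 ≤ n ^ 2 + (2 * n + 1 - k)) (by linarith)
  have hε0 := gateSize_pos hN
  rw [GateRel] at hrel
  set ε := gateSize (n ^ 2 + (2 * n + 1 - k)) with hε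
  set εs := Real.pi / (2 * n) with hεs
  have hεs0 : 0 < εs := by positivity
  have hεs1 : εs ≤ 1 / 8 := by nlinarith
  have hεsc : (εs : ℂ) ≠ 0 := by exact_mod_cast hεs0.ne'
  have hε0c : (ε : ℂ) ≠ 0 := by exact_mod_cast hε0.ne'
  have hεsn : ‖(εs : ℂ)‖ = εs := by rw [Complex.norm_real, Real.norm_eq_abs, abs_of_pos hεs0]
  have hεn : ‖(ε : ℂ)‖ = ε := by rw [Complex.norm_real, Real.norm_eq_abs, abs_of_pos hε0]
  set t := √(n ^ 2 + (2 * n + 1 - k)) with ht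
  have ht2 : t ^ 2 = (n + 1) ^ 2 - k := by rw [← hNe]; exact Real.sq_sqrt hN.le
  have htn : n ≤ t := Real.le_sqrt_of_sq_le (by linarith)
  have htn1 : t ≤ n + 1 := by nlinarith only [ht2, htn, hn1, hk]
  set y := Real.pi * (n + 1 - t) with hy
  have e2 : n + 1 - t = k / (n + 1 + t) := by
    rw [eq_div_iff (by linarith)]; linear_combination -ht2
  have e3 : n + 1 - t ≤ k * (1 / (2 * n)) := by
    rw [e2, div_eq_mul_one_div]
    gcongr
    linarith
  have hy0 : 0 ≤ y := by
    have : 0 ≤ n + 1 - t := by linarith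
    positivity
  have hyk : y ≤ k * εs := by
    calc y ≤ Real.pi * (k * (1 / (2 * n))) := by rw [hy]; gcongr
      _ = _ := by rw [hεs]; ring
  have hyε : |k - y / ε| ≤ k ^ 2 * εs := by
    -- Exact, because y/ε = 2t(n + 1 - t) and k = (n+1)² - t².
    have e1 : k - y / ε = (n + 1 - t) ^ 2 := by
      rw [hy, hε, gateSize, ← ht]
      have : 0 < t := by linarith
      field_simp
      linear_combination ht2
    rw [e1, abs_of_nonneg (sq_nonneg _)]
    have e4 : n + 1 - t ≤ k * εs := by
      refine e3.trans ?_
      rw [hεs]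
      gcongr
      linarith
    calc (n + 1 - t) ^ 2 ≤ (k * εs) ^ 2 := by
          have : 0 ≤ n + 1 - t := by linarith
          gcongr
      _ = k ^ 2 * εs * εs := by ring
      _ ≤ k ^ 2 * εs * 1 := by gcongr; linarith
      _ = _ := by ring
  set u : ℂ := (εs : ℂ) * v - y with hu
  have hun : ‖u‖ ≤ 2 * k * εs := by
    refine (norm_sub_le _ _).trans ?_
    rw [norm_mul, hεsn, Complex.norm_real, Real.norm_eq_abs, abs_of_nonneg hy0]
    have : εs * ‖v‖ ≤ εs * (k / 20) := by gcongr
    nlinarith only [this, hyk, mul_pos hεs0 (one_pos.trans_le hk)]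
  have hu4 : ‖u‖ ≤ 1 / 4 := by linarith
  have hχ : ((Real.pi * (t - n) : ℝ) : ℂ) + (εs : ℂ) * v = u + Real.pi := by
    rw [hu, hy]
    push_cast
    ring
  rw [hχ, Complex.sin_add_pi, Complex.cos_add_pi] at hrel
  have hzu : z * Complex.sin u = -ε * Complex.cos u := by linear_combination -hrel
  have hc1 := norm_cos_sub_one_le (w := u) (by linarith)
  have hc2 : 1 / 2 ≤ ‖Complex.cos u‖ := by
    have := norm_sub_norm_le (1 : ℂ) (1 - Complex.cos u)
    rw [norm_one, norm_sub_rev, sub_sub_cancel] at this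
    nlinarith [norm_nonneg u]
  have hc0 : Complex.cos u ≠ 0 := by
    intro h
    rw [h] at hc2
    norm_num at hc2
  have hz0 : z ≠ 0 := by
    rintro rfl
    rw [zero_mul] at hzu
    exact (mul_ne_zero (neg_ne_zero.2 hε0c) hc0) hzu.symm
  set Z : ℂ := -1 / z with hZ
  have hzZ : -1 / Z = z := by rw [hZ, neg_one_div_neg_one_div]
  have hZc : (ε : ℂ) * Z * Complex.cos u = Complex.sin u := by
    rw [hZ]
    field_simp
    linear_combination -hzu
  have hZu : ‖(ε : ℂ) * Z - u‖ ≤ 2 * ‖u‖ ^ 3 := by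
    have e : ((ε : ℂ) * Z - u) * Complex.cos u = (Complex.sin u - u) - u * (Complex.cos u - 1) := by
      linear_combination hZc
    have h5 : ‖((ε : ℂ) * Z - u) * Complex.cos u‖ ≤ ‖u‖ ^ 3 := by
      rw [e]
      refine (norm_sub_le _ _).trans ?_
      rw [norm_mul]
      have h6 := norm_sin_sub_self_le (w := u) (by linarith)
      have h7 := mul_le_mul_of_nonneg_left hc1 (norm_nonneg u)
      have : 0 ≤ ‖u‖ ^ 3 := by positivity
      nlinarith only [h6, h7, this]
    rw [norm_mul] at h5
    nlinarith only [h5, hc2, norm_nonneg ((ε : ℂ) * Z - u)]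
  have hZv : ‖Z - (v - k)‖ ≤ K * εs := by
    have e : Z - (v - k) = ((ε : ℂ) * Z - u) / ε + ((εs / ε * (1 - ε / εs) : ℝ) : ℂ) * v
        + ((k - y / ε : ℝ) : ℂ) := by
      rw [hu]
      push_cast
      field_simp
      ring
    have t1 : ‖((ε : ℂ) * Z - u) / ε‖ ≤ 32 * k ^ 3 * εs := by
      rw [norm_div, hεn, div_le_iff₀ hε0]
      calc _ ≤ 2 * (2 * k * εs) ^ 3 := hZu.trans (by gcongr)
        _ = 16 * k ^ 3 * εs * εs * εs := by ring
        _ ≤ 16 * k ^ 3 * εs * 1 * (2 * ε) := by gcongr; linarith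
        _ = _ := by ring
    have t2 : ‖((εs / ε * (1 - ε / εs) : ℝ) : ℂ) * v‖ ≤ 4 * k * εs := by
      rw [norm_mul, Complex.norm_real, Real.norm_eq_abs, abs_mul, abs_sub_comm, abs_of_pos (by positivity)]
      have : εs / ε ≤ 2 := by rw [div_le_iff₀ hε0]; exact g2
      calc εs / ε * |ε / εs - 1| * ‖v‖ ≤ 2 * (2 * εs) * (k / 20) := by
            gcongr
            linarith
        _ ≤ _ := by linarith [mul_pos hεs0 (one_pos.trans_le hk)]
    rw [e]
    refine (norm_add_le _ _).trans ((add_le_add_left (norm_add_le _ _) _).trans ?_)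
    rw [Complex.norm_real, Real.norm_eq_abs, hK]
    linarith
  have hKe : K * εs + (‖b‖ + ‖c‖) * (2 * k) ^ 2 * εs ≤ min η (1 / 10) := by
    rw [hK'] at hn2
    linarith
  have hKe0 : 0 ≤ (‖b‖ + ‖c‖) * (2 * k) ^ 2 * εs := by positivity
  have hKe1 : 0 ≤ K * εs := by positivity
  have hKη := hKe.trans (min_le_left _ _)
  have hK10 := hKe.trans (min_le_right _ _)
  have hZk : ‖Z + k‖ ≤ k / 4 := by
    have e : Z + k = (Z - (v - k)) + v := by ring
    rw [e]
    refine (norm_add_le _ _).trans ?_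
    linarith
  refine ⟨hZk, ?_⟩
  obtain ⟨-, z2, z3, z4⟩ := norm_bounds_of_norm_add_le (Z := Z) (x := k) (t := 1 / 4) (by linarith)
  rw [abs_of_pos (by norm_num), abs_of_pos (by linarith)] at z2
  have hre : 0 < (Z ^ 2).re := by
    have : Z.re < 0 := by linarith
    refine re_sq_pos_of_two_mul_abs_im_le ?_ this.ne
    rw [abs_of_neg this]
    linarith
  have hεZ : ‖(ε : ℂ) * Z‖ ≤ 2 * k * εs := by
    rw [norm_mul, hεn]
    calc ε * ‖Z‖ ≤ εs * (2 * k) := by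
          gcongr
          linarith
      _ = _ := by ring
  have hg := norm_gatePhase_sub_le b c v (ε := ε) hre (by linarith)
  rw [hzZ] at hg
  have e : gatePhase b c v z ε - (fatouApprox b Z + k) =
      (gatePhase b c v z ε - (v - b / 2 * Complex.log (Z ^ 2))) - (Z - (v - k)) := by
    rw [fatouApprox]; ring
  rw [e]
  refine (norm_sub_le _ _).trans ?_
  have t1 : (‖b‖ + ‖c‖) * ‖(ε : ℂ) * Z‖ ^ 2 ≤ (‖b‖ + ‖c‖) * (2 * k) ^ 2 * εs := by
    have : ‖(ε : ℂ) * Z‖ ^ 2 ≤ (2 * k) ^ 2 * εs := by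
      calc ‖(ε : ℂ) * Z‖ ^ 2 ≤ (2 * k * εs) ^ 2 := by gcongr
        _ = (2 * k) ^ 2 * εs * εs := by ring
        _ ≤ (2 * k) ^ 2 * εs * 1 := by gcongr; linarith
        _ = _ := by ring
    calc _ ≤ (‖b‖ + ‖c‖) * ((2 * k) ^ 2 * εs) := by gcongr
      _ = _ := by ring
  linarith

/-! ### Convergence of a passage to the Lavaurs map -/

/-- This handles the first k and last k steps of a passage, outside the gate estimates: k is fixed
there while the forcing is O(1/n), so continuity on compact sets suffices. -/
lemma exists_perturbed_iterate (f : ℂ[X]) (k : ℕ) (R : ℝ) {η : ℝ} (hη : 0 < η) :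
    ∃ τ > 0, ∀ z d : ℕ → ℂ, ‖z 0‖ ≤ R → (∀ m < k, z (m + 1) = f.eval (z m) + d m) →
      (∀ m < k, ‖d m‖ ≤ τ) → ‖z k - (fun x => f.eval x)^[k] (z 0)‖ ≤ η := by
  induction k generalizing η with
  | zero =>
    refine ⟨1, one_pos, fun z d _ _ _ => ?_⟩
    simpa using hη.le
  | succ k ih =>
    obtain ⟨R', hR'⟩ := (isCompact_closedBall (0 : ℂ) R).exists_bound_of_continuousOn
      (continuous_iterate_eval f k).continuousOn
    have huc : UniformContinuousOn (fun x => f.eval x) (Metric.closedBall 0 (R' + 1)) :=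
      (isCompact_closedBall _ _).uniformContinuousOn_of_continuous f.continuous.continuousOn
    obtain ⟨δ, hδ, hd⟩ := Metric.uniformContinuousOn_iff.1 huc (η / 2) (by linarith)
    obtain ⟨τ, hτ, h⟩ := ih (show 0 < min 1 (δ / 2) by positivity)
    refine ⟨min τ (η / 2), by positivity, fun z d hz hrec hdm => ?_⟩
    have h1 := h z d hz (fun m hm => hrec m (by omega))
      (fun m hm => (hdm m (by omega)).trans (min_le_left _ _))
    have h2 := hR' (z 0) (by simpa using hz)
    rw [Function.iterate_succ_apply', hrec k (by omega)]
    set w := (fun x => f.eval x)^[k] (z 0)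
    have h3 : ‖z k‖ ≤ R' + 1 := by
      have e : z k = (z k - w) + w := by ring
      rw [e]
      refine (norm_add_le _ _).trans ?_
      linarith [min_le_left 1 (δ / 2)]
    have h4 := hd (z k) (by simpa using h3) w (by simpa using (by linarith : ‖w‖ ≤ R' + 1)) (by
      rw [dist_eq_norm]
      exact h1.trans_lt ((min_le_right _ _).trans_lt (by linarith)))
    rw [dist_eq_norm] at h4
    have e : f.eval (z k) + d k - f.eval w = (f.eval (z k) - f.eval w) + d k := by ring
    rw [e]
    refine (norm_add_le _ _).trans ?_
    have := (hdm k (by omega)).trans (min_le_right _ _)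
    linarith

lemma norm_fatouApprox_sub_le_right {b : ℂ} {R : ℝ} (hR : 0 < R) {Y Y' : ℂ}
    (hY : R ≤ Y.re) (hY' : R ≤ Y'.re) :
    ‖fatouApprox b Y - fatouApprox b Y'‖ ≤ (1 + ‖b‖ / R) * ‖Y - Y'‖ := by
  have h1 := norm_log_sq_sub_le_right hR hY hY'
  have e : fatouApprox b Y - fatouApprox b Y' = (Y - Y') -
      b / 2 * (Complex.log (Y ^ 2) - Complex.log (Y' ^ 2)) := by rw [fatouApprox, fatouApprox]; ring
  rw [e]
  refine (norm_sub_le _ _).trans ?_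
  rw [norm_mul, norm_div, Complex.norm_ofNat]
  calc _ ≤ ‖Y - Y'‖ + ‖b‖ / 2 * (2 / R * ‖Y - Y'‖) := by gcongr
    _ = _ := by ring

lemma norm_neg_one_div_sub_le {w w' : ℂ} {k θ : ℝ} (hk : 0 < k) (hw : w ≠ 0) (hwk : ‖-1 / w‖ ≤ 2 * k)
    (h1 : ‖w' - w‖ ≤ 1 / (4 * k)) (h2 : ‖w' - w‖ ≤ θ / (8 * k ^ 2)) : ‖-1 / w' - -1 / w‖ ≤ θ := by
  have hwp : 0 < ‖w‖ := norm_pos_iff.2 hw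
  have h3 : 1 / (2 * k) ≤ ‖w‖ := by
    rw [norm_div, norm_neg, norm_one, div_le_iff₀ hwp] at hwk
    rw [div_le_iff₀ (by positivity)]
    linarith
  have e0 : 1 / (2 * k) = 1 / (4 * k) + 1 / (4 * k) := by field_simp; norm_num
  have h4 : 1 / (4 * k) ≤ ‖w'‖ := by
    have := norm_sub_norm_le w (w - w')
    rw [sub_sub_cancel, norm_sub_rev] at this
    linarith
  have hwp' : 0 < ‖w'‖ := lt_of_lt_of_le (by positivity) h4
  have hw' : w' ≠ 0 := norm_pos_iff.1 hwp'
  have e : -1 / w' - -1 / w = (w' - w) / (w' * w) := by field_simp; ring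
  rw [e, norm_div, norm_mul, div_le_iff₀ (by positivity)]
  have h5 : 1 / (4 * k) * (1 / (2 * k)) ≤ ‖w'‖ * ‖w‖ := by gcongr
  have hθ : 0 ≤ θ := by
    have := (norm_nonneg _).trans h2
    by_contra h
    have : θ / (8 * k ^ 2) < 0 := div_neg_of_neg_of_pos (by linarith) (by positivity)
    linarith
  calc ‖w' - w‖ ≤ θ / (8 * k ^ 2) := h2
    _ = θ * (1 / (4 * k) * (1 / (2 * k))) := by field_simp; ring
    _ ≤ _ := by gcongr

set_option maxHeartbeats 1000000 in
/-- Near a point of the parabolic basin, passing once through the gate is close to the Lavaurs map. -/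
theorem exists_lavaurs_convergence {f : ℂ[X]} (h0 : f.coeff 0 = 0) (h1 : f.coeff 1 = 1)
    (h2 : f.coeff 2 = 1) {ξ : ℂ} (hξ : ξ ∈ parabolicBasin f) :
    ∃ ρ > 0, ∀ η > 0, ∃ σ > 0, ∃ n₁ : ℕ, ∀ n : ℕ, n₁ ≤ n → ∀ z d : ℕ → ℂ, z 0 ∈ Metric.closedBall ξ ρ →
      (∀ m < 2 * n + 1, z (m + 1) = f.eval (z m) + d m) →
      (∀ m < 2 * n + 1, ‖d m - (gateSize ((n : ℝ) ^ 2 + m) : ℂ) ^ 2‖ ≤ σ / n ^ 3) →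
      ‖z (2 * n + 1) - lavaursMap f (z 0)‖ ≤ η := by
  obtain ⟨ρ, hρ, B, hB, hatt⟩ := exists_attracting h0 h1 h2 hξ
  obtain ⟨C, σ₁, hC, hσ₁, hpass⟩ := exists_gate_passage h0 h1 h2
  refine ⟨ρ, hρ, fun η hη => ?_⟩
  obtain ⟨s', hs', k₀, hrep⟩ := exists_repelling h0 h1 h2 B (show 0 < η / 2 by linarith)
  set b := 1 - f.coeff 3
  set c : ℂ := ((2 / Real.pi ^ 2 : ℝ) : ℂ) - f.coeff 3
  set s := min 1 s' with hs
  have hs0 : 0 < s := by positivity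
  have hs1 : s ≤ 1 := min_le_left _ _
  have hss : s ≤ s' := min_le_right _ _
  -- The phase budget uses s/8 for each of: the attracting coordinate, the perturbed initial steps,
  -- entry, C/k, Cσ, and exit. The bound 1/80 keeps the initial delay below k/20.
  obtain ⟨k₁, hk₁⟩ := hatt (min (1 / 80) (s / 8)) (by positivity)
  obtain ⟨k₂, hk₂⟩ := hpass (B + 3)
  obtain ⟨k₃, hk₃⟩ := exists_nat_ge (8 * C / s + 80)
  -- The cut-off time k is fixed before n, since the entry, exit and perturbation estimates are
  -- limits in n for fixed k.
  obtain ⟨k, hk⟩ : ∃ k, k = k₀ + k₁ + k₂ + k₃ := ⟨_, rfl⟩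
  have hkk : (k₃ : ℝ) ≤ k := by exact_mod_cast (by omega : k₃ ≤ k)
  have hCs : 0 ≤ 8 * C / s := by positivity
  have hk80 : (80 : ℝ) ≤ k := by linarith
  have hkp : (0 : ℝ) < k := by linarith
  have hCk : C * (1 / k) ≤ s / 8 := by
    have : 8 * C / s ≤ k := by linarith
    rw [div_le_iff₀ hs0] at this
    rw [mul_one_div, div_le_iff₀ hkp]
    linarith
  obtain ⟨n₂, hn₂, hentry⟩ := gate_entry b c (k := k) (by linarith) (show 0 < s / 8 by linarith)
  obtain ⟨n₃, hn₃, hexit⟩ := gate_exit b c (k := k) (by linarith) (show 0 < s / 8 by linarith)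
  set θ := min 1 (s / (8 * (1 + ‖b‖))) with hθ
  have hθ0 : 0 < θ := by positivity
  obtain ⟨τ₁, hτ₁, hper1⟩ := exists_perturbed_iterate f k (‖ξ‖ + ρ)
    (show 0 < min (1 / (4 * k : ℝ)) (θ / (8 * (k : ℝ) ^ 2)) by positivity)
  obtain ⟨τ₂, hτ₂, hper2⟩ := exists_perturbed_iterate f k 2 (show 0 < η / 2 by linarith)
  obtain ⟨n₄, hn₄⟩ := exists_nat_ge (n₂ + n₃ + 4 / τ₁ + 4 / τ₂)
  refine ⟨min σ₁ (min 1 (s / (8 * (C + 1)))), by positivity, n₄ + k + 5,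
    fun n hn z d hz hrec hd => ?_⟩
  set σ := min σ₁ (min 1 (s / (8 * (C + 1)))) with hσ
  have hσ0 : 0 < σ := by positivity
  have hσ1 : σ ≤ 1 := (min_le_right _ _).trans (min_le_left _ _)
  have hCσ : C * σ ≤ s / 8 := by
    have h3 : σ ≤ s / (8 * (C + 1)) := (min_le_right _ _).trans (min_le_right _ _)
    rw [le_div_iff₀ (by positivity)] at h3
    linarith
  have hn4R : (n₄ : ℝ) + k + 5 ≤ n := by exact_mod_cast hn
  have hτ1p : 0 < 4 / τ₁ := by positivity
  have hτ2p : 0 < 4 / τ₂ := by positivity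
  have hn1 : (1 : ℝ) ≤ n := by linarith
  have hdn : ∀ m < 2 * n + 1, ‖d m‖ ≤ 4 / n := by
    intro m hm
    have hN : 0 < (n : ℝ) ^ 2 + m := by positivity
    have e : d m = (d m - (gateSize ((n : ℝ) ^ 2 + m) : ℂ) ^ 2) + (gateSize ((n : ℝ) ^ 2 + m) : ℂ) ^ 2 := by ring
    rw [e]
    refine (norm_add_le _ _).trans ?_
    have h3 := hd m hm
    have h4 : σ / (n : ℝ) ^ 3 ≤ 1 / n := by
      rw [div_le_div_iff₀ (by positivity) (by linarith)]
      have : (n : ℝ) ≤ (n : ℝ) ^ 3 := le_self_pow₀ hn1 (by norm_num)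
      nlinarith
    have h5 : ‖(gateSize ((n : ℝ) ^ 2 + m) : ℂ) ^ 2‖ ≤ 3 / n := by
      rw [norm_pow, Complex.norm_real, Real.norm_eq_abs, sq_abs, gateSize_sq hN,
        div_le_div_iff₀ (by positivity) (by linarith)]
      have hp1 := Real.pi_lt_d2
      have hp0 := Real.pi_pos
      have hp : Real.pi ^ 2 ≤ 12 := by nlinarith
      have hm0 : (0 : ℝ) ≤ m := m.cast_nonneg
      nlinarith
    have e2 : 4 / (n : ℝ) = 1 / n + 3 / n := by ring
    linarith
  have hnτ1 : 4 / (n : ℝ) ≤ τ₁ := by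
    have : 4 / τ₁ ≤ n := by linarith
    rw [div_le_iff₀ hτ₁] at this
    rw [div_le_iff₀ (by linarith)]
    linarith
  have hnτ2 : 4 / (n : ℝ) ≤ τ₂ := by
    have : 4 / τ₂ ≤ n := by linarith
    rw [div_le_iff₀ hτ₂] at this
    rw [div_le_iff₀ (by linarith)]
    linarith
  have hz0 : ‖z 0‖ ≤ ‖ξ‖ + ρ := by
    have e : z 0 = ξ + (z 0 - ξ) := by ring
    rw [e]
    refine (norm_add_le _ _).trans ?_
    rw [Metric.mem_closedBall, dist_eq_norm] at hz
    linarith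
  have p1 := hper1 z d hz0 (fun m hm => hrec m (by omega)) (fun m hm => (hdn m (by omega)).trans hnτ1)
  obtain ⟨a1, a2⟩ := hk₁ k (by omega) (z 0) hz
  have a3 := hB (z 0) hz
  set φ := attractingFatouCoordinate f (z 0) with hφ
  set w := (fun x => f.eval x)^[k] (z 0) with hw
  have a2' : ‖-1 / w - k‖ ≤ 1 / 80 * k := a2.trans (by gcongr; exact min_le_left _ _)
  have a1' : ‖fatouApprox b (-1 / w) - k - φ‖ ≤ s / 8 := a1.trans (min_le_right _ _)
  have hre1 : 79 / 80 * (k : ℝ) ≤ (-1 / w).re := by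
    have := (abs_le.1 ((Complex.abs_re_le_norm _).trans a2')).1
    simp only [Complex.sub_re, Complex.natCast_re] at this
    linarith
  have hwn : ‖-1 / w‖ ≤ 2 * k := by
    have e : -1 / w = (-1 / w - k) + k := by ring
    rw [e]
    refine (norm_add_le _ _).trans ?_
    rw [Complex.norm_natCast]
    linarith
  have hw0 : w ≠ 0 := by
    intro h
    rw [h] at hre1
    simp at hre1
    linarith
  have hZZ := norm_neg_one_div_sub_le hkp hw0 hwn (p1.trans (min_le_left _ _)) (p1.trans (min_le_right _ _))
  set Z := -1 / z k with hZ
  have hθ1 : θ ≤ 1 := min_le_left _ _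
  have hre2 : 1 ≤ Z.re := by
    have := (abs_le.1 ((Complex.abs_re_le_norm _).trans hZZ)).1
    simp only [Complex.sub_re] at this
    linarith
  have hΦZ : ‖fatouApprox b Z - fatouApprox b (-1 / w)‖ ≤ s / 8 := by
    refine (norm_fatouApprox_sub_le_right one_pos hre2 (by linarith)).trans ?_
    have h3 : θ ≤ s / (8 * (1 + ‖b‖)) := min_le_right _ _
    rw [le_div_iff₀ (by positivity)] at h3
    rw [div_one]
    have := mul_le_mul_of_nonneg_left hZZ (show 0 ≤ 1 + ‖b‖ by positivity)
    linarith
  have hZk : ‖Z - k‖ ≤ 1 / 80 * k + 1 := by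
    have e : Z - k = (Z - -1 / w) + (-1 / w - k) := by ring
    rw [e]
    refine (norm_add_le _ _).trans ?_
    linarith
  have hzZ : -1 / Z = z k := neg_one_div_neg_one_div _
  obtain ⟨v₀, e1, e2, e3⟩ := hentry n (by linarith) Z (by
    rw [Complex.ofReal_natCast]
    linarith)
  rw [hzZ] at e1 e3
  rw [Complex.ofReal_natCast] at e2 e3
  have hv₀ : ‖v₀‖ ≤ k / 20 := by
    have e : v₀ = (v₀ - (Z - k)) + (Z - k) := by ring
    rw [e]
    refine (norm_add_le _ _).trans ?_
    linarith
  set q₀ := gatePhase b c v₀ (z k) (gateSize ((n : ℝ) ^ 2 + k)) with hq₀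
  have hq₀φ : ‖q₀ - φ‖ ≤ s / 8 + s / 8 + s / 8 := by
    have e : q₀ - φ = (q₀ - (fatouApprox b Z - k)) + (fatouApprox b Z - fatouApprox b (-1 / w)) +
      (fatouApprox b (-1 / w) - k - φ) := by ring
    rw [e]
    refine (norm_add_le _ _).trans ((add_le_add_left (norm_add_le _ _) _).trans ?_)
    linarith
  have hq₀n : ‖q₀‖ ≤ B + 3 := by
    have e : q₀ = (q₀ - φ) + φ := by ring
    rw [e]
    refine (norm_add_le _ _).trans ?_
    linarith
  obtain ⟨v, w1, w2, w3⟩ := hk₂ k n (by omega) (by omega) σ hσ0.le (min_le_left _ _) z d v₀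
    (fun m _ hm => hd m (by omega)) (fun m _ hm => hrec m (by omega)) e1 hv₀ hq₀n
  obtain ⟨x1, x2⟩ := hexit n (by linarith) _ v w2 w1
  rw [Complex.ofReal_natCast] at x1 x2
  set ze := z (2 * n + 1 - k) with hze
  set Y := -1 / ze with hY
  have hYΦ : ‖fatouApprox b Y - (φ - k)‖ ≤ s' := by
    have e : fatouApprox b Y - (φ - k) =
        (gatePhase b c v ze (gateSize ((n : ℝ) ^ 2 + (2 * n + 1 - k))) - q₀) + (q₀ - φ) -
        (gatePhase b c v ze (gateSize ((n : ℝ) ^ 2 + (2 * n + 1 - k))) - (fatouApprox b Y + k)) := by ring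
    rw [e]
    refine (norm_sub_le _ _).trans ((add_le_add_left (norm_add_le _ _) _).trans ?_)
    rw [mul_add] at w3
    linarith
  have r1 := hrep k (by omega) φ a3 Y (by linarith) hYΦ
  have hYz : -1 / Y = ze := neg_one_div_neg_one_div _
  rw [hYz] at r1
  have hzen : ‖ze‖ ≤ 2 := by
    have h3 := norm_bounds_of_norm_add_le (Z := Y) (x := k) (t := 1 / 4) (by
      rw [Complex.ofReal_natCast]; linarith)
    rw [← hYz, norm_div, norm_neg, norm_one, div_le_iff₀ (by linarith [h3.1])]
    linarith [h3.1]
  -- The last k perturbed steps follow k steps of f, which bring the exit point close to the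
  -- parameterization at φ.
  have r2 := hper2 (fun i => z (2 * n + 1 - k + i)) (fun i => d (2 * n + 1 - k + i)) hzen
    (fun m hm => hrec (2 * n + 1 - k + m) (by omega)) (fun m hm => (hdn (2 * n + 1 - k + m) (by omega)).trans hnτ2)
  have hend : 2 * n + 1 - k + k = 2 * n + 1 := by omega
  simp only [hend, add_zero] at r2
  have e : z (2 * n + 1) - lavaursMap f (z 0) = (z (2 * n + 1) - (fun x => f.eval x)^[k] ze) +
      ((fun x => f.eval x)^[k] ze - repellingFatouParameterization f φ) := by
    rw [lavaursMap]; ring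
  rw [e]
  refine (norm_add_le _ _).trans ?_
  linarith

/-! ### The driving parabolic orbit of g -/

/-- Conjugating by w ↦ -w turns w - w² + … into w + w² + …, so the estimates at infinity apply to g
in the coordinate 1/w. -/
lemma eval_iterate_comp_neg (g : ℂ[X]) (w : ℂ) (j : ℕ) :
    (fun x => (-g.comp (C (-1) * X)).eval x)^[j] (-w) = -(fun x => g.eval x)^[j] w := by
  induction j with
  | zero => rfl
  | succ j ih =>
    rw [Function.iterate_succ_apply', Function.iterate_succ_apply', ih]
    simp

/-- Orbits of `g(w) = w - w² + O(w³)` in the coordinate `1 / w`. -/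
lemma exists_norm_one_div_iterate_sub_le {g : ℂ[X]} (h0 : g.coeff 0 = 0) (h1 : g.coeff 1 = 1)
    (h2 : g.coeff 2 = -1) :
    ∃ K : ℝ, 0 ≤ K ∧ ∃ x₀ : ℝ, 2 ≤ x₀ ∧ ∀ x : ℝ, x₀ ≤ x → ∀ w : ℂ, ‖1 / w - x‖ ≤ 1 → ∀ j : ℕ,
      ‖1 / (fun y => g.eval y)^[j] w - (x + j)‖ ≤ 1 + K * Real.log (x + j) ∧
      (x + j) / 2 ≤ ‖1 / (fun y => g.eval y)^[j] w‖ := by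
  set h : ℂ[X] := -g.comp (C (-1) * X) with hh
  have c0 : h.coeff 0 = 0 := by
    rw [hh, coeff_neg, comp_C_mul_X_coeff, h0]; norm_num
  have c1 : h.coeff 1 = 1 := by
    rw [hh, coeff_neg, comp_C_mul_X_coeff, h1]; norm_num
  have c2 : h.coeff 2 = 1 := by
    rw [hh, coeff_neg, comp_C_mul_X_coeff, h2]; norm_num
  obtain ⟨R, C, hR, hC, hb⟩ := exists_atInfinity_bound c0 c1 c2
  set B := ‖1 - h.coeff 3‖ + C with hB
  have hB0 : 0 ≤ B := by positivity
  refine ⟨4 * B, by positivity, 2 * R + 2, by linarith, fun x hx w hw => ?_⟩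
  have hW : ∀ j, 1 / (fun y => g.eval y)^[j] w = -1 / (fun y => h.eval y)^[j] (-w) := fun j => by
    rw [eval_iterate_comp_neg, neg_div_neg_eq]
  have hstep : ∀ j, 1 / (fun y => g.eval y)^[j + 1] w =
      atInfinity h (1 / (fun y => g.eval y)^[j] w) := fun j => by
    rw [hW, hW, Function.iterate_succ_apply', atInfinity, neg_one_div_neg_one_div]
  set W : ℕ → ℂ := fun j => 1 / (fun y => g.eval y)^[j] w with hWd
  have hlow : ∀ j : ℕ, ∀ D : ℝ, ‖W j - (x + j)‖ ≤ D → x + j - D ≤ ‖W j‖ := fun j D hD => by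
    have e1 : ‖((x + j : ℝ) : ℂ)‖ = x + j := by
      rw [Complex.norm_real, Real.norm_eq_abs, abs_of_nonneg (by linarith [j.cast_nonneg (α := ℝ)])]
    have := norm_sub_norm_le ((x + j : ℝ) : ℂ) (W j)
    rw [e1, norm_sub_rev] at this
    push_cast at this
    linarith
  -- A crude linear bound comes first: it gives ‖W j‖ ≥ (x+j)/2. The step error is then O(1/(x+j)),
  -- whose sum is logarithmic.
  have key : ∀ j : ℕ, ‖W j - (x + j)‖ ≤ 1 + j / 10 := by
    intro j
    induction j with
    | zero => simpa [hWd] using hw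
    | succ j ih =>
      have h3 := hlow j _ ih
      have h4 : R ≤ ‖W j‖ := by
        have : (0 : ℝ) ≤ j := j.cast_nonneg
        linarith
      have h5 := (hb (W j) h4).1
      have e : W (j + 1) - (x + (j + 1 : ℕ)) =
          (W j - (x + j)) + (atInfinity h (W j) - W j - 1) := by
        rw [hWd]; dsimp only; rw [hstep]; push_cast; ring
      rw [e]
      refine (norm_add_le _ _).trans ?_
      push_cast
      linarith
  have hhalf : ∀ j : ℕ, (x + j) / 2 ≤ ‖W j‖ := fun j => by
    have h3 := hlow j _ (key j)
    have : (0 : ℝ) ≤ j := j.cast_nonneg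
    linarith
  refine fun j => ⟨?_, hhalf j⟩
  induction j with
  | zero =>
    have : 0 ≤ Real.log x := Real.log_nonneg (by linarith)
    have : 0 ≤ 4 * B * Real.log x := by positivity
    have h3 : ‖1 / w - x‖ ≤ 1 + 4 * B * Real.log x := by linarith
    simpa using h3
  | succ j ih =>
    have hj : (0 : ℝ) ≤ j := j.cast_nonneg
    have hxj : 0 < x + j := by linarith
    have h4 : R ≤ ‖W j‖ := by linarith [hhalf j]
    have h5 := (hb (W j) h4).2.1
    have hWp : 1 ≤ ‖W j‖ := hR.trans h4
    have h6 : ‖atInfinity h (W j) - W j - 1‖ ≤ B / ‖W j‖ := by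
      have e : atInfinity h (W j) - W j - 1 =
          (atInfinity h (W j) - W j - 1 - (1 - h.coeff 3) / W j) + (1 - h.coeff 3) / W j := by ring
      rw [e]
      refine (norm_add_le _ _).trans ?_
      rw [norm_div (1 - h.coeff 3), hB, add_div, add_comm]
      gcongr
      refine h5.trans ?_
      gcongr
      nlinarith
    have h7 : B / ‖W j‖ ≤ 2 * B / (x + j) := by
      rw [div_le_div_iff₀ (by linarith) hxj]
      nlinarith [hhalf j]
    have h8 : 2 * B / (x + j) ≤ 4 * B * (Real.log (x + (j + 1)) - Real.log (x + j)) := by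
      rw [← Real.log_div (by linarith) (by linarith)]
      have h9 := Real.one_sub_inv_le_log_of_pos (x := (x + (j + 1)) / (x + j))
        (div_pos (by linarith) hxj)
      have h10 : 1 / (2 * (x + j)) ≤ 1 - ((x + (j + 1)) / (x + j))⁻¹ := by
        have e : 1 - ((x + (j + 1)) / (x + j))⁻¹ = 1 / (x + (j + 1)) := by
          have : x + (j + 1) ≠ 0 := (by linarith : 0 < x + ((j : ℝ) + 1)).ne'
          rw [inv_div, eq_div_iff this, sub_mul, div_mul_cancel₀ _ this]
          ring
        rw [e]
        exact one_div_le_one_div_of_le (by linarith) (by linarith)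
      calc 2 * B / (x + j) = 4 * B * (1 / (2 * (x + j))) := by field_simp; ring
        _ ≤ _ := by gcongr; linarith
    have e : W (j + 1) - (x + (j + 1 : ℕ)) =
        (W j - (x + j)) + (atInfinity h (W j) - W j - 1) := by
      rw [hWd]; dsimp only; rw [hstep]; push_cast; ring
    change ‖W (j + 1) - (x + (j + 1 : ℕ))‖ ≤ _
    rw [e]
    refine (norm_add_le _ _).trans ?_
    have ih' : ‖W j - (x + j)‖ ≤ 1 + 4 * B * Real.log (x + j) := ih
    push_cast
    linarith

/-- The orbits of `g` follow `1 / N` closely enough to drive the passages through the gate. -/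
theorem exists_parabolic_orbit {g : ℂ[X]} (h0 : g.coeff 0 = 0) (h1 : g.coeff 1 = 1)
    (h2 : g.coeff 2 = -1) :
    ∃ N₀ : ℕ, 2 ≤ N₀ ∧
      (∀ n₀ : ℕ, N₀ ≤ n₀ → ∀ w : ℂ, ‖1 / w - (n₀ : ℂ) ^ 2‖ ≤ 1 → ∀ j : ℕ,
        ‖(fun y => g.eval y)^[j] w‖ ≤ 2 / ((n₀ : ℝ) ^ 2 + j)) ∧
      ∀ σ > 0, ∃ n₁ : ℕ, ∀ n₀ : ℕ, N₀ ≤ n₀ → ∀ w : ℂ, ‖1 / w - (n₀ : ℂ) ^ 2‖ ≤ 1 →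
        ∀ n : ℕ, n₁ ≤ n → n₀ ≤ n → ∀ m < 2 * n + 1,
        ‖(Real.pi : ℂ) ^ 2 / 4 * (fun y => g.eval y)^[n ^ 2 - n₀ ^ 2 + m] w -
          (gateSize ((n : ℝ) ^ 2 + m) : ℂ) ^ 2‖ ≤ σ / n ^ 3 := by
  obtain ⟨K, hK, x₀, hx₀, hb⟩ := exists_norm_one_div_iterate_sub_le h0 h1 h2
  have hN : ∀ n₀ : ℕ, ⌈x₀⌉₊ ≤ n₀ → x₀ ≤ (n₀ : ℝ) ^ 2 := fun n₀ h => by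
    have h3 : x₀ ≤ n₀ := (Nat.le_ceil _).trans (by exact_mod_cast h)
    nlinarith
  refine ⟨max ⌈x₀⌉₊ 2, le_max_right _ _, fun n₀ hn₀ w hw j => ?_, fun σ hσ => ?_⟩
  · have h3 := (hb _ (hN n₀ ((le_max_left _ _).trans hn₀)) w (by simpa using hw) j).2
    have h4 := hN n₀ ((le_max_left _ _).trans hn₀)
    have h5 : 0 < (n₀ : ℝ) ^ 2 + j := by linarith [j.cast_nonneg (α := ℝ)]
    rcases eq_or_ne ((fun y => g.eval y)^[j] w) 0 with h | h
    · rw [h, norm_zero]; positivity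
    rw [norm_div, norm_one, le_div_iff₀ (norm_pos_iff.2 h)] at h3
    rw [le_div_iff₀ h5]
    linarith
  obtain ⟨x₁, hx₁, hlog⟩ := exists_add_mul_log_le (2 * 4 * (1 + K * Real.log 4)) (2 * 4 * (K * 2)) hσ
  refine ⟨⌈x₁⌉₊, fun n₀ hn₀ w hw n hn hn₀n m hm => ?_⟩
  have h3 := hb _ (hN n₀ ((le_max_left _ _).trans hn₀)) w (by simpa using hw) (n ^ 2 - n₀ ^ 2 + m)
  have hsq : n₀ ^ 2 ≤ n ^ 2 := Nat.pow_le_pow_left hn₀n 2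
  have hnR : x₁ ≤ n := (Nat.le_ceil _).trans (by exact_mod_cast hn)
  have hn1 : (1 : ℝ) ≤ n := hx₁.trans hnR
  have hmR : (m : ℝ) ≤ 2 * n := by exact_mod_cast Nat.lt_succ_iff.1 hm
  have e1 : (n₀ : ℝ) ^ 2 + (n ^ 2 - n₀ ^ 2 + m : ℕ) = (n : ℝ) ^ 2 + m := by
    rw [Nat.cast_add, Nat.cast_sub hsq]; push_cast; ring
  have e2 : (((n₀ : ℝ) ^ 2 : ℝ) : ℂ) + (n ^ 2 - n₀ ^ 2 + m : ℕ) = (((n : ℝ) ^ 2 + m : ℝ) : ℂ) := by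
    rw [← e1]; push_cast; rfl
  rw [e1, e2] at h3
  set v := (fun y => g.eval y)^[n ^ 2 - n₀ ^ 2 + m] w
  set N : ℝ := (n : ℝ) ^ 2 + m with hNd
  have hN1 : (n : ℝ) ^ 2 ≤ N := by rw [hNd]; linarith [m.cast_nonneg (α := ℝ)]
  have hN4 : N ≤ 4 * (n : ℝ) ^ 2 := by rw [hNd]; nlinarith
  have hNp : 0 < N := lt_of_lt_of_le (by positivity) hN1
  have hv : v ≠ 0 := by
    intro h
    rw [h, div_zero, norm_zero] at h3
    linarith [h3.2]
  have hvp := norm_pos_iff.2 hv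
  have hvN : ‖v‖ ≤ 2 / N := by
    have h4 := h3.2
    rw [norm_div, norm_one, le_div_iff₀ hvp] at h4
    rw [le_div_iff₀ hNp]
    linarith
  have hNc : (N : ℂ) ≠ 0 := by exact_mod_cast hNp.ne'
  -- As 1/v - N = O(log N), v = O(1/N) and N ≥ n², the forcing error is O(log n / n⁴), which is
  -- o(n⁻³).
  have e3 : (Real.pi : ℂ) ^ 2 / 4 * v - (gateSize N : ℂ) ^ 2 =
      -((Real.pi : ℂ) ^ 2 / 4 * (v * (1 / N) * (1 / v - N))) := by
    rw [← Complex.ofReal_pow (gateSize N), gateSize_sq hNp]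
    push_cast
    field_simp
    ring
  have hlogN : Real.log N ≤ Real.log 4 + 2 * Real.log n := by
    rw [← Real.log_rpow (by linarith), ← Real.log_mul (by norm_num) (by positivity)]
    refine Real.log_le_log hNp (hN4.trans_eq ?_)
    norm_num
  have hD : 2 * 4 * ‖1 / v - (N : ℂ)‖ ≤ σ * n := by
    refine le_trans ?_ (hlog n hnR)
    have : K * Real.log N ≤ K * (Real.log 4 + 2 * Real.log n) := by gcongr
    linarith [h3.1]
  rw [e3, norm_neg, norm_mul, norm_mul, norm_mul]
  have e4 : ‖(Real.pi : ℂ) ^ 2 / 4‖ ≤ 4 := by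
    rw [norm_div, norm_pow, Complex.norm_real, Real.norm_eq_abs, abs_of_pos Real.pi_pos]
    norm_num
    nlinarith [Real.pi_le_four, Real.pi_pos]
  have e5 : ‖1 / (N : ℂ)‖ = 1 / N := by
    rw [norm_div, norm_one, Complex.norm_real, Real.norm_eq_abs, abs_of_pos hNp]
  rw [e5]
  calc ‖(Real.pi : ℂ) ^ 2 / 4‖ * (‖v‖ * (1 / N) * ‖1 / v - (N : ℂ)‖)
      ≤ 4 * (2 / (n : ℝ) ^ 2 * (1 / (n : ℝ) ^ 2) * ‖1 / v - (N : ℂ)‖) := by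
        gcongr
        exact hvN.trans (by gcongr)
    _ = 2 * 4 * ‖1 / v - (N : ℂ)‖ / (n : ℝ) ^ 4 := by field_simp
    _ ≤ σ * n / (n : ℝ) ^ 4 := by gcongr
    _ = σ / n ^ 3 := by field_simp

/-! ### Escape to infinity, and return to the Lavaurs fixed point -/

/-- The polynomial is z times its `divX`, which is nonconstant because the quadratic coefficient is
nonzero, and so tends to infinity. -/
lemma exists_two_mul_norm_add_le_norm_eval {f : ℂ[X]} (h0 : f.coeff 0 = 0) (h2 : f.coeff 2 ≠ 0)
    (M : ℝ) : ∃ R : ℝ, 1 ≤ R ∧ ∀ z : ℂ, R ≤ ‖z‖ → 2 * ‖z‖ + M ≤ ‖f.eval z‖ := by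
  have hdeg : 0 < f.divX.degree := by
    refine natDegree_pos_iff_degree_pos.1 ?_
    refine lt_of_lt_of_le one_pos (le_natDegree_of_ne_zero ?_)
    rwa [coeff_divX]
  have ht := tendsto_norm_atTop f.divX hdeg (tendsto_norm_cocompact_atTop (E := ℂ))
  have h3 := ht.eventually_ge_atTop (2 + |M|)
  rw [← Metric.cobounded_eq_cocompact, (Filter.hasBasis_cobounded_norm).eventually_iff] at h3
  obtain ⟨R, -, hR⟩ := h3
  refine ⟨max R 1, le_max_right _ _, fun z hz => ?_⟩
  have h4 : 2 + |M| ≤ ‖f.divX.eval z‖ := hR ((le_max_left _ _).trans hz)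
  have hz1 : 1 ≤ ‖z‖ := (le_max_right _ _).trans hz
  have e : f.eval z = f.divX.eval z * z := by
    conv_lhs => rw [← divX_mul_X_add f]
    simp [h0]
  rw [e, norm_mul]
  nlinarith [le_abs_self M, abs_nonneg M]

/-- Once the norm reaches R it doubles forever, so no bound can be met infinitely often afterwards.
-/
lemma norm_lt_of_frequently_le {E : Type*} [NormedAddCommGroup E] {u : ℕ → E} {R : ℝ} (hR : 0 < R)
    (h : ∀ n, R ≤ ‖u n‖ → 2 * ‖u n‖ ≤ ‖u (n + 1)‖) {B : ℝ} (hB : ∃ᶠ n in atTop, ‖u n‖ ≤ B) (n : ℕ) :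
    ‖u n‖ < R := by
  by_contra! hn
  have key : ∀ k : ℕ, R * 2 ^ k ≤ ‖u (n + k)‖ := by
    intro k
    induction k with
    | zero => simpa using hn
    | succ k ih =>
      have h1 : R ≤ ‖u (n + k)‖ := by
        refine le_trans ?_ ih
        have : (1 : ℝ) ≤ 2 ^ k := one_le_pow₀ (by norm_num)
        nlinarith
      have h2 := h _ h1
      rw [pow_succ, ← add_assoc]
      linarith
  have ht : Tendsto (fun k : ℕ => R * (2 : ℝ) ^ k) atTop atTop :=
    (tendsto_pow_atTop_atTop_of_one_lt (by norm_num)).const_mul_atTop hR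
  obtain ⟨k₀, hk₀⟩ := eventually_atTop.1 (ht.eventually_gt_atTop B)
  obtain ⟨m, hm, hmB⟩ := frequently_atTop.1 hB (n + k₀)
  obtain ⟨k, rfl⟩ := Nat.exists_eq_add_of_le (show n ≤ m by omega)
  linarith [hk₀ k (by omega), key k]

lemma tendsto_zero_of_eventually_le_mul_add {a : ℕ → ℝ} (ha : ∀ n, 0 ≤ a n) {l : ℝ} (hl0 : 0 ≤ l)
    (hl : l < 1) (h : ∀ η > 0, ∀ᶠ n in atTop, a (n + 1) ≤ l * a n + η) :
    Tendsto a atTop (𝓝 0) := by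
  rw [Metric.tendsto_atTop]
  intro ε hε
  obtain ⟨N, hN⟩ := eventually_atTop.1 (h ((1 - l) * (ε / 2)) (by nlinarith))
  have key : ∀ k : ℕ, a (N + k) ≤ l ^ k * a N + ε / 2 := by
    intro k
    induction k with
    | zero => simp; linarith
    | succ k ih =>
      refine (hN (N + k) (by omega)).trans ?_
      rw [pow_succ]
      nlinarith
  have ht : Tendsto (fun k : ℕ => l ^ k * a N) atTop (𝓝 0) := by
    simpa using (tendsto_pow_atTop_nhds_zero_of_lt_one hl0 hl).mul_const (a N)
  obtain ⟨k₀, hk₀⟩ := eventually_atTop.1 (ht.eventually_lt_const (half_pos hε))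
  refine ⟨N + k₀, fun n hn => ?_⟩
  obtain ⟨k, rfl⟩ := Nat.exists_eq_add_of_le (show N ≤ n by omega)
  rw [Real.dist_eq, sub_zero, abs_of_nonneg (ha _)]
  linarith [hk₀ k (by omega), key k]

lemma skewProduct_iterate_snd (f g : ℂ[X]) (p : ℂ × ℂ) (n : ℕ) :
    ((skewProduct f g)^[n] p).2 = (fun y => g.eval y)^[n] p.2 := by
  induction n with
  | zero => rfl
  | succ n ih =>
    rw [Function.iterate_succ_apply', Function.iterate_succ_apply', ← ih]
    rfl

lemma skewProduct_iterate_succ_fst (f g : ℂ[X]) (p : ℂ × ℂ) (n : ℕ) :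
    ((skewProduct f g)^[n + 1] p).1 = f.eval ((skewProduct f g)^[n] p).1 +
      (Real.pi : ℂ) ^ 2 / 4 * ((skewProduct f g)^[n] p).2 := by
  rw [Function.iterate_succ_apply']
  rfl

lemma exists_closedBall_norm_sub_le {L : ℂ → ℂ} {ξ μ : ℂ} (hfix : L ξ = ξ) (hL : HasDerivAt L μ ξ)
    (hμ : ‖μ‖ < 1) : ∃ l : ℝ, 0 ≤ l ∧ l < 1 ∧ ∃ r > 0, ∀ z ∈ Metric.closedBall ξ r,
      ‖L z - ξ‖ ≤ l * ‖z - ξ‖ := by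
  refine ⟨(1 + ‖μ‖) / 2, by positivity, by linarith, ?_⟩
  have h := (hasDerivAt_iff_isLittleO.1 hL).def (show 0 < (1 - ‖μ‖) / 2 by linarith)
  obtain ⟨r, hr, hb⟩ := Metric.nhds_basis_closedBall.eventually_iff.1 h
  refine ⟨r, hr, fun z hz => ?_⟩
  have h1 := hb hz
  rw [hfix] at h1
  have e : L z - ξ = (L z - ξ - (z - ξ) • μ) + (z - ξ) * μ := by rw [smul_eq_mul]; ring
  rw [e]
  refine (norm_add_le _ _).trans ?_
  rw [norm_mul]
  linarith

lemma tendsto_sq_sub_sq (n₀ : ℕ) : Tendsto (fun n : ℕ => n ^ 2 - n₀ ^ 2) atTop atTop :=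
  (tendsto_sub_atTop_nat _).comp (tendsto_pow_atTop two_ne_zero)

/-- Near an attracting fixed point of the Lavaurs map and deep enough in the basin of `g`, the
iterates of the skew product return to the fixed point at times `n² - n₀²`. -/
theorem exists_tendsto_iterate {f g : ℂ[X]} (hf0 : f.coeff 0 = 0) (hf1 : f.coeff 1 = 1)
    (hf2 : f.coeff 2 = 1) (hg0 : g.coeff 0 = 0) (hg1 : g.coeff 1 = 1) (hg2 : g.coeff 2 = -1)
    {ξ : ℂ} (hξ : IsAttractingFixedPointOfLavaurs f ξ) :
    ∃ r > 0, ∃ n₀ : ℕ, 2 ≤ n₀ ∧ ∀ p : ℂ × ℂ, ‖p.1 - ξ‖ ≤ r → ‖1 / p.2 - (n₀ : ℂ) ^ 2‖ ≤ 1 →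
      Tendsto (fun n : ℕ => (skewProduct f g)^[n ^ 2 - n₀ ^ 2] p) atTop (𝓝 (ξ, 0)) := by
  obtain ⟨hbasin, hfix, μ, hder, hμ⟩ := hξ
  obtain ⟨ρ, hρ, hconv⟩ := exists_lavaurs_convergence hf0 hf1 hf2 hbasin
  obtain ⟨l, hl0, hl1, r₁, hr₁, hcontr⟩ := exists_closedBall_norm_sub_le hfix hder hμ
  obtain ⟨N₀, hN₀, horb, hdrive⟩ := exists_parabolic_orbit hg0 hg1 hg2
  -- The times n² - n₀² and (n+1)² - n₀² are 2n+1 apart, one passage. The threshold n₁ depends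
  -- neither on n₀ nor on p, so n₀ can be chosen beyond it afterwards.
  have hstep : ∀ η > 0, ∃ n₁ : ℕ, ∀ n₀ : ℕ, N₀ ≤ n₀ → ∀ p : ℂ × ℂ, ‖1 / p.2 - (n₀ : ℂ) ^ 2‖ ≤ 1 →
      ∀ n : ℕ, n₁ ≤ n → n₀ ≤ n →
      ‖((skewProduct f g)^[n ^ 2 - n₀ ^ 2] p).1 - ξ‖ ≤ min ρ r₁ →
      ‖((skewProduct f g)^[(n + 1) ^ 2 - n₀ ^ 2] p).1 - ξ‖ ≤
        l * ‖((skewProduct f g)^[n ^ 2 - n₀ ^ 2] p).1 - ξ‖ + η := by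
    intro η hη
    obtain ⟨σ, hσ, n₁, h1⟩ := hconv η hη
    obtain ⟨n₂, h2⟩ := hdrive σ hσ
    refine ⟨max n₁ n₂, fun n₀ hn₀ p hp n hn hn₀n hz => ?_⟩
    have hsq : n₀ ^ 2 ≤ n ^ 2 := Nat.pow_le_pow_left hn₀n 2
    have e : (n + 1) ^ 2 - n₀ ^ 2 = n ^ 2 - n₀ ^ 2 + (2 * n + 1) := by
      have : (n + 1) ^ 2 = n ^ 2 + (2 * n + 1) := by ring
      omega
    have h3 := h1 n (by omega) (fun m => ((skewProduct f g)^[n ^ 2 - n₀ ^ 2 + m] p).1)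
      (fun m => (Real.pi : ℂ) ^ 2 / 4 * ((skewProduct f g)^[n ^ 2 - n₀ ^ 2 + m] p).2)
      (by simpa [dist_eq_norm] using hz.trans (min_le_left _ _))
      (fun m _ => skewProduct_iterate_succ_fst f g p _)
      (fun m hm => by
        rw [skewProduct_iterate_snd]
        exact h2 n₀ hn₀ p.2 hp n (by omega) hn₀n m hm)
    have h4 := hcontr _ (by simpa [dist_eq_norm] using hz.trans (min_le_right _ _))
    rw [← e, add_zero] at h3
    set z' := ((skewProduct f g)^[(n + 1) ^ 2 - n₀ ^ 2] p).1
    set z := ((skewProduct f g)^[n ^ 2 - n₀ ^ 2] p).1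
    have e' : z' - ξ = (z' - lavaursMap f z) + (lavaursMap f z - ξ) := by ring
    rw [e']
    refine (norm_add_le _ _).trans ?_
    linarith
  set r := min ρ r₁ with hr
  have hr0 : 0 < r := lt_min hρ hr₁
  -- An error of (1-l)r keeps the disc of radius r invariant, since lr + (1-l)r = r.
  obtain ⟨n₁, hn₁⟩ := hstep ((1 - l) * r) (mul_pos (by linarith) hr0)
  refine ⟨r, hr0, max N₀ n₁, by omega, fun p hp1 hp2 => ?_⟩
  set n₀ := max N₀ n₁ with hn₀
  have hw : ∀ j, ‖((skewProduct f g)^[j] p).2‖ ≤ 2 / ((n₀ : ℝ) ^ 2 + j) := fun j => by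
    rw [skewProduct_iterate_snd]
    exact horb n₀ (le_max_left _ _) p.2 hp2 j
  have hstay : ∀ n, n₀ ≤ n → ‖((skewProduct f g)^[n ^ 2 - n₀ ^ 2] p).1 - ξ‖ ≤ r := by
    intro n hn
    induction n, hn using Nat.le_induction with
    | base => simpa using hp1
    | succ n hn ih =>
      refine (hn₁ n₀ (le_max_left _ _) p hp2 n ((le_max_right _ _).trans hn) hn ih).trans ?_
      nlinarith
  have hz : Tendsto (fun n : ℕ => ((skewProduct f g)^[n ^ 2 - n₀ ^ 2] p).1) atTop (𝓝 ξ) := by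
    rw [tendsto_iff_norm_sub_tendsto_zero]
    refine tendsto_zero_of_eventually_le_mul_add (fun _ => norm_nonneg _) hl0 hl1 fun η hη => ?_
    obtain ⟨n₂, hn₂⟩ := hstep η hη
    filter_upwards [eventually_ge_atTop n₂, eventually_ge_atTop n₀] with n h3 h4
    exact hn₂ n₀ (le_max_left _ _) p hp2 n h3 h4 (hstay n h4)
  have hw0 : Tendsto (fun j : ℕ => ((skewProduct f g)^[j] p).2) atTop (𝓝 0) := by
    refine squeeze_zero_norm hw ?_
    exact tendsto_const_nhds.div_atTop
      (tendsto_atTop_add_const_left _ _ tendsto_natCast_atTop_atTop)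
  exact hz.prodMk_nhds (hw0.comp (tendsto_sq_sub_sq n₀))

/-! ### Vitali-type propagation of convergence -/

section Vitali

variable {E : Type*} [NormedAddCommGroup E] [NormedSpace ℂ E]

/-- Each Taylor term is an integral over the circle of radius ρ, where the functions converge
pointwise and are bounded, so dominated convergence applies. -/
lemma tendsto_cauchyPowerSeries_apply {h : ℕ → ℂ → E} {c : E} {ρ M : ℝ} (hρ : 0 < ρ)
    (hd : ∀ n, Continuous (h n)) (hM : ∀ᶠ n in atTop, ∀ ζ, ‖ζ‖ ≤ ρ → ‖h n ζ‖ ≤ M)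
    (hc : ∀ ζ, ‖ζ‖ ≤ ρ → Tendsto (fun n => h n ζ) atTop (𝓝 c)) (ζ : ℂ) (k : ℕ) :
    Tendsto (fun n => cauchyPowerSeries (h n) 0 ρ k fun _ => ζ) atTop
      (𝓝 (cauchyPowerSeries (fun _ => c) 0 ρ k fun _ => ζ)) := by
  have hcirc : ∀ θ, ‖circleMap 0 ρ θ‖ = ρ := fun θ => by
    rw [norm_circleMap_zero, abs_of_pos hρ]
  have hne : ∀ θ, circleMap 0 ρ θ ≠ 0 := fun θ => norm_pos_iff.1 (by rw [hcirc]; exact hρ)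
  simp only [cauchyPowerSeries_apply, circleIntegral]
  refine Tendsto.const_smul ?_ _
  refine intervalIntegral.tendsto_integral_filter_of_dominated_convergence
    (fun _ => ρ * ((‖ζ‖ / ρ) ^ k * (ρ⁻¹ * M))) ?_ ?_ intervalIntegrable_const ?_
  · refine Eventually.of_forall fun n => Continuous.aestronglyMeasurable ?_
    simp only [sub_zero, deriv_circleMap]
    have h1 : Continuous fun θ => circleMap 0 ρ θ := continuous_circleMap 0 ρ
    have h2 : Continuous fun θ => (circleMap 0 ρ θ)⁻¹ := h1.inv₀ hne
    simp only [div_eq_mul_inv]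
    exact (h1.mul continuous_const).smul
      (((continuous_const.mul h2).pow k).smul (h2.smul ((hd n).comp h1)))
  · filter_upwards [hM] with n hn
    refine Eventually.of_forall fun θ _ => ?_
    rw [norm_smul, norm_smul, norm_smul, deriv_circleMap, norm_mul, norm_pow, norm_div, norm_inv,
      sub_zero, hcirc, Complex.norm_I, mul_one]
    gcongr
    exact hn _ (hcirc θ).le
  · refine Eventually.of_forall fun θ _ => ?_
    exact ((hc _ (hcirc θ).le).const_smul _).const_smul _ |>.const_smul _

/-- A bounded sequence of entire functions that converges to a constant on a small disc converges to
it on every concentric disc where it is bounded. -/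
theorem tendsto_of_tendsto_on_small_disc [CompleteSpace E] {h : ℕ → ℂ → E} {c : E} {ρ R M : ℝ}
    (hρ : 0 < ρ) (hρR : ρ ≤ R) (hd : ∀ n, Differentiable ℂ (h n))
    (hM : ∀ᶠ n in atTop, ∀ ζ, ‖ζ‖ ≤ R → ‖h n ζ‖ ≤ M)
    (hc : ∀ ζ, ‖ζ‖ ≤ ρ → Tendsto (fun n => h n ζ) atTop (𝓝 c)) {ζ : ℂ} (hζ : ‖ζ‖ < R) :
    Tendsto (fun n => h n ζ) atTop (𝓝 c) := by
  have hR : 0 < R := hρ.trans_le hρR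
  lift ρ to NNReal using hρ.le
  lift R to NNReal using hR.le
  have hρ' : 0 < ρ := by exact_mod_cast hρ
  have hR' : 0 < R := by exact_mod_cast hR
  have hs : ∀ F : ℂ → E, Differentiable ℂ F →
      F ζ = ∑' k, cauchyPowerSeries F 0 ρ k fun _ => ζ := fun F hF => by
    have h1 := (hF.hasFPowerSeriesOnBall 0 hρ').hasSum (y := ζ) (by simp)
    rw [zero_add] at h1
    exact h1.tsum_eq.symm
  simp only [fun n => hs (h n) (hd n)]
  rw [show c = ∑' k, cauchyPowerSeries (fun _ => c) 0 ρ k fun _ => ζ from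
    hs (fun _ => c) (differentiable_const c)]
  have hq : ‖ζ‖ / R < 1 := (div_lt_one hR).2 hζ
  refine tendsto_tsum_of_dominated_convergence (bound := fun k => M * (‖ζ‖ / R) ^ k)
    ((summable_geometric_of_lt_one (by positivity) hq).mul_left M)
    (tendsto_cauchyPowerSeries_apply hρ (fun n => (hd n).continuous)
      (hM.mono fun n hn ζ hζ => hn ζ (hζ.trans hρR)) hc ζ) ?_
  filter_upwards [hM] with n hn k
  -- By uniqueness of the expansion, the coefficients obtained on the small circle, where
  -- convergence is known, equal those on the large circle, whose Cauchy bounds give a summable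
  -- geometric majorant.
  rw [((hd n).hasFPowerSeriesOnBall 0 hρ').hasFPowerSeriesAt.eq_formalMultilinearSeries
    ((hd n).hasFPowerSeriesOnBall 0 hR').hasFPowerSeriesAt]
  refine (ContinuousMultilinearMap.le_opNorm _ _).trans ?_
  have h1 := norm_cauchyPowerSeries_le (h n) 0 R k
  have h2 : (2 * Real.pi)⁻¹ * ∫ θ : ℝ in 0..2 * Real.pi, ‖h n (circleMap 0 R θ)‖ ≤ M := by
    have h3 := intervalIntegral.norm_integral_le_of_norm_le_const (a := 0) (b := 2 * Real.pi) (C := M)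
      (f := fun θ => ‖h n (circleMap 0 R θ)‖) (fun θ _ => by
        rw [norm_norm]
        exact hn _ (by rw [norm_circleMap_zero, abs_of_pos hR]))
    rw [sub_zero, abs_of_pos Real.two_pi_pos] at h3
    have h4 := (le_abs_self _).trans h3
    rw [inv_mul_le_iff₀ Real.two_pi_pos]
    linarith
  rw [Finset.prod_const, Finset.card_univ, Fintype.card_fin, div_pow, div_eq_mul_inv, ← mul_assoc,
    mul_right_comm]
  refine mul_le_mul_of_nonneg_right (h1.trans ?_) (by positivity)
  rw [abs_of_pos hR, inv_pow]
  gcongr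

/-- Propagation of convergence to a constant along a ball where a sequence of entire maps is
bounded. -/
theorem tendsto_of_tendsto_near {V : Type*} [NormedAddCommGroup V] [NormedSpace ℂ V]
    [CompleteSpace E] {F : ℕ → V → E} {c : E} {y₀ : V} {R M : ℝ}
    (hd : ∀ n, Differentiable ℂ (F n))
    (hM : ∀ᶠ n in atTop, ∀ y ∈ Metric.ball y₀ R, ‖F n y‖ ≤ M)
    (hc : ∀ᶠ y in 𝓝 y₀, Tendsto (fun n => F n y) atTop (𝓝 c)) {y : V} (hy : y ∈ Metric.ball y₀ R) :
    Tendsto (fun n => F n y) atTop (𝓝 c) := by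
  -- Restriction to the complex line through y₀ and y reduces to one variable; q > 1 places the
  -- parameter 1 of y inside the disc.
  set l : ℂ → V := fun ζ => y₀ + ζ • (y - y₀) with hl
  have hld : Differentiable ℂ l := by fun_prop
  have hl0 : l 0 = y₀ := by simp [hl]
  have hl1 : l 1 = y := by simp [hl]
  rw [mem_ball_iff_norm] at hy
  obtain ⟨q, hq1, hq⟩ : ∃ q : ℝ, 1 < q ∧ q * ‖y - y₀‖ < R := by
    have h1 : ∀ᶠ q in 𝓝[>] (1 : ℝ), q * ‖y - y₀‖ < R := by
      refine (Continuous.tendsto' (by fun_prop) 1 _ (by ring)).mono_left nhdsWithin_le_nhds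
        |>.eventually_lt_const hy
    obtain ⟨q, h2, h3⟩ := (h1.and self_mem_nhdsWithin).exists
    exact ⟨q, h3, h2⟩
  have h1 : ∀ᶠ ζ in 𝓝 (0 : ℂ), Tendsto (fun n => F n (l ζ)) atTop (𝓝 c) :=
    (hld.continuous.tendsto' 0 y₀ hl0).eventually hc
  obtain ⟨ρ, hρ, h2⟩ := Metric.nhds_basis_closedBall.eventually_iff.1 h1
  rw [← hl1]
  refine tendsto_of_tendsto_on_small_disc (h := fun n ζ => F n (l ζ)) (ρ := min ρ 1) (R := q) (M := M)
    (lt_min hρ one_pos) ((min_le_right _ _).trans hq1.le) (fun n => (hd n).comp hld) ?_ ?_ ?_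
  · filter_upwards [hM] with n hn ζ hζ
    refine hn _ ?_
    rw [mem_ball_iff_norm, hl, add_sub_cancel_left, norm_smul]
    exact lt_of_le_of_lt (by gcongr) hq
  · intro ζ hζ
    exact h2 (by simpa using hζ.trans (min_le_left _ _))
  · simpa using hq1

end Vitali

/-! ### Chordal distance, equicontinuity and Fatou components -/

lemma chordalDist_comm (p q : ℂ × ℂ) : chordalDist p q = chordalDist q p := by
  rw [chordalDist, chordalDist, norm_sub_rev p.1, norm_sub_rev p.2, norm_sub_rev (p.1 * q.2),
    mul_comm (√(‖p.1‖ ^ 2 + ‖p.2‖ ^ 2 + 1))]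

lemma chordalDist_le_mul_dist (B : ℝ) (hB : 0 ≤ B) (p q : ℂ × ℂ) (hq : ‖q‖ ≤ B) :
    chordalDist p q ≤ (2 + 2 * B) * dist p q := by
  have h1 : ‖p.1 - q.1‖ ≤ dist p q := by
    rw [dist_eq_norm]; exact norm_fst_le (p - q)
  have h2 : ‖p.2 - q.2‖ ≤ dist p q := by
    rw [dist_eq_norm]; exact norm_snd_le (p - q)
  have h3 : ‖p.1 * q.2 - q.1 * p.2‖ ≤ 2 * B * dist p q := by
    have e : p.1 * q.2 - q.1 * p.2 = (p.1 - q.1) * q.2 - q.1 * (p.2 - q.2) := by ring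
    rw [e]
    refine (norm_sub_le _ _).trans ?_
    rw [norm_mul, norm_mul]
    have h4 : ‖p.1 - q.1‖ * ‖q.2‖ ≤ dist p q * B := by
      gcongr; exact (norm_snd_le q).trans hq
    have h5 : ‖q.1‖ * ‖p.2 - q.2‖ ≤ B * dist p q := by
      gcongr; exact (norm_fst_le q).trans hq
    linarith
  have h0 : 0 ≤ dist p q := dist_nonneg
  have h6 : √(‖p.1 - q.1‖ ^ 2 + ‖p.2 - q.2‖ ^ 2 + ‖p.1 * q.2 - q.1 * p.2‖ ^ 2) ≤
      (2 + 2 * B) * dist p q := by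
    refine Real.sqrt_le_iff.2 ⟨by positivity, ?_⟩
    have h7 : ‖p.1 - q.1‖ ^ 2 + ‖p.2 - q.2‖ ^ 2 + ‖p.1 * q.2 - q.1 * p.2‖ ^ 2 ≤
        dist p q ^ 2 + dist p q ^ 2 + (2 * B * dist p q) ^ 2 := by gcongr
    refine h7.trans ?_
    have : 0 ≤ B * dist p q ^ 2 := by positivity
    nlinarith [sq_nonneg (dist p q)]
  have h8 : ∀ v : ℂ × ℂ, 1 ≤ √(‖v.1‖ ^ 2 + ‖v.2‖ ^ 2 + 1) := fun v =>
    Real.one_le_sqrt.2 (by linarith [sq_nonneg ‖v.1‖, sq_nonneg ‖v.2‖])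
  rw [chordalDist]
  refine (div_le_self (Real.sqrt_nonneg _) ?_).trans h6
  nlinarith [h8 p, h8 q]

/-- Points of a bounded set have chordal distance bounded below from a neighbourhood of the line at
infinity. Projective equicontinuity thus yields Euclidean bounds at those times when one orbit is
bounded. -/
lemma norm_le_of_chordalDist_lt {B : ℝ} (hB : 0 ≤ B) {p q : ℂ × ℂ} (hp : ‖p‖ ≤ B)
    (h : chordalDist p q < 1 / (4 * (2 * B + 1))) : ‖q‖ ≤ 2 * B + 1 := by
  by_contra! hq
  have hp1 := (norm_fst_le p).trans hp
  have hp2 := (norm_snd_le p).trans hp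
  have hq1 := norm_fst_le q
  have hq2 := norm_snd_le q
  set t := ‖q‖ with ht
  have hnum : (t + 1) / 2 ≤ √(‖p.1 - q.1‖ ^ 2 + ‖p.2 - q.2‖ ^ 2 + ‖p.1 * q.2 - q.1 * p.2‖ ^ 2) := by
    refine Real.le_sqrt_of_sq_le ?_
    rcases max_choice ‖q.1‖ ‖q.2‖ with hm | hm
    · have h1 : ‖q.1‖ = t := by rw [ht, Prod.norm_def, hm]
      have h2 : (t + 1) / 2 ≤ ‖p.1 - q.1‖ := by
        have := norm_sub_norm_le q.1 p.1
        rw [norm_sub_rev] at this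
        linarith
      have h3 := pow_le_pow_left₀ (by linarith) h2 2
      linarith [sq_nonneg ‖p.2 - q.2‖, sq_nonneg ‖p.1 * q.2 - q.1 * p.2‖]
    · have h1 : ‖q.2‖ = t := by rw [ht, Prod.norm_def, hm]
      have h2 : (t + 1) / 2 ≤ ‖p.2 - q.2‖ := by
        have := norm_sub_norm_le q.2 p.2
        rw [norm_sub_rev] at this
        linarith
      have h3 := pow_le_pow_left₀ (by linarith) h2 2
      linarith [sq_nonneg ‖p.1 - q.1‖, sq_nonneg ‖p.1 * q.2 - q.1 * p.2‖]
  have hden : ∀ (v : ℂ × ℂ) (s : ℝ), 0 ≤ s → ‖v.1‖ ≤ s → ‖v.2‖ ≤ s →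
      √(‖v.1‖ ^ 2 + ‖v.2‖ ^ 2 + 1) ≤ 2 * s + 1 := fun v s hs h1 h2 => by
    refine Real.sqrt_le_iff.2 ⟨by positivity, ?_⟩
    have h3 := pow_le_pow_left₀ (norm_nonneg _) h1 2
    have h4 := pow_le_pow_left₀ (norm_nonneg _) h2 2
    nlinarith
  have hpos : ∀ v : ℂ × ℂ, 0 < √(‖v.1‖ ^ 2 + ‖v.2‖ ^ 2 + 1) := fun v => by positivity
  rw [chordalDist, div_lt_div_iff₀ (mul_pos (hpos p) (hpos q)) (by positivity), one_mul] at h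
  have h1 := mul_le_mul (hden p B hB hp1 hp2) (hden q t (by linarith) hq1 hq2) (hpos q).le
    (by positivity)
  nlinarith

/-- Iterates of an entire map that are uniformly bounded on an open set are equicontinuous there. -/
theorem iteratesEquicontinuousOn_of_norm_le {P : ℂ × ℂ → ℂ × ℂ} (hP : Differentiable ℂ P)
    {U : Set (ℂ × ℂ)} (hU : IsOpen U) {B : ℝ} (hB : ∀ n, ∀ x ∈ U, ‖P^[n] x‖ ≤ B) :
    IteratesEquicontinuousOn P U := by
  intro x hx ε hε
  have hB0 : 0 ≤ B := (norm_nonneg _).trans (hB 0 x hx)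
  obtain ⟨r, hr, hball⟩ := Metric.isOpen_iff.1 hU x hx
  have hlim : Tendsto (fun y => (2 + 2 * B) * (2 * B / r * dist y x)) (𝓝 x) (𝓝 0) :=
    Continuous.tendsto' (by fun_prop) _ _ (by simp)
  filter_upwards [hlim.eventually_lt_const hε, Metric.ball_mem_nhds x hr] with y hy hyr n
  refine lt_of_le_of_lt ?_ hy
  -- The Schwarz lemma gives a Lipschitz bound independent of the iterate.
  have h1 := Complex.dist_le_div_mul_dist_of_mapsTo_ball (f := P^[n]) (c := x) (z := y) (R₁ := r)
    (R₂ := 2 * B) (hP.iterate n).differentiableOn (fun u hu => by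
      rw [mem_closedBall_iff_norm]
      refine (norm_sub_le _ _).trans ?_
      linarith [hB n u (hball hu), hB n x hx]) hyr
  refine (chordalDist_le_mul_dist B hB0 _ _ (hB n y (hball hyr))).trans ?_
  rw [dist_comm]
  gcongr

/-- If iterates of an entire map along a subsequence tend to a constant near a point of a Fatou
component, then they do so on the whole component. -/
theorem tendsto_of_mem_connectedComponentIn_fatouSet {P : ℂ × ℂ → ℂ × ℂ} (hP : Differentiable ℂ P)
    {s : ℕ → ℕ} {c x₀ : ℂ × ℂ} (hx₀ : x₀ ∈ fatouSet P)
    (hc : ∀ᶠ y in 𝓝 x₀, Tendsto (fun n => P^[s n] y) atTop (𝓝 c)) {x : ℂ × ℂ}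
    (hx : x ∈ connectedComponentIn (fatouSet P) x₀) :
    Tendsto (fun n => P^[s n] x) atTop (𝓝 c) := by
  -- A connectedness argument: A is open, so it remains to show that A contains its limit points in
  -- the component.
  set A := {x | ∀ᶠ y in 𝓝 x, Tendsto (fun n => P^[s n] y) atTop (𝓝 c)} with hA
  have hAo : IsOpen A := isOpen_iff_mem_nhds.2 fun x hx => eventually_eventually_nhds.2 hx
  suffices hsub : connectedComponentIn (fatouSet P) x₀ ⊆ A from (hsub hx).self_of_nhds
  refine isPreconnected_connectedComponentIn.subset_of_closure_inter_subset hAo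
    ⟨x₀, mem_connectedComponentIn hx₀, hc⟩ ?_
  rintro x ⟨hxc, hxF⟩
  obtain ⟨U, ⟨-, hUe⟩, hxU⟩ := connectedComponentIn_subset _ _ hxF
  set B := ‖c‖ + 1 with hB
  have hB0 : 0 ≤ B := by positivity
  set B' := 2 * B + 1 with hB'
  have hB'0 : 0 ≤ B' := by positivity
  -- Equicontinuity compares only with x, so boundedness passes in two hops, from y₀ to x and from x
  -- to y. The constant is chosen for the second hop, which has the larger bound B'.
  have h1 := hUe x hxU (1 / (4 * (2 * B' + 1))) (by positivity)
  obtain ⟨r, hr, hball⟩ := Metric.nhds_basis_ball.eventually_iff.1 h1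
  obtain ⟨y₀, hy₀A, hy₀⟩ := Metric.mem_closure_iff.1 hxc (r / 3) (by positivity)
  have hy₀r : y₀ ∈ Metric.ball x r := by
    rw [Metric.mem_ball, dist_comm]; linarith
  have hlim : Tendsto (fun n => ‖P^[s n] y₀‖) atTop (𝓝 ‖c‖) := hy₀A.self_of_nhds.norm
  have hbd : ∀ᶠ n in atTop, ∀ y ∈ Metric.ball y₀ (2 * r / 3), ‖P^[s n] y‖ ≤ 2 * B' + 1 := by
    filter_upwards [hlim.eventually_lt_const (lt_add_one ‖c‖)] with n hn y hy
    have h2 : ‖P^[s n] x‖ ≤ B' := by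
      refine norm_le_of_chordalDist_lt hB0 (p := P^[s n] y₀) hn.le ?_
      rw [chordalDist_comm]
      refine (hball hy₀r (s n)).trans_le ?_
      gcongr
      linarith
    refine norm_le_of_chordalDist_lt hB'0 h2 (hball ?_ (s n))
    rw [Metric.mem_ball] at hy ⊢
    have := dist_triangle y y₀ x
    rw [dist_comm y₀] at this
    linarith
  filter_upwards [Metric.ball_mem_nhds x (show 0 < r / 3 by positivity)] with y hy
  refine tendsto_of_tendsto_near (F := fun n => P^[s n]) (fun n => hP.iterate _) hbd hy₀A ?_
  rw [Metric.mem_ball] at hy ⊢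
  have := dist_triangle y x y₀
  linarith

/-! ### Global facts on the skew product, and the conclusion -/

lemma differentiable_skewProduct (f g : ℂ[X]) : Differentiable ℂ (skewProduct f g) :=
  ((f.differentiable.comp differentiable_fst).add (differentiable_snd.const_mul _)).prodMk
    (g.differentiable.comp differentiable_snd)

lemma skewProduct_iterate_zero {f g : ℂ[X]} (hg0 : g.coeff 0 = 0) (z : ℂ) (n : ℕ) :
    (skewProduct f g)^[n] (z, 0) = ((fun x => f.eval x)^[n] z, 0) := by
  induction n with
  | zero => rfl
  | succ n ih =>
    rw [Function.iterate_succ_apply', Function.iterate_succ_apply', ih, skewProduct]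
    simp [← coeff_zero_eq_eval_zero, hg0]

/-- Points of the parabolic basin are not preperiodic. -/
lemma iterate_injective_of_mem_parabolicBasin {f : ℂ[X]} {ξ : ℂ} (hξ : ξ ∈ parabolicBasin f) :
    Function.Injective fun n : ℕ => (fun x => f.eval x)^[n] ξ := by
  suffices h : ∀ i j : ℕ, i < j → (fun x => f.eval x)^[i] ξ ≠ (fun x => f.eval x)^[j] ξ by
    intro i j hij
    by_contra hne
    rcases lt_or_gt_of_ne hne with h' | h'
    · exact h i j h' hij
    · exact h j i h' hij.symm
  intro i j hij h
  set F : ℂ → ℂ := fun x => f.eval x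
  have hfix : F^[j - i] (F^[i] ξ) = F^[i] ξ := by
    rw [← Function.iterate_add_apply, Nat.sub_add_cancel hij.le, h]
  have hconst : ∀ k : ℕ, F^[(j - i) * k + i] ξ = F^[i] ξ := fun k => by
    rw [Function.iterate_add_apply, Function.iterate_mul, Function.iterate_fixed hfix]
  have ht : Tendsto (fun k : ℕ => (j - i) * k + i) atTop atTop :=
    tendsto_atTop_mono (fun k => (Nat.le_mul_of_pos_left k (by omega)).trans (Nat.le_add_right _ _))
      tendsto_id
  have h1 := hξ.1.comp ht
  simp only [Function.comp_def] at h1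
  simp only [show ∀ k : ℕ, (fun x => f.eval x)^[(j - i) * k + i] ξ = F^[i] ξ from hconst] at h1
  exact hξ.2 i (tendsto_nhds_unique tendsto_const_nhds h1)

lemma isOpen_norm_one_div_sub_lt (a : ℂ) : IsOpen {w : ℂ | w ≠ 0 ∧ ‖1 / w - a‖ < 1} := by
  have h : ContinuousOn (fun w : ℂ => ‖1 / w - a‖) {w | w ≠ 0} :=
    ((continuousOn_const.div continuousOn_id fun _ h => h).sub continuousOn_const).norm
  exact h.isOpen_inter_preimage isOpen_ne isOpen_Iio

/-- There is a bound for all orbits of the skew product that return to a bounded region infinitely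
often and whose second coordinates are infinitely often in the unit disc. -/
lemma exists_norm_iterate_le {f g : ℂ[X]} (hf0 : f.coeff 0 = 0) (hf2 : f.coeff 2 ≠ 0)
    (hg0 : g.coeff 0 = 0) (hg2 : g.coeff 2 ≠ 0) :
    ∃ B : ℝ, ∀ (c : ℂ) (s : ℕ → ℕ), Tendsto s atTop atTop → ∀ p : ℂ × ℂ,
      Tendsto (fun n => (skewProduct f g)^[s n] p) atTop (𝓝 (c, 0)) →
      ∀ n, ‖(skewProduct f g)^[n] p‖ ≤ B := by
  obtain ⟨R, hR, hgR⟩ := exists_two_mul_norm_add_le_norm_eval hg0 hg2 0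
  obtain ⟨S, hS, hfS⟩ := exists_two_mul_norm_add_le_norm_eval hf0 hf2 (4 * R)
  refine ⟨max S R, fun c s hs p hp => ?_⟩
  have hfreq : ∀ u : ℕ → ℂ, ∀ a : ℂ, Tendsto (fun n => u (s n)) atTop (𝓝 a) →
      ∃ᶠ n in atTop, ‖u n‖ ≤ ‖a‖ + 1 := fun u a h =>
    hs.frequently (p := fun n => ‖u n‖ ≤ ‖a‖ + 1)
      (h.norm.eventually_le_const (lt_add_one ‖a‖)).frequently
  have hw : ∀ n, ‖((skewProduct f g)^[n] p).2‖ < R := by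
    refine norm_lt_of_frequently_le (one_pos.trans_le hR) (fun n hn => ?_) (hfreq _ 0 hp.snd_nhds)
    have := hgR _ hn
    rw [Function.iterate_succ_apply']
    change _ ≤ ‖g.eval _‖
    linarith
  have hz : ∀ n, ‖((skewProduct f g)^[n] p).1‖ < S := by
    refine norm_lt_of_frequently_le (one_pos.trans_le hS) (fun n hn => ?_) (hfreq _ c hp.fst_nhds)
    have h1 := hfS _ hn
    have h2 : ‖(Real.pi : ℂ) ^ 2 / 4 * ((skewProduct f g)^[n] p).2‖ ≤ 4 * R := by
      rw [norm_mul, norm_div, norm_pow, Complex.norm_real, Real.norm_eq_abs, abs_of_pos Real.pi_pos]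
      refine mul_le_mul ?_ (hw n).le (norm_nonneg _) (by norm_num)
      norm_num
      nlinarith [Real.pi_le_four, Real.pi_pos]
    have h3 := norm_sub_le_norm_add (f.eval ((skewProduct f g)^[n] p).1)
      ((Real.pi : ℂ) ^ 2 / 4 * ((skewProduct f g)^[n] p).2)
    rw [skewProduct_iterate_succ_fst]
    linarith
  exact fun n => max_le_max (hz n).le (hw n).le

end LavaursSkew

theorem mainTheorem1 (f g : Polynomial ℂ)
    (hf0 : f.coeff 0 = 0) (hf1 : f.coeff 1 = 1) (hf2 : f.coeff 2 = 1)
    (hg0 : g.coeff 0 = 0) (hg1 : g.coeff 1 = 1) (hg2 : g.coeff 2 = -1)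
    (hL : ∃ ξ : ℂ, LavaursSkew.IsAttractingFixedPointOfLavaurs f ξ) :
    ∃ Ω : Set (ℂ × ℂ),
      LavaursSkew.IsWanderingFatouComponent (LavaursSkew.skewProduct f g) Ω ∧
      ∀ p ∈ Ω, Bornology.IsBounded
        (Set.range fun n : ℕ => (LavaursSkew.skewProduct f g)^[n] p) := by
  obtain ⟨ξ, hξ⟩ := hL
  obtain ⟨r, hr, n₀, hn₀, htend⟩ :=
    LavaursSkew.exists_tendsto_iterate hf0 hf1 hf2 hg0 hg1 hg2 hξ
  obtain ⟨B, hB⟩ := LavaursSkew.exists_norm_iterate_le (f := f) (g := g) hf0 (by simp [hf2]) hg0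
    (by simp [hg2])
  set P := LavaursSkew.skewProduct f g with hP
  have hPd : Differentiable ℂ P := LavaursSkew.differentiable_skewProduct f g
  set U : Set (ℂ × ℂ) := Metric.ball ξ r ×ˢ {w : ℂ | w ≠ 0 ∧ ‖1 / w - (n₀ : ℂ) ^ 2‖ < 1}
  have hUo : IsOpen U :=
    Metric.isOpen_ball.prod (LavaursSkew.isOpen_norm_one_div_sub_lt _)
  have hUt : ∀ p ∈ U, Tendsto (fun n : ℕ => P^[n ^ 2 - n₀ ^ 2] p) atTop (𝓝 (ξ, 0)) := fun p hp =>
    htend p (mem_ball_iff_norm.1 hp.1).le hp.2.2.le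
  have hs := LavaursSkew.tendsto_sq_sub_sq n₀
  -- The bound B does not depend on the point. It gives equicontinuity on U here, and boundedness of
  -- the orbits in the whole component at the end.
  have hUF : U ⊆ LavaursSkew.fatouSet P := Set.subset_sUnion_of_mem ⟨hUo,
    LavaursSkew.iteratesEquicontinuousOn_of_norm_le hPd hUo fun n x hx => hB ξ _ hs x (hUt x hx) n⟩
  have hn₀c : (n₀ : ℂ) ≠ 0 := by exact_mod_cast (by omega : n₀ ≠ 0)
  have hx₀ : (ξ, 1 / (n₀ : ℂ) ^ 2) ∈ U := ⟨Metric.mem_ball_self hr, by simp [hn₀c], by simp⟩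
  have hΩ : ∀ p ∈ connectedComponentIn (LavaursSkew.fatouSet P) (ξ, 1 / (n₀ : ℂ) ^ 2),
      Tendsto (fun n : ℕ => P^[n ^ 2 - n₀ ^ 2] p) atTop (𝓝 (ξ, 0)) := fun p hp =>
    LavaursSkew.tendsto_of_mem_connectedComponentIn_fatouSet hPd (hUF hx₀)
      ((hUo.eventually_mem hx₀).mono hUt) hp
  refine ⟨_, ⟨⟨_, hUF hx₀, rfl⟩, fun i j hij => Set.disjoint_left.2 ?_⟩, fun p hp => ?_⟩
  · rintro _ ⟨x, hx, rfl⟩ ⟨y, hy, hxy⟩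
    -- Since P^k commutes with the iterates and is continuous, the limit along the same times at a
    -- point of P^k(Ω) is P^k(ξ, 0). A point common to two images would have two limits.
    have hlim : ∀ (k : ℕ) (u : ℂ × ℂ),
        Tendsto (fun n : ℕ => P^[n ^ 2 - n₀ ^ 2] u) atTop (𝓝 (ξ, 0)) →
        Tendsto (fun n : ℕ => P^[n ^ 2 - n₀ ^ 2] (P^[k] u)) atTop
          (𝓝 ((fun x => f.eval x)^[k] ξ, 0)) := fun k u hu => by
      have h1 := ((hPd.iterate k).continuous.tendsto (ξ, 0)).comp hu
      rw [LavaursSkew.skewProduct_iterate_zero hg0] at h1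
      refine h1.congr fun n => ?_
      rw [Function.comp_apply, ← Function.iterate_add_apply, ← Function.iterate_add_apply, add_comm]
    have h1 := hlim i x (hΩ x hx)
    have h2 := hlim j y (hΩ y hy)
    rw [hxy] at h2
    exact hij (LavaursSkew.iterate_injective_of_mem_parabolicBasin hξ.1
      (Prod.ext_iff.1 (tendsto_nhds_unique h1 h2)).1)
  · refine isBounded_iff_forall_norm_le.2 ⟨B, ?_⟩
    rintro _ ⟨n, rfl⟩
    exact hB ξ _ hs p (hΩ p hp) n
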